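/- Let $\mathbb K$ be an algebraically closed field of characteristic $0$. Let $(I,A,\cdot)$ be a Borcherds–Cartan datum: $I$ is a finite set, $A=(a_{ij})_{i,j\in I}$ is an integer matrix with $a_{ii}\in\{2,0,-2,-4,\dots\}$ and $a_{ij}\le 0$ for $i\ne j$, and there are integers $r_i>0$ with $i\cdot j=r_ia_{ij}=r_ja_{ji}$ for all $i,j$. Put $I^+=\{i: a_{ii}=2\}$, $I^0=\{i: a_{ii}=0\}$, $I^-=\{i:a_{ii}<0\}$ and $\mathbb I=I^+\cup I^0\cup(I^-\times\mathbb Z_{>0})$; elements of $\mathbb I$ are written $(i,\ell)$, with $\ell=1$ if $i\in I^+\cup I^0$. For a multiset $\nu$ of $n$ elements of $\mathbb I$, $R(\nu)$ is the $\mathbb Z$-graded unital $\mathbb K$-algebra spanned by braid-like diagrams (multiplied by stacking, $ab$ being $a$ on top of $b$, mismatched products being $0$, modulo planar isotopy) generated, for each ordering $\mathbf i=(i_1,\ell_1)\cdots(i_n,\ell_n)$ of $\nu$, by orthogonal idempotents $1_{\mathbf i}$ with sum $1$ (degree $0$), dots $x_k=x_{k,\mathbf i}=1_{\mathbf i}x_{k,\mathbf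 i}1_{\mathbf i}$ (degree $2r_{i_k}$) and crossings $\tau_k=\tau_{k,\mathbf i}=1_{s_k\mathbf i}\tau_{k,\mathbf i}1_{\mathbf i}$ (degree $-\ell_k\ell_{k+1}r_{i_k}a_{i_ki_{k+1}}$), with the following local relations, where strands $k,k+1$ (and $k+2$) of the bottom sequence $\mathbf i$ have colours $(i,\ell),(j,p)$ (and $(h,q)$): * $\tau_k^2 1_{\mathbf i}$ equals $0$ if $i=j\in I^+$; $1_{\mathbf i}$ if $a_{ij}=0$; $\bigl(x_k^{-\ell^2a_{ii}/2}+x_{k+1}^{-\ell^2a_{ii}/2}\bigr)^2 1_{\mathbf i}$ if $i=j\in I^-$ and $\ell=p$; and $\bigl(x_k^{-\ell pa_{ij}}+x_{k+1}^{-\ell pa_{ji}}\bigr)1_{\mathbf i}$ if $(i,\ell)\ne(j,p)$ and $a_{ij}\neq0$. * $(x_k\tau_k-\tau_kx_{k+1})1_{\mathbf i}=(\tau_kx_k-x_{k+1}\tau_k)1_{\mathbf i}$, and this equals $1_{\mathbf i}$ if $i=j\in I^+$ and $0$ otherwise. * $(\tau_k\tau_{k+1}\tau_k-\tau_{k+1}\tau_k\tau_{k+1})1_{\mathbf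 i}$ equals $\sum_{c=0}^{-pa_{ij}-1}x_k^{c}x_{k+2}^{-pa_{ij}-1-c}1_{\mathbf i}$ if $i=h\in I^+$, $i\neq j$ and $a_{ij}\ne0$, and $0$ otherwise. Let $\psi$ be the anti-involution of $R(\nu)$ flipping diagrams about a horizontal axis. On $m$ adjacent strands of the same colour $i$ put $$e_{i,m}=x_1^{m-1}x_2^{m-2}\cdots x_{m-1}\tau_{w_0}\ (i\in I^+),\qquad e_{i,m}=\frac1{m!}\sum_{\omega\in S_m}\tau_\omega\ (i\in I^0),$$ where $x_1,\dots,x_m$ and $\tau_1,\dots,\tau_{m-1}$ are numbered from the left-most of these $m$ strands, $\tau_\omega$ is the product of the $\tau_k$ along a reduced expression of $\omega$, and $w_0$ is the longest element of $S_m$; write $\otimes$ for placing diagrams side by side. A graded module $M$ has shifts $(M\{d\})_n=M_{n-d}$. For a sequence $\mathbf i$ of elements of $\mathbb I$ and divided powers $i_1^{(m_1)},\dots,i_t^{(m_t)}$ with $i_k\in I^+$, $1_{\mathbf i}$ denotes the juxtaposition of the idempotents $e_{i_k,m_k}$ and of the identity strands, $\langle\mathbf i\rangle=\sum_k\frac{m_k(m_k-1)}2r_{i_k}$,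 and $P_{\mathbf i}=R(\nu)\psi(1_{\mathbf i})\{-\langle\mathbf i\rangle\}$. **Proposition (quantum Serre relations).** Let $i\in I^+$, $j\in I$, $i\ne j$, $n\in\mathbb Z_{>0}$ and $m=1-na_{ij}$. There are isomorphisms of graded left $R(\nu)$-modules, with $\nu$ the class of the sequences involved: $$\bigoplus_{c=0}^{\lfloor m/2\rfloor}P_{i^{(2c)}j^ni^{(m-2c)}}\cong\bigoplus_{c=0}^{\lfloor (m-1)/2\rfloor}P_{i^{(2c+1)}j^ni^{(m-2c-1)}}\quad\text{if } j\in I^+,$$ $$\bigoplus_{c=0}^{\lfloor m/2\rfloor}P_{i^{(2c)}(j,n)i^{(m-2c)}}\cong\bigoplus_{c=0}^{\lfloor (m-1)/2\rfloor}P_{i^{(2c+1)}(j,n)i^{(m-2c-1)}}\quad\text{if } j\in I^-,$$ $$\bigoplus_{c=0}^{\lfloor m/2\rfloor}R(i^mj^n)\,\psi(e_{i,2c}\otimes e_{j,n}\otimes e_{i,m-2c})\{-\langle i^{(2c)}i^{(m-2c)}\rangle\}\cong\bigoplus_{c=0}^{\lfloor (m-1)/2\rfloor}R(i^mj^n)\,\psi(e_{i,2c+1}\otimes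 e_{j,n}\otimes e_{i,m-2c-1})\{-\langle i^{(2c+1)}i^{(m-2c-1)}\rangle\}\quad\text{if } j\in I^0.$$ Moreover, for any $i,j\in I$ with $a_{ij}=0$, and all $\ell,k$, there are isomorphisms of graded left modules (without shift) $$P_{(i,\ell)(j,k)}\cong P_{(j,k)(i,\ell)}\quad\text{if }(i,\ell),(j,k)\in\mathbb I,$$ $$R(i^\ell(j,k))\cdot e_{i,\ell}\otimes1_{(j,k)}\cong R(i^\ell(j,k))\cdot1_{(j,k)}\otimes e_{i,\ell}\quad\text{if } i\in I^0,\ (j,k)\in\mathbb I,$$ $$R(i^\ell j^k)\cdot e_{i,\ell}\otimes e_{j,k}\cong R(i^\ell j^k)\cdot e_{j,k}\otimes e_{i,\ell}\quad\text{if } i,j\in I^0.$$ -/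

import Mathlib

open scoped DirectSum

namespace BorcherdsKLR

/-- A Borcherds–Cartan datum: an integer matrix `a` with diagonal entries in
`{2, 0, -2, -4, …}`, nonpositive off-diagonal entries, and positive integers `r i` such that
`diag(r) * a` is symmetric.  The associated bilinear form is `i · j = r i * a i j`. -/
structure Datum (I : Type*) where
  a : Matrix I I ℤ
  r : I → ℤ
  diag : ∀ i, a i i = 2 ∨ (a i i ≤ 0 ∧ Even (a i i))
  offDiag : ∀ i j, i ≠ j → a i j ≤ 0
  r_pos : ∀ i, 0 < r i
  symm : ∀ i j, r i * a i j = r j * a j i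

variable {I : Type*}

/-- Real indices `I⁺`. -/
def Datum.IsReal (D : Datum I) (i : I) : Prop := D.a i i = 2

/-- Indices in `I⁰`. -/
def Datum.IsZero (D : Datum I) (i : I) : Prop := D.a i i = 0

/-- Indices in `I⁻`. -/
def Datum.IsNeg (D : Datum I) (i : I) : Prop := D.a i i < 0

/-- The set of colours `I⁺ ∪ I⁰ ∪ (I⁻ × ℤ_{>0})`.  An element is a pair `(i, ℓ)` with `ℓ ≥ 1`,
where `ℓ = 1` unless `i ∈ I⁻`. -/
@[ext] structure Color (D : Datum I) where
  idx : I
  mult : ℕ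
  mult_pos : 0 < mult
  mult_eq_one : ¬ D.IsNeg idx → mult = 1

/-- `i ∈ I⁺` as a colour. -/
def Color.real {D : Datum I} (i : I) (_hi : D.IsReal i) : Color D where
  idx := i
  mult := 1
  mult_pos := one_pos
  mult_eq_one := fun _ => rfl

/-- `i ∈ I⁰` as a colour. -/
def Color.zero {D : Datum I} (i : I) (_hi : D.IsZero i) : Color D where
  idx := i
  mult := 1
  mult_pos := one_pos
  mult_eq_one := fun _ => rfl

/-- `(i, ℓ)` with `i ∈ I⁻` and `ℓ ≥ 1` as a colour. -/
def Color.neg {D : Datum I} (i : I) (hi : D.IsNeg i) (l : ℕ) (hl : 0 < l) : Color D where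
  idx := i
  mult := l
  mult_pos := hl
  mult_eq_one := fun h => absurd hi h

section Sequences

variable {D : Datum I}

/-- For a multiset `ν` of colours (an equivalence class of sequences up to permutation),
the sequences belonging to `ν`. -/
@[ext] structure Seq (ν : Multiset (Color D)) where
  entry : Fin (Multiset.card ν) → Color D
  map_entry : Finset.univ.val.map entry = ν

instance Seq.instFinite (ν : Multiset (Color D)) : Finite (Seq ν) := by
  have : Finite {c // c ∈ ν} := Multiset.finite_toSet ν
  refine Finite.of_injective
    (fun (s : Seq ν) (k : Fin (Multiset.card ν)) =>
      (⟨s.entry k, by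
        have h := Multiset.mem_map_of_mem s.entry (Finset.mem_univ_val k)
        rwa [s.map_entry] at h⟩ : {c // c ∈ ν})) ?_
  intro s t h
  apply Seq.ext
  funext k
  exact congrArg Subtype.val (congrFun h k)

noncomputable instance Seq.instFintype (ν : Multiset (Color D)) : Fintype (Seq ν) :=
  Fintype.ofFinite _

variable {ν : Multiset (Color D)}

/-- The colour in position `k`; positions are numbered from `0`. -/
def Seq.at (s : Seq ν) (k : ℕ) (hk : k < Multiset.card ν) : Color D := s.entry ⟨k, hk⟩

/-- The sequence `s_k s`, with the entries in positions `k`, `k + 1` exchanged. -/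
def Seq.swap (s : Seq ν) (k : ℕ) (hk : k + 1 < Multiset.card ν) : Seq ν where
  entry := s.entry ∘ Equiv.swap ⟨k, Nat.lt_of_succ_lt hk⟩ ⟨k + 1, hk⟩
  map_entry := by
    have h := congrArg Finset.val (Finset.map_univ_equiv
      (Equiv.swap (⟨k, Nat.lt_of_succ_lt hk⟩ : Fin (Multiset.card ν)) ⟨k + 1, hk⟩))
    rw [Finset.map_val] at h
    rw [← Multiset.map_map]
    exact (congrArg (Multiset.map s.entry) h).trans s.map_entry

/-- A list of colours as an element of the class `ν` of its permutations. -/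
def Seq.ofList (l : List (Color D)) (h : (l : Multiset (Color D)) = ν) : Seq ν where
  entry := fun k => l.get (k.cast (by rw [← h, Multiset.coe_card]))
  map_entry := by
    subst h
    have h2 := List.ofFn_get l
    rw [List.ofFn_eq_map] at h2
    exact congrArg (fun t : List (Color D) => (t : Multiset (Color D))) h2


theorem Seq.swap_swap (s : Seq ν) (k : ℕ) (hk : k + 1 < Multiset.card ν) :
    (s.swap k hk).swap k hk = s := by
  ext x
  all_goals simp [Seq.swap]

theorem Seq.at_swap_left (s : Seq ν) (k : ℕ) (hk : k + 1 < Multiset.card ν)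
    (hk' : k < Multiset.card ν) : (s.swap k hk).at k hk' = s.at (k + 1) hk := by
  simp [Seq.at, Seq.swap]

theorem Seq.at_swap_right (s : Seq ν) (k : ℕ) (hk : k + 1 < Multiset.card ν) :
    (s.swap k hk).at (k + 1) hk = s.at k (Nat.lt_of_succ_lt hk) := by
  simp [Seq.at, Seq.swap]

theorem Seq.at_swap_of_ne (s : Seq ν) (k l : ℕ) (hk : k + 1 < Multiset.card ν)
    (hl : l < Multiset.card ν) (h : l ≠ k) (h' : l ≠ k + 1) :
    (s.swap k hk).at l hl = s.at l hl := by
  simp only [Seq.at, Seq.swap, Function.comp_apply]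
  rw [Equiv.swap_apply_of_ne_of_ne] <;> simpa [Fin.ext_iff]

theorem Seq.ext_at {s t : Seq ν} (h : ∀ k hk, s.at k hk = t.at k hk) : s = t :=
  Seq.ext (funext fun k => h k.1 k.2)

theorem Seq.at_swap (s : Seq ν) (k l : ℕ) (hk : k + 1 < Multiset.card ν)
    (hl : l < Multiset.card ν) :
    (s.swap k hk).at l hl =
      if l = k then s.at (k + 1) hk else
      if l = k + 1 then s.at k (Nat.lt_of_succ_lt hk) else s.at l hl := by
  split_ifs with h h'
  · subst h; exact s.at_swap_left _ _ _
  · subst h'; exact s.at_swap_right _ _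
  · exact s.at_swap_of_ne _ _ _ _ h h'

theorem Seq.swap_eq_self (s : Seq ν) (k : ℕ) (hk : k + 1 < Multiset.card ν)
    (h : s.at k (Nat.lt_of_succ_lt hk) = s.at (k + 1) hk) : s.swap k hk = s := by
  apply Seq.ext_at
  intro l hl
  rw [Seq.at_swap]
  split_ifs with h1 h2
  · subst h1; exact h.symm
  · subst h2; exact h
  · rfl

theorem Seq.swap_comm (s : Seq ν) (k l : ℕ) (hk : k + 1 < Multiset.card ν)
    (hl : l + 1 < Multiset.card ν) (h : k + 1 < l) :
    (s.swap k hk).swap l hl = (s.swap l hl).swap k hk := by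
  apply Seq.ext_at
  intro p hp
  simp only [Seq.at_swap]
  split_ifs <;> first | rfl | omega

theorem Seq.swap_braid (s : Seq ν) (k : ℕ) (hk : k + 2 < Multiset.card ν) :
    ((s.swap k (by omega)).swap (k + 1) hk).swap k (by omega) =
      ((s.swap (k + 1) hk).swap k (by omega)).swap (k + 1) hk := by
  apply Seq.ext_at
  intro p hp
  simp only [Seq.at_swap]
  split_ifs <;> first | rfl | omega

end Sequences

section Algebra

variable (K : Type*) [Field K] {D : Datum I} (ν : Multiset (Color D))

/-- The diagrammatic generators of `R(ν)`: the idempotents `1_s`, the dots `x_{k,s}` and the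
crossings `τ_{k,s}`, for a sequence `s` (read at the bottom of the diagram) belonging to `ν`. -/
inductive Gen {D : Datum I} (ν : Multiset (Color D))
  | one (s : Seq ν) : Gen ν
  | dot (k : ℕ) (hk : k < Multiset.card ν) (s : Seq ν) : Gen ν
  | cross (k : ℕ) (hk : k + 1 < Multiset.card ν) (s : Seq ν) : Gen ν

/-- The degrees of the generators. -/
def Gen.deg {ν : Multiset (Color D)} : Gen ν → ℤ
  | .one _ => 0
  | .dot k hk s => 2 * D.r (s.at k hk).idx
  | .cross k hk s =>
      -((s.at k (Nat.lt_of_succ_lt hk)).mult * (s.at (k + 1) hk).mult *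
        D.r (s.at k (Nat.lt_of_succ_lt hk)).idx *
        D.a (s.at k (Nat.lt_of_succ_lt hk)).idx (s.at (k + 1) hk).idx)

section Relations

variable {ν}

/-- `1_s` in the free algebra. -/
abbrev fOne (s : Seq ν) : FreeAlgebra K (Gen ν) := FreeAlgebra.ι K (Gen.one s)

/-- `x_{k,s}` in the free algebra. -/
abbrev fX (k : ℕ) (hk : k < Multiset.card ν) (s : Seq ν) : FreeAlgebra K (Gen ν) :=
  FreeAlgebra.ι K (Gen.dot k hk s)

/-- `τ_{k,s}` in the free algebra. -/
abbrev fT (k : ℕ) (hk : k + 1 < Multiset.card ν) (s : Seq ν) : FreeAlgebra K (Gen ν) :=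
  FreeAlgebra.ι K (Gen.cross k hk s)

/-- Two colours are the same real index: `i = j ∈ I⁺`. -/
def SameReal (c d : Color D) : Prop := c.idx = d.idx ∧ D.IsReal c.idx

/-- The colour pattern `i, (j, ℓ), i` with `i ∈ I⁺`, `i ≠ j` and `a i j ≠ 0`, for which the braid
relation has a correction term. -/
def BraidException (c d e : Color D) : Prop :=
  SameReal c e ∧ c.idx ≠ d.idx ∧ D.a c.idx d.idx ≠ 0

end Relations

/-- The defining relations of `R(ν)`.  A product `a * b` is the diagram `a` put on top of `b`.
The first group says that diagrams are multiplied by stacking (mismatched products vanish), that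
`∑ 1_s` is the unit, and that diagrams are taken up to isotopy; the second group consists of the
local relations. -/
inductive Rel : FreeAlgebra K (Gen ν) → FreeAlgebra K (Gen ν) → Prop
  | one_mul_one (s : Seq ν) : Rel (fOne K s * fOne K s) (fOne K s)
  | one_mul_one_of_ne (s t : Seq ν) (h : s ≠ t) : Rel (fOne K s * fOne K t) 0
  | sum_one : Rel (∑ s : Seq ν, fOne K s) 1
  | one_mul_dot (k : ℕ) (hk : k < Multiset.card ν) (s : Seq ν) :
      Rel (fOne K s * fX K k hk s) (fX K k hk s)
  | dot_mul_one (k : ℕ) (hk : k < Multiset.card ν) (s : Seq ν) :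
      Rel (fX K k hk s * fOne K s) (fX K k hk s)
  | one_mul_cross (k : ℕ) (hk : k + 1 < Multiset.card ν) (s : Seq ν) :
      Rel (fOne K (s.swap k hk) * fT K k hk s) (fT K k hk s)
  | cross_mul_one (k : ℕ) (hk : k + 1 < Multiset.card ν) (s : Seq ν) :
      Rel (fT K k hk s * fOne K s) (fT K k hk s)
  | dot_comm_dot (k l : ℕ) (hk : k < Multiset.card ν) (hl : l < Multiset.card ν) (s : Seq ν) :
      Rel (fX K k hk s * fX K l hl s) (fX K l hl s * fX K k hk s)
  | dot_comm_cross (l k : ℕ) (hl : l < Multiset.card ν) (hk : k + 1 < Multiset.card ν)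
      (s : Seq ν) (h : l ≠ k) (h' : l ≠ k + 1) :
      Rel (fX K l hl (s.swap k hk) * fT K k hk s) (fT K k hk s * fX K l hl s)
  | cross_comm_cross (k l : ℕ) (hk : k + 1 < Multiset.card ν) (hl : l + 1 < Multiset.card ν)
      (s : Seq ν) (h : k + 1 < l) :
      Rel (fT K k hk (s.swap l hl) * fT K l hl s) (fT K l hl (s.swap k hk) * fT K k hk s)
  -- double crossing, `i = j ∈ I⁺`
  | double_real (k : ℕ) (hk : k + 1 < Multiset.card ν) (s : Seq ν)
      (h : SameReal (s.at k (Nat.lt_of_succ_lt hk)) (s.at (k + 1) hk)) :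
      Rel (fT K k hk (s.swap k hk) * fT K k hk s) 0
  -- double crossing, `a i j = 0`
  | double_orthogonal (k : ℕ) (hk : k + 1 < Multiset.card ν) (s : Seq ν)
      (h : D.a (s.at k (Nat.lt_of_succ_lt hk)).idx (s.at (k + 1) hk).idx = 0) :
      Rel (fT K k hk (s.swap k hk) * fT K k hk s) (fOne K s)
  -- double crossing, `(i, ℓ) = (j, k)` with `i ∈ I⁻`
  | double_neg (k : ℕ) (hk : k + 1 < Multiset.card ν) (s : Seq ν) (c : Color D)
      (h : s.at k (Nat.lt_of_succ_lt hk) = c) (h' : s.at (k + 1) hk = c) (hc : D.IsNeg c.idx) :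
      Rel (fT K k hk (s.swap k hk) * fT K k hk s)
        ((fX K k (Nat.lt_of_succ_lt hk) s ^ (-((c.mult : ℤ) ^ 2 * (D.a c.idx c.idx / 2))).toNat
          + fX K (k + 1) hk s ^ (-((c.mult : ℤ) ^ 2 * (D.a c.idx c.idx / 2))).toNat) ^ 2
          * fOne K s)
  -- double crossing, `(i, ℓ) ≠ (j, k)` and `a i j ≠ 0`
  | double_ne (k : ℕ) (hk : k + 1 < Multiset.card ν) (s : Seq ν) (c d : Color D)
      (h : s.at k (Nat.lt_of_succ_lt hk) = c) (h' : s.at (k + 1) hk = d) (hcd : c ≠ d)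
      (ha : D.a c.idx d.idx ≠ 0) :
      Rel (fT K k hk (s.swap k hk) * fT K k hk s)
        ((fX K k (Nat.lt_of_succ_lt hk) s ^ (-((d.mult : ℤ) * c.mult * D.a c.idx d.idx)).toNat
          + fX K (k + 1) hk s ^ (-((d.mult : ℤ) * c.mult * D.a d.idx c.idx)).toNat) * fOne K s)
  -- dots and crossings, `i = j ∈ I⁺`
  | slide_left_real (k : ℕ) (hk : k + 1 < Multiset.card ν) (s : Seq ν)
      (h : SameReal (s.at k (Nat.lt_of_succ_lt hk)) (s.at (k + 1) hk)) :
      Rel (fX K k (Nat.lt_of_succ_lt hk) (s.swap k hk) * fT K k hk s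
          - fT K k hk s * fX K (k + 1) hk s) (fOne K s)
  | slide_right_real (k : ℕ) (hk : k + 1 < Multiset.card ν) (s : Seq ν)
      (h : SameReal (s.at k (Nat.lt_of_succ_lt hk)) (s.at (k + 1) hk)) :
      Rel (fT K k hk s * fX K k (Nat.lt_of_succ_lt hk) s
          - fX K (k + 1) hk (s.swap k hk) * fT K k hk s) (fOne K s)
  -- dots and crossings, otherwise
  | slide_left (k : ℕ) (hk : k + 1 < Multiset.card ν) (s : Seq ν)
      (h : ¬ SameReal (s.at k (Nat.lt_of_succ_lt hk)) (s.at (k + 1) hk)) :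
      Rel (fX K k (Nat.lt_of_succ_lt hk) (s.swap k hk) * fT K k hk s)
        (fT K k hk s * fX K (k + 1) hk s)
  | slide_right (k : ℕ) (hk : k + 1 < Multiset.card ν) (s : Seq ν)
      (h : ¬ SameReal (s.at k (Nat.lt_of_succ_lt hk)) (s.at (k + 1) hk)) :
      Rel (fT K k hk s * fX K k (Nat.lt_of_succ_lt hk) s)
        (fX K (k + 1) hk (s.swap k hk) * fT K k hk s)
  -- braid relation for `i, (j, ℓ), i` with `i ∈ I⁺`, `i ≠ j`, `a i j ≠ 0`
  | braid_real (k : ℕ) (hk : k + 2 < Multiset.card ν) (s : Seq ν) (c d : Color D)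
      (h₀ : s.at k (by omega) = c) (h₁ : s.at (k + 1) (by omega) = d)
      (h : BraidException c d (s.at (k + 2) hk)) :
      Rel
        (fT K k (by omega) ((s.swap k (by omega)).swap (k + 1) hk)
            * fT K (k + 1) hk (s.swap k (by omega)) * fT K k (by omega) s
          - fT K (k + 1) hk ((s.swap (k + 1) hk).swap k (by omega))
            * fT K k (by omega) (s.swap (k + 1) hk) * fT K (k + 1) hk s)
        (∑ c' ∈ Finset.range (-((d.mult : ℤ) * D.a c.idx d.idx)).toNat,
          fX K k (by omega) s ^ c'
            * fX K (k + 2) hk s ^ ((-((d.mult : ℤ) * D.a c.idx d.idx)).toNat - 1 - c')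
            * fOne K s)
  -- braid relation, otherwise
  | braid (k : ℕ) (hk : k + 2 < Multiset.card ν) (s : Seq ν)
      (h : ¬ BraidException (s.at k (by omega)) (s.at (k + 1) (by omega)) (s.at (k + 2) hk)) :
      Rel
        (fT K k (by omega) ((s.swap k (by omega)).swap (k + 1) hk)
            * fT K (k + 1) hk (s.swap k (by omega)) * fT K k (by omega) s)
        (fT K (k + 1) hk ((s.swap (k + 1) hk).swap k (by omega))
            * fT K k (by omega) (s.swap (k + 1) hk) * fT K (k + 1) hk s)

/-- The Khovanov–Lauda–Rouquier algebra `R(ν)`. -/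
abbrev KLR : Type _ := RingQuot (Rel K ν)


/-- The image of a generator in `R(ν)`. -/
noncomputable def gen {ν : Multiset (Color D)} (g : Gen ν) : KLR K ν :=
  RingQuot.mkAlgHom K (Rel K ν) (FreeAlgebra.ι K g)

/-- The generator obtained by flipping a diagram about a horizontal axis. -/
def Gen.flip {ν : Multiset (Color D)} : Gen ν → Gen ν
  | .one s => .one s
  | .dot k hk s => .dot k hk s
  | .cross k hk s => .cross k hk (s.swap k hk)

section Flip

variable {ν}

theorem SameReal.eq {c d : Color D} (h : SameReal c d) : c = d := by
  obtain ⟨h1, h2⟩ := h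
  have hc : ¬ D.IsNeg c.idx := by
    unfold Datum.IsNeg; unfold Datum.IsReal at h2; omega
  apply Color.ext h1
  rw [c.mult_eq_one hc, d.mult_eq_one (h1 ▸ hc)]

theorem SameReal.symm {c d : Color D} (h : SameReal c d) : SameReal d c :=
  ⟨h.1.symm, h.1 ▸ h.2⟩

theorem BraidException.symm {c d e : Color D} (h : BraidException c d e) :
    BraidException e d c := by
  have := h.1.eq
  subst this
  exact h

theorem gen_one_comm_dot (k : ℕ) (hk : k < Multiset.card ν) (s : Seq ν) :
    Commute (gen K (Gen.one s)) (gen K (Gen.dot k hk s)) := by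
  have h1 := RingQuot.mkAlgHom_rel K (Rel.one_mul_dot (K := K) k hk s)
  have h2 := RingQuot.mkAlgHom_rel K (Rel.dot_mul_one (K := K) k hk s)
  rw [map_mul] at h1 h2
  exact h1.trans h2.symm

theorem gen_dot_comm_dot (k l : ℕ) (hk : k < Multiset.card ν) (hl : l < Multiset.card ν)
    (s : Seq ν) : Commute (gen K (Gen.dot k hk s)) (gen K (Gen.dot l hl s)) := by
  have h1 := RingQuot.mkAlgHom_rel K (Rel.dot_comm_dot (K := K) k l hk hl s)
  rw [map_mul, map_mul] at h1
  exact h1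

/-- The algebra homomorphism from the free algebra underlying the flip `ψ`. -/
noncomputable def flipFree : FreeAlgebra K (Gen ν) →ₐ[K] (KLR K ν)ᵐᵒᵖ :=
  FreeAlgebra.lift K fun g => MulOpposite.op (gen K g.flip)

theorem flipFree_rel ⦃x y : FreeAlgebra K (Gen ν)⦄ (h : Rel K ν x y) :
    flipFree K x = flipFree K y := by
  have key : ∀ {a b}, Rel K ν a b →
      RingQuot.mkAlgHom K (Rel K ν) a = RingQuot.mkAlgHom K (Rel K ν) b :=
    fun h => RingQuot.mkAlgHom_rel K h
  apply MulOpposite.unop_injective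
  cases h with
  | one_mul_one s =>
    have := key (Rel.one_mul_one s)
    simpa [flipFree, gen, Gen.flip] using this
  | one_mul_one_of_ne s t h =>
    have := key (Rel.one_mul_one_of_ne t s h.symm)
    simpa [flipFree, gen, Gen.flip] using this
  | sum_one =>
    have := key (Rel.sum_one)
    simpa [flipFree, gen, Gen.flip] using this
  | one_mul_dot k hk s =>
    have := key (Rel.dot_mul_one k hk s)
    simpa [flipFree, gen, Gen.flip] using this
  | dot_mul_one k hk s =>
    have := key (Rel.one_mul_dot k hk s)
    simpa [flipFree, gen, Gen.flip] using this
  | one_mul_cross k hk s =>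
    have := key (Rel.cross_mul_one k hk (s.swap k hk))
    simpa [flipFree, gen, Gen.flip] using this
  | cross_mul_one k hk s =>
    have := key (Rel.one_mul_cross k hk (s.swap k hk))
    rw [Seq.swap_swap] at this
    simpa [flipFree, gen, Gen.flip] using this
  | dot_comm_dot k l hk hl s =>
    have := key (Rel.dot_comm_dot l k hl hk s)
    simpa [flipFree, gen, Gen.flip] using this
  | dot_comm_cross l k hl hk s h h' =>
    have := key (Rel.dot_comm_cross l k hl hk (s.swap k hk) h h')
    rw [Seq.swap_swap] at this
    simpa [flipFree, gen, Gen.flip] using this.symm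
  | cross_comm_cross k l hk hl s h =>
    have := key (Rel.cross_comm_cross k l hk hl ((s.swap k hk).swap l hl) h)
    rw [Seq.swap_swap, Seq.swap_comm s k l hk hl h, Seq.swap_swap] at this
    have e := Seq.swap_comm s k l hk hl h
    simpa [flipFree, gen, Gen.flip, e] using this.symm
  | double_real k hk s h =>
    have := key (Rel.double_real k hk s h)
    simpa [flipFree, gen, Gen.flip, Seq.swap_swap] using this
  | double_orthogonal k hk s h =>
    have := key (Rel.double_orthogonal k hk s h)
    simpa [flipFree, gen, Gen.flip, Seq.swap_swap] using this
  | double_neg k hk s c h h' hc =>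
    have := key (Rel.double_neg k hk s c h h' hc)
    have c1 := gen_one_comm_dot K k (Nat.lt_of_succ_lt hk) s
    have c2 := gen_one_comm_dot K (k + 1) hk s
    have c3 := ((c1.pow_right (-((c.mult : ℤ) ^ 2 * (D.a c.idx c.idx / 2))).toNat).add_right
      (c2.pow_right (-((c.mult : ℤ) ^ 2 * (D.a c.idx c.idx / 2))).toNat)).pow_right 2
    simp only [map_mul, map_add, map_pow] at this
    simpa [flipFree, gen, Gen.flip, Seq.swap_swap] using this.trans c3.eq.symm
  | double_ne k hk s c d h h' hcd ha =>
    have := key (Rel.double_ne k hk s c d h h' hcd ha)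
    have c1 := gen_one_comm_dot K k (Nat.lt_of_succ_lt hk) s
    have c2 := gen_one_comm_dot K (k + 1) hk s
    have c3 := (c1.pow_right (-((d.mult : ℤ) * c.mult * D.a c.idx d.idx)).toNat).add_right
      (c2.pow_right (-((d.mult : ℤ) * c.mult * D.a d.idx c.idx)).toNat)
    simp only [map_mul, map_add, map_pow] at this
    simpa [flipFree, gen, Gen.flip, Seq.swap_swap] using this.trans c3.eq.symm
  | slide_left_real k hk s h =>
    have := key (Rel.slide_right_real k hk (s.swap k hk)
      (by rw [Seq.at_swap_left, Seq.at_swap_right]; exact h.symm))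
    rw [Seq.swap_swap] at this
    have e := s.swap_eq_self k hk h.eq
    simp only [e] at this
    simpa [flipFree, gen, Gen.flip, e] using this
  | slide_right_real k hk s h =>
    have := key (Rel.slide_left_real k hk (s.swap k hk)
      (by rw [Seq.at_swap_left, Seq.at_swap_right]; exact h.symm))
    rw [Seq.swap_swap] at this
    have e := s.swap_eq_self k hk h.eq
    simp only [e] at this
    simpa [flipFree, gen, Gen.flip, e] using this
  | slide_left k hk s h =>
    have := key (Rel.slide_right k hk (s.swap k hk)
      (by rw [Seq.at_swap_left, Seq.at_swap_right]; exact fun h' => h h'.symm))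
    rw [Seq.swap_swap] at this
    simpa [flipFree, gen, Gen.flip] using this
  | slide_right k hk s h =>
    have := key (Rel.slide_left k hk (s.swap k hk)
      (by rw [Seq.at_swap_left, Seq.at_swap_right]; exact fun h' => h h'.symm))
    rw [Seq.swap_swap] at this
    simpa [flipFree, gen, Gen.flip] using this
  | braid_real k hk s c d h₀ h₁ h =>
    have e : ((s.swap k (by omega)).swap (k + 1) hk).swap k (by omega) = s := by
      apply Seq.ext_at
      intro p hp
      have := h.1.eq
      simp only [Seq.at_swap]
      split_ifs <;> grind
    have e' := (s.swap_braid k hk).symm.trans e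
    have e1 : (s.swap k (by omega)).swap (k + 1) hk = s.swap k (by omega) := by
      rw [← Seq.swap_swap ((s.swap k (by omega)).swap (k + 1) hk) k (by omega), e]
    have e2 : (s.swap (k + 1) hk).swap k (by omega) = s.swap (k + 1) hk := by
      rw [← Seq.swap_swap ((s.swap (k + 1) hk).swap k (by omega)) (k + 1) hk, e']
    have := key (Rel.braid_real k hk s c d h₀ h₁ h)
    have c1 := gen_one_comm_dot K k (by omega) s
    have c2 := gen_one_comm_dot K (k + 2) hk s
    have c3 := gen_dot_comm_dot K k (k + 2) (by omega) hk s
    simp only [e1, e2, map_mul, map_sub, map_sum, map_pow] at this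
    simp only [flipFree, gen, Gen.flip, e1, e2, Seq.swap_swap, map_mul, map_sub, map_sum, map_pow,
      FreeAlgebra.lift_ι_apply, MulOpposite.unop_mul, MulOpposite.unop_sub, MulOpposite.unop_op,
      MulOpposite.unop_pow, Finset.unop_sum, mul_assoc] at this ⊢
    rw [this]
    refine Finset.sum_congr rfl fun t _ => ?_
    have c4 := (c1.pow_right t).mul_right
      (c2.pow_right ((-((d.mult : ℤ) * D.a c.idx d.idx)).toNat - 1 - t))
    have c5 := c3.pow_pow t ((-((d.mult : ℤ) * D.a c.idx d.idx)).toNat - 1 - t)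
    rw [← mul_assoc]
    refine c4.eq.symm.trans ?_
    rw [c5.eq]
    rfl
  | braid k hk s h =>
    have e := s.swap_braid k hk
    have h' : ¬ BraidException
        ((((s.swap k (by omega)).swap (k + 1) hk).swap k (by omega)).at k (by omega))
        ((((s.swap k (by omega)).swap (k + 1) hk).swap k (by omega)).at (k + 1) (by omega))
        ((((s.swap k (by omega)).swap (k + 1) hk).swap k (by omega)).at (k + 2) hk) := by
      intro hb
      apply h
      have := hb.symm
      simp only [Seq.at_swap] at this
      simpa [show ¬ (k = k + 1 + 1) by omega, show ¬ (k + 1 + 1 = k) by omega] using this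
    have := key (Rel.braid k hk _ h')
    rw [Seq.swap_swap, Seq.swap_swap] at this
    simp only [e] at this
    rw [Seq.swap_swap, Seq.swap_swap] at this
    simp only [flipFree, gen, Gen.flip, e, map_mul,
      FreeAlgebra.lift_ι_apply, MulOpposite.unop_mul, MulOpposite.unop_op, mul_assoc] at this ⊢
    exact this

variable (ν) in
/-- The flip `ψ` as an algebra homomorphism to the opposite algebra. -/
noncomputable def flipHom : KLR K ν →ₐ[K] (KLR K ν)ᵐᵒᵖ :=
  RingQuot.liftAlgHom K ⟨flipFree K, flipFree_rel K⟩

/-- The anti-involution `ψ` of `R(ν)`, flipping diagrams about a horizontal axis. -/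
noncomputable def psi (a : KLR K ν) : KLR K ν := (flipHom K ν a).unop

theorem psi_gen (g : Gen ν) : psi K (gen K g) = gen K g.flip := by
  simp only [psi, flipHom, gen, RingQuot.liftAlgHom_mkAlgHom_apply]
  simp [flipFree, gen]

theorem psi_mul (a b : KLR K ν) : psi K (a * b) = psi K b * psi K a := by
  simp [psi]

theorem psi_one : psi K (1 : KLR K ν) = 1 := by
  simp [psi]

end Flip

section Grading

/-- The homogeneous part of degree `d` of `R(ν)`: the span of the products of generators whose
degrees add up to `d`. -/
def degPart (d : ℤ) : Submodule K (KLR K ν) :=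
  Submodule.span K
    {a | ∃ w : List (Gen ν), (w.map Gen.deg).sum = d ∧ (w.map (gen K)).prod = a}

variable {ν}

theorem gen_mem_degPart (g : Gen ν) : gen K g ∈ degPart K ν g.deg :=
  Submodule.subset_span ⟨[g], by simp, by simp⟩

variable (ν)

instance degPart.gradedMonoid : SetLike.GradedMonoid (degPart K ν) where
  one_mem := Submodule.subset_span ⟨[], by simp, by simp⟩
  mul_mem := by
    intro i j a b ha hb
    have h := Submodule.mul_mem_mul ha hb
    rw [degPart, degPart, Submodule.span_mul_span] at h
    refine Submodule.span_mono ?_ h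
    rintro _ ⟨_, ⟨w, rfl, rfl⟩, _, ⟨w', rfl, rfl⟩, rfl⟩
    exact ⟨w ++ w', by simp, by simp⟩

variable {ν}

/-- The homomorphism of the free algebra to Laurent polynomials over `R(ν)` that records the
degrees of the generators. -/
noncomputable def degFree : FreeAlgebra K (Gen ν) →ₐ[K] AddMonoidAlgebra (KLR K ν) ℤ :=
  FreeAlgebra.lift K fun g => AddMonoidAlgebra.single g.deg (gen K g)

/-- Homogeneity, of degree `d`, of an element of the free algebra modulo the relations. -/
def IsHom (d : ℤ) (a : FreeAlgebra K (Gen ν)) : Prop :=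
  degFree K a = AddMonoidAlgebra.single d (RingQuot.mkAlgHom K (Rel K ν) a)

variable {K}

theorem IsHom.gen (g : Gen ν) : IsHom K g.deg (FreeAlgebra.ι K g) := by
  rw [IsHom, degFree, FreeAlgebra.lift_ι_apply]
  rfl

theorem IsHom.one : IsHom K 0 (1 : FreeAlgebra K (Gen ν)) := by
  rw [IsHom, map_one, map_one]
  rfl

theorem IsHom.zero (d : ℤ) : IsHom K d (0 : FreeAlgebra K (Gen ν)) := by
  simp [IsHom]

theorem IsHom.mul {d e : ℤ} {a b : FreeAlgebra K (Gen ν)} (ha : IsHom K d a) (hb : IsHom K e b) :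
    IsHom K (d + e) (a * b) := by
  unfold IsHom at *
  rw [map_mul, map_mul, ha, hb, AddMonoidAlgebra.single_mul_single]

theorem IsHom.add {d : ℤ} {a b : FreeAlgebra K (Gen ν)} (ha : IsHom K d a) (hb : IsHom K d b) :
    IsHom K d (a + b) := by
  unfold IsHom at *
  rw [map_add, map_add, ha, hb, AddMonoidAlgebra.single_add]

theorem IsHom.sub {d : ℤ} {a b : FreeAlgebra K (Gen ν)} (ha : IsHom K d a) (hb : IsHom K d b) :
    IsHom K d (a - b) := by
  unfold IsHom at *
  rw [map_sub, map_sub, ha, hb, AddMonoidAlgebra.single_sub]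

theorem IsHom.sum {ι : Type*} {d : ℤ} (t : Finset ι) {f : ι → FreeAlgebra K (Gen ν)}
    (hf : ∀ i ∈ t, IsHom K d (f i)) : IsHom K d (∑ i ∈ t, f i) := by
  classical
  induction t using Finset.induction_on with
  | empty => simpa using IsHom.zero d
  | insert i t hi ih =>
    rw [Finset.sum_insert hi]
    exact (hf _ (by simp)).add (ih fun j hj => hf j (by simp [hj]))

theorem IsHom.pow {d : ℤ} {a : FreeAlgebra K (Gen ν)} (ha : IsHom K d a) (n : ℕ) :
    IsHom K (n * d) (a ^ n) := by
  induction n with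
  | zero => simpa using IsHom.one
  | succ n ih =>
    rw [pow_succ]
    convert ih.mul ha using 1
    push_cast; ring

theorem IsHom.cast {d e : ℤ} {a : FreeAlgebra K (Gen ν)} (ha : IsHom K d a) (h : d = e) :
    IsHom K e a := h ▸ ha

theorem IsHom.eq {d : ℤ} {a b : FreeAlgebra K (Gen ν)} (ha : IsHom K d a) (hb : IsHom K d b)
    (h : Rel K ν a b) : degFree K a = degFree K b := by
  unfold IsHom at *
  rw [ha, hb, RingQuot.mkAlgHom_rel K h]

theorem toNat_double_ne {c d : Color D} (hcd : c ≠ d) :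
    (((-((d.mult : ℤ) * c.mult * D.a c.idx d.idx)).toNat : ℕ) : ℤ) =
        -((d.mult : ℤ) * c.mult * D.a c.idx d.idx) ∧
      (((-((d.mult : ℤ) * c.mult * D.a d.idx c.idx)).toNat : ℕ) : ℤ) =
        -((d.mult : ℤ) * c.mult * D.a d.idx c.idx) := by
  have key : ∀ c d : Color D, c ≠ d → D.a c.idx d.idx ≤ 0 := by
    intro c d hcd
    by_cases hi : c.idx = d.idx
    · by_contra hcon
      apply hcd
      have hn : ¬ D.IsNeg c.idx := by
        unfold Datum.IsNeg; rw [← hi] at hcon; omega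
      exact Color.ext hi (by rw [c.mult_eq_one hn, d.mult_eq_one (hi ▸ hn)])
    · exact D.offDiag _ _ hi
  have h1 := key c d hcd
  have h2 := key d c hcd.symm
  exact ⟨Int.toNat_of_nonneg (by rw [← mul_neg]; exact mul_nonneg (by positivity) (by omega)),
    Int.toNat_of_nonneg (by rw [← mul_neg]; exact mul_nonneg (by positivity) (by omega))⟩

set_option maxHeartbeats 1000000 in
theorem degFree_rel ⦃x y : FreeAlgebra K (Gen ν)⦄ (h : Rel K ν x y) :
    degFree K x = degFree K y := by
  cases id h with
  | one_mul_one s => exact ((IsHom.gen _).mul (IsHom.gen _)).eq (IsHom.gen _) h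
  | one_mul_one_of_ne s t hst => exact ((IsHom.gen _).mul (IsHom.gen _)).eq (IsHom.zero _) h
  | sum_one => exact (IsHom.sum (d := 0) _ fun s _ => IsHom.gen (Gen.one s)).eq IsHom.one h
  | one_mul_dot k hk s =>
    exact (((IsHom.gen _).mul (IsHom.gen _)).cast (by simp [Gen.deg])).eq (IsHom.gen _) h
  | dot_mul_one k hk s =>
    exact (((IsHom.gen _).mul (IsHom.gen _)).cast (by simp [Gen.deg])).eq (IsHom.gen _) h
  | one_mul_cross k hk s =>
    exact (((IsHom.gen _).mul (IsHom.gen _)).cast (by simp [Gen.deg])).eq (IsHom.gen _) h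
  | cross_mul_one k hk s =>
    exact (((IsHom.gen _).mul (IsHom.gen _)).cast (by simp [Gen.deg])).eq (IsHom.gen _) h
  | dot_comm_dot k l hk hl s =>
    exact (((IsHom.gen _).mul (IsHom.gen _)).cast (add_comm _ _)).eq
      ((IsHom.gen _).mul (IsHom.gen _)) h
  | dot_comm_cross l k hl hk s h1 h2 =>
    refine (((IsHom.gen _).mul (IsHom.gen _)).cast ?_).eq ((IsHom.gen _).mul (IsHom.gen _)) h
    simp only [Gen.deg, Seq.at_swap]
    split_ifs <;> grind
  | cross_comm_cross k l hk hl s h1 =>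
    refine (((IsHom.gen _).mul (IsHom.gen _)).cast ?_).eq ((IsHom.gen _).mul (IsHom.gen _)) h
    simp only [Gen.deg, Seq.at_swap]
    split_ifs <;> grind
  | double_real k hk s h1 =>
    exact ((IsHom.gen _).mul (IsHom.gen _)).eq (IsHom.zero _) h
  | double_orthogonal k hk s h1 =>
    refine (((IsHom.gen _).mul (IsHom.gen _)).cast ?_).eq (IsHom.gen _) h
    have h2 := D.symm (s.at k (Nat.lt_of_succ_lt hk)).idx (s.at (k + 1) hk).idx
    rw [h1, mul_zero] at h2
    have h3 := (mul_eq_zero.1 h2.symm).resolve_left (D.r_pos _).ne'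
    simp [Gen.deg, Seq.at_swap, h1, h3]
  | double_neg k hk s c h1 h2 hc =>
    have hev : D.a c.idx c.idx = 2 * (D.a c.idx c.idx / 2) := by
      unfold Datum.IsNeg at hc
      rcases D.diag c.idx with h3 | ⟨_, h3⟩
      · omega
      · obtain ⟨t, ht⟩ := h3; omega
    have hN : (((-((c.mult : ℤ) ^ 2 * (D.a c.idx c.idx / 2))).toNat : ℕ) : ℤ) =
        -((c.mult : ℤ) ^ 2 * (D.a c.idx c.idx / 2)) := by
      apply Int.toNat_of_nonneg
      unfold Datum.IsNeg at hc
      have : D.a c.idx c.idx / 2 ≤ 0 := by omega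
      nlinarith [sq_nonneg (c.mult : ℤ)]
    refine (((IsHom.gen _).mul (IsHom.gen _)).cast ?_).eq
      (((((IsHom.gen _).pow _).add (((IsHom.gen _).pow _).cast ?_)).pow _).mul (IsHom.gen _)) h
    · simp only [Gen.deg, Seq.at_swap, h1, h2]
      rw [hN]
      simp
      generalize D.a c.idx c.idx / 2 = t at hev
      rw [hev]; ring
    · simp only [Gen.deg, h1, h2]
  | double_ne k hk s c d h1 h2 hcd ha =>
    obtain ⟨hN, hN'⟩ := toNat_double_ne hcd
    have hsym := D.symm c.idx d.idx
    refine (((IsHom.gen _).mul (IsHom.gen _)).cast ?_).eq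
      ((((IsHom.gen _).pow _).add (((IsHom.gen _).pow _).cast ?_)).mul (IsHom.gen _)) h
    · simp only [Gen.deg, Seq.at_swap_left, Seq.at_swap_right, h1, h2]
      rw [hN]
      linear_combination (c.mult * d.mult : ℤ) * hsym
    · simp only [Gen.deg, h1, h2]
      rw [hN, hN']
      linear_combination 2 * (c.mult * d.mult : ℤ) * hsym
  | slide_left_real k hk s h1 =>
    have e := s.swap_eq_self k hk h1.eq
    have e1 := h1.eq
    have h2 : D.a (s.at (k + 1) hk).idx (s.at (k + 1) hk).idx = 2 := e1 ▸ h1.2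
    have h3 : ((s.at (k + 1) hk).mult : ℤ) = 1 := by
      rw [(s.at (k + 1) hk).mult_eq_one (by unfold Datum.IsNeg; omega), Nat.cast_one]
    refine ((((IsHom.gen _).mul (IsHom.gen _)).cast ?_).sub
      (((IsHom.gen _).mul (IsHom.gen _)).cast ?_)).eq (IsHom.gen _) h
    · simp only [Gen.deg, e, e1, h2, h3]; ring
    · simp only [Gen.deg, e1, h2, h3]; ring
  | slide_right_real k hk s h1 =>
    have e := s.swap_eq_self k hk h1.eq
    have e1 := h1.eq
    have h2 : D.a (s.at (k + 1) hk).idx (s.at (k + 1) hk).idx = 2 := e1 ▸ h1.2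
    have h3 : ((s.at (k + 1) hk).mult : ℤ) = 1 := by
      rw [(s.at (k + 1) hk).mult_eq_one (by unfold Datum.IsNeg; omega), Nat.cast_one]
    refine ((((IsHom.gen _).mul (IsHom.gen _)).cast ?_).sub
      (((IsHom.gen _).mul (IsHom.gen _)).cast ?_)).eq (IsHom.gen _) h
    · simp only [Gen.deg, e1, h2, h3]; ring
    · simp only [Gen.deg, e, e1, h2, h3]; ring
  | slide_left k hk s h1 =>
    refine (((IsHom.gen _).mul (IsHom.gen _)).cast ?_).eq ((IsHom.gen _).mul (IsHom.gen _)) h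
    simp only [Gen.deg, Seq.at_swap]
    split_ifs <;> grind
  | slide_right k hk s h1 =>
    refine (((IsHom.gen _).mul (IsHom.gen _)).cast ?_).eq ((IsHom.gen _).mul (IsHom.gen _)) h
    simp only [Gen.deg, Seq.at_swap]
    split_ifs <;> grind
  | braid_real k hk s c d h0 h1 h2 =>
    have hc := h2.1.eq.symm
    have hne : c ≠ d := fun hcd => h2.2.1 (congrArg Color.idx hcd)
    have hm : (c.mult : ℤ) = 1 := by
      have h3 : D.a c.idx c.idx = 2 := h2.1.2
      rw [c.mult_eq_one (by unfold Datum.IsNeg; omega), Nat.cast_one]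
    have hcc : D.a c.idx c.idx = 2 := h2.1.2
    have hN := (toNat_double_ne hne).1
    have hsym := D.symm c.idx d.idx
    rw [hm, mul_one] at hN
    refine (((((IsHom.gen _).mul (IsHom.gen _)).mul (IsHom.gen _)).cast ?_).sub
      ((((IsHom.gen _).mul (IsHom.gen _)).mul (IsHom.gen _)).cast ?_)).eq
      (IsHom.sum (d := 2 * D.r c.idx * (-((d.mult : ℤ) * D.a c.idx d.idx) - 1)) _ fun t ht =>
        ((((IsHom.gen _).pow t).mul ((IsHom.gen _).pow _)).mul (IsHom.gen _)).cast ?_) h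
    · simp [Gen.deg, Seq.at_swap, h0, h1, hc, hm, hcc, show ¬ (k = k + 1 + 1) by omega,
        show ¬ (k + 1 + 1 = k) by omega]
      linear_combination (d.mult : ℤ) * hsym
    · simp [Gen.deg, Seq.at_swap, h0, h1, hc, hm, hcc, show ¬ (k = k + 1 + 1) by omega,
        show ¬ (k + 1 + 1 = k) by omega]
      linear_combination (d.mult : ℤ) * hsym
    · rw [Finset.mem_range] at ht
      generalize (-((d.mult : ℤ) * D.a c.idx d.idx)).toNat = N at hN ht
      have hN2 : ((N - 1 - t : ℕ) : ℤ) = N - 1 - t := by omega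
      simp only [Gen.deg, h0, hc, hN2]
      rw [← hN]; ring
  | braid k hk s h1 =>
    refine ((((IsHom.gen _).mul (IsHom.gen _)).mul (IsHom.gen _)).cast ?_).eq
      (((IsHom.gen _).mul (IsHom.gen _)).mul (IsHom.gen _)) h
    simp only [Gen.deg, Seq.at_swap]
    split_ifs <;> grind

variable (K) (ν)

/-- The homomorphism `a ↦ ∑ a_d T^d` decomposing elements into homogeneous components. -/
noncomputable def degHom : KLR K ν →ₐ[K] AddMonoidAlgebra (KLR K ν) ℤ :=
  RingQuot.liftAlgHom K ⟨degFree K, degFree_rel⟩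

theorem degHom_of_mem {d : ℤ} {a : KLR K ν} (ha : a ∈ degPart K ν d) :
    degHom K ν a = AddMonoidAlgebra.single d a := by
  refine Submodule.span_induction ?_ ?_ ?_ ?_ ha
  · rintro _ ⟨w, rfl, rfl⟩
    clear ha
    induction w with
    | nil => rw [List.map_nil, List.map_nil, List.prod_nil, map_one]; rfl
    | cons g w ih =>
      rw [List.map_cons, List.map_cons, List.prod_cons, List.sum_cons, map_mul, ih,
        ← AddMonoidAlgebra.single_mul_single]
      congr 1
      rw [degHom, BorcherdsKLR.gen, RingQuot.liftAlgHom_mkAlgHom_apply, degFree,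
        FreeAlgebra.lift_ι_apply]
      rfl
  · simp
  · intro x y _ _ hx hy
    rw [map_add, hx, hy, AddMonoidAlgebra.single_add]
  · intro c x _ hx
    rw [map_smul, hx, AddMonoidAlgebra.smul_single]

theorem iSup_degPart : ⨆ d, degPart K ν d = ⊤ := by
  rw [eq_top_iff]
  rintro a -
  obtain ⟨f, rfl⟩ := RingQuot.mkAlgHom_surjective K (Rel K ν) a
  induction f using FreeAlgebra.induction with
  | grade0 r =>
    rw [AlgHom.commutes, Algebra.algebraMap_eq_smul_one]
    exact Submodule.smul_mem _ _ (Submodule.mem_iSup_of_mem 0 (SetLike.GradedOne.one_mem))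
  | grade1 g => exact Submodule.mem_iSup_of_mem g.deg (gen_mem_degPart K g)
  | mul x y hx hy =>
    rw [map_mul]
    generalize RingQuot.mkAlgHom K (Rel K ν) x = a at hx ⊢
    generalize RingQuot.mkAlgHom K (Rel K ν) y = b at hy ⊢
    refine Submodule.iSup_induction _ (motive := fun a => a * b ∈ ⨆ d, degPart K ν d) hx ?_ ?_ ?_
    · intro i a ha
      refine Submodule.iSup_induction _ (motive := fun b => a * b ∈ ⨆ d, degPart K ν d) hy ?_ ?_ ?_
      · intro j b hb
        exact Submodule.mem_iSup_of_mem (i + j) (SetLike.GradedMul.mul_mem ha hb)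
      · simp
      · intro b b' h h'
        rw [mul_add]; exact Submodule.add_mem _ h h'
    · simp
    · intro a a' h h'
      rw [add_mul]; exact Submodule.add_mem _ h h'
  | add x y hx hy => rw [map_add]; exact Submodule.add_mem _ hx hy

theorem isInternal_degPart : DirectSum.IsInternal (degPart K ν) := by
  have key : ∀ (x : ⨁ d, degPart K ν d) (d : ℤ),
      (degHom K ν (DirectSum.coeAddMonoidHom (degPart K ν) x)).coeff d = x d := by
    intro x d
    induction x using DirectSum.induction_on with
    | zero => simp
    | of i y =>
      rw [DirectSum.coeAddMonoidHom_of, degHom_of_mem K ν y.2]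
      by_cases h : i = d
      · subst h
        rw [DirectSum.of_eq_same]
        exact Finsupp.single_eq_same
      · rw [DirectSum.of_eq_of_ne _ _ _ (Ne.symm h)]
        exact Finsupp.single_eq_of_ne (Ne.symm h)
    | add x y hx hy =>
      rw [map_add, map_add, DirectSum.add_apply, Submodule.coe_add, ← hx, ← hy]
      rfl
  refine ⟨?_, ?_⟩
  · intro x y hxy
    ext d
    rw [← key x d, hxy, key y d]
  · intro a
    have ha : a ∈ LinearMap.range (DirectSum.coeLinearMap (degPart K ν)) := by
      rw [DirectSum.range_coeLinearMap, iSup_degPart]; trivial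
    obtain ⟨x, hx⟩ := ha
    exact ⟨x, hx⟩

/-- `R(ν)` is a `ℤ`-graded algebra. -/
noncomputable instance instGradedAlgebra : GradedAlgebra (degPart K ν) :=
  { degPart.gradedMonoid K ν, (isInternal_degPart K ν).chooseDecomposition with }

end Grading

end Algebra

section Words

open Equiv

/-- For `ω ∈ S_{n+1}`, write `ω = ω' * (s_{n-1} ⋯ s_p)` with `p = ω⁻¹ n` and `ω'` fixing `n`;
this is `ω'` regarded as an element of `S_n` (points are numbered from `0`). -/
def strip {n : ℕ} (ω : Perm (Fin (n + 1))) : Perm (Fin n) :=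
  removeNone ((finSuccEquiv' (ω.symm (Fin.last n))).symm.trans
    (ω.trans (finSuccEquiv' (Fin.last n))))

/-- A reduced expression of `ω ∈ S_n` as a word in the simple transpositions `s_k = (k, k+1)`.
It is reduced since the last run `s_{n-1} ⋯ s_p`, with `p = ω⁻¹ n` for `ω ∈ S_{n+1}`, has one letter
for each inversion of `ω` that involves the value `n`. -/
def redWord : (n : ℕ) → Perm (Fin n) → List ℕ
  | 0, _ => []
  | n + 1, ω =>
      redWord n (strip ω) ++ (List.range' (ω.symm (Fin.last n)) (n - ω.symm (Fin.last n))).reverse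

/-- The permutation of `ℕ` given by a word in the simple transpositions. -/
def wordPerm (w : List ℕ) : Perm ℕ := (w.map fun k => swap k (k + 1)).prod

theorem wordPerm_append (v w : List ℕ) : wordPerm (v ++ w) = wordPerm v * wordPerm w := by
  simp [wordPerm]

theorem wordPerm_descending (p l x : ℕ) :
    wordPerm (List.range' p l).reverse x =
      if x < p then x else if x = p then p + l else if x ≤ p + l then x - 1 else x := by
  induction l generalizing x with
  | zero => simp [wordPerm]; split_ifs <;> omega
  | succ l ih =>
    have h : (List.range' p (l + 1)).reverse = [p + l] ++ (List.range' p l).reverse := by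
      rw [List.range'_concat]; simp
    rw [h, wordPerm_append, Perm.mul_apply, ih]
    simp only [wordPerm, List.map_cons, List.map_nil, List.prod_singleton, swap_apply_def]
    split_ifs <;> omega

theorem strip_apply {n : ℕ} (ω : Perm (Fin (n + 1))) (k : Fin n) :
    ((strip ω k).castSucc : Fin (n + 1)) = ω ((ω.symm (Fin.last n)).succAbove k) := by
  have hne : ω ((ω.symm (Fin.last n)).succAbove k) ≠ Fin.last n := fun h =>
    Fin.succAbove_ne (ω.symm (Fin.last n)) k (by rw [eq_symm_apply, h])
  have h1 : some (strip ω k) =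
      finSuccEquiv' (Fin.last n) (ω ((ω.symm (Fin.last n)).succAbove k)) := by
    refine removeNone_some _ ?_
    obtain ⟨y, hy⟩ := Fin.exists_succAbove_eq hne
    refine ⟨y, ?_⟩
    simp only [trans_apply, finSuccEquiv'_symm_some]
    rw [← hy, finSuccEquiv'_succAbove]
  have h2 := congrArg (finSuccEquiv' (Fin.last n)).symm h1
  rw [symm_apply_apply, finSuccEquiv'_symm_some, Fin.succAbove_last] at h2
  exact h2

theorem wordPerm_redWord_last : ∀ (n : ℕ) (ω : Perm (Fin n)) (k : ℕ), n ≤ k →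
    wordPerm (redWord n ω) k = k
  | 0, _, _, _ => rfl
  | n + 1, ω, k, hk => by
    rw [redWord, wordPerm_append, Perm.mul_apply, wordPerm_descending]
    have := (ω.symm (Fin.last n)).is_lt
    rw [if_neg (by omega), if_neg (by omega), if_neg (by omega)]
    exact wordPerm_redWord_last n _ k (by omega)

/-- The word `redWord n ω` is an expression of `ω`. -/
theorem wordPerm_redWord : ∀ (n : ℕ) (ω : Perm (Fin n)) (k : Fin n),
    wordPerm (redWord n ω) k = ω k
  | n + 1, ω, k => by
    rw [redWord, wordPerm_append, Perm.mul_apply, wordPerm_descending]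
    have hp := (ω.symm (Fin.last n)).is_lt
    have hk := k.is_lt
    by_cases h : k = ω.symm (Fin.last n)
    · rw [if_neg (by omega), if_pos (by rw [h]),
        show ((ω.symm (Fin.last n) : Fin (n + 1)) : ℕ) + (n - ω.symm (Fin.last n)) = n by omega,
        wordPerm_redWord_last _ _ _ le_rfl, h, apply_symm_apply, Fin.val_last]
    · obtain ⟨y, rfl⟩ := Fin.exists_succAbove_eq h
      rw [← strip_apply, Fin.val_castSucc, ← wordPerm_redWord n (strip ω) y]
      congr 1
      have hy := y.is_lt
      by_cases hlt : (y : ℕ) < ω.symm (Fin.last n)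
      · rw [Fin.succAbove_of_castSucc_lt _ _ (by simpa [Fin.lt_def] using hlt), Fin.val_castSucc,
          if_pos hlt]
      · rw [Fin.succAbove_of_le_castSucc _ _ (by simpa [Fin.le_def] using hlt), Fin.val_succ,
          if_neg (by omega), if_neg (by omega), if_pos (by omega)]
        omega

end Words

section Elements

variable (K : Type*) [Field K] {D : Datum I} (ν : Multiset (Color D))

/-- The dot on the strand in position `k`: the sum of all `x_{k,s}`. -/
noncomputable def dotAt (k : ℕ) : KLR K ν :=
  if hk : k < Multiset.card ν then ∑ s : Seq ν, gen K (Gen.dot k hk s) else 0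

/-- The crossing of the strands in positions `k`, `k + 1`: the sum of all `τ_{k,s}`. -/
noncomputable def crossAt (k : ℕ) : KLR K ν :=
  if hk : k + 1 < Multiset.card ν then ∑ s : Seq ν, gen K (Gen.cross k hk s) else 0

/-- `τ_ω` for `ω ∈ S_m`, on the `m` consecutive strands starting in position `p`. -/
noncomputable def tauAt (p m : ℕ) (ω : Equiv.Perm (Fin m)) : KLR K ν :=
  ((redWord m ω).map fun k => crossAt K ν (p + k)).prod

/-- `x_1^{m-1} x_2^{m-2} ⋯ x_{m-1} τ_{w₀}`, on the `m` consecutive strands starting in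
position `p`; here `w₀` is the longest element of `S_m`. -/
noncomputable def nilHeckeAt (p m : ℕ) : KLR K ν :=
  ((List.range m).map fun t => dotAt K ν (p + t) ^ (m - 1 - t)).prod * tauAt K ν p m Fin.revPerm

/-- `(1 / n!) ∑_{ω ∈ S_n} τ_ω`, on the `n` consecutive strands starting in position `p`. -/
noncomputable def symmetrizerAt (p n : ℕ) : KLR K ν :=
  ((n.factorial : K)⁻¹) • ∑ ω : Equiv.Perm (Fin n), tauAt K ν p n ω

end Elements

section Idempotents

/-- Building blocks of generalized sequences: a single strand of any colour, a divided power
`i^{(m)}` for `i ∈ I⁺`, or `n` strands of colour `i ∈ I⁰` carrying the symmetrizer `e_{i,n}`. -/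
inductive Block (D : Datum I)
  | strand (c : Color D) : Block D
  | divided (i : I) (hi : D.IsReal i) (m : ℕ) : Block D
  | symm (i : I) (hi : D.IsZero i) (n : ℕ) : Block D

variable {D : Datum I}

/-- The underlying colours of a block, from left to right. -/
def Block.colors : Block D → List (Color D)
  | .strand c => [c]
  | .divided i hi m => List.replicate m (Color.real i hi)
  | .symm i hi n => List.replicate n (Color.zero i hi)

/-- The sequence of colours underlying a generalized sequence. -/
def colors (w : List (Block D)) : List (Color D) := w.flatMap Block.colors

/-- `⟨w⟩`: the sum of `m (m - 1) / 2 * r_i` over the divided powers `i^{(m)}` in `w`. -/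
def blockShift (w : List (Block D)) : ℤ :=
  (w.map fun
    | .strand _ => 0
    | .divided i _ m => ((m * (m - 1) / 2 : ℕ) : ℤ) * D.r i
    | .symm _ _ _ => 0).sum

variable (K : Type*) [Field K] (ν : Multiset (Color D))

/-- The diagram carried by a block whose leftmost strand is in position `p`. -/
noncomputable def Block.elem (p : ℕ) : Block D → KLR K ν
  | .strand _ => 1
  | .divided _ _ m => nilHeckeAt K ν p m
  | .symm _ _ n => symmetrizerAt K ν p n

/-- The diagrams of the blocks of `w` side by side, the first strand being in position `p`. -/
noncomputable def blocksElem : ℕ → List (Block D) → KLR K ν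
  | _, [] => 1
  | p, b :: w => b.elem K ν p * blocksElem (p + b.colors.length) w

variable {ν}

/-- The idempotent `1_w` of `R(ν)` of a generalized sequence `w` of class `ν`: the horizontal
composition of `1_c`, `e_{i,m}` and `e_{i,n}` for its blocks. -/
noncomputable def idem (w : List (Block D)) (h : (colors w : Multiset (Color D)) = ν) : KLR K ν :=
  blocksElem K ν 0 w * gen K (Gen.one (Seq.ofList (colors w) h))

end Idempotents

section Modules

variable (K : Type*) [Field K] {D : Datum I} {ν : Multiset (Color D)}

/-- The left module `R(ν) e`. -/
abbrev LeftIdeal (e : KLR K ν) : Type _ := ↥(Submodule.span (KLR K ν) {e})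

/-- The pair `(e, d)` stands for the graded left module `(R(ν) e){d}`, where `e ∈ R(ν)` is
homogeneous, `R(ν) e` has the grading induced from `R(ν)`, and `(M{d})_n = M_{n-d}`. -/
structure ShiftedIdeal (ν : Multiset (Color D)) where
  elem : KLR K ν
  shift : ℤ

variable {K}

/-- The homogeneous part of degree `n` of `(R(ν) e){d}`. -/
def ShiftedIdeal.part (P : ShiftedIdeal K ν) (n : ℤ) : Set (LeftIdeal K P.elem) :=
  {y | (y : KLR K ν) ∈ degPart K ν (n - P.shift)}

/-- The homogeneous part of degree `n` of a direct sum `⨁ c, P c`. -/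
def sumPart {ι : Type} (P : ι → ShiftedIdeal K ν) (n : ℤ) :
    Set (⨁ c, LeftIdeal K (P c).elem) :=
  {y | ∀ c, y c ∈ (P c).part n}

/-- The graded left `R(ν)`-modules `⨁ c, P c` and `⨁ c, Q c` are isomorphic: there is an
`R(ν)`-linear bijection which, with its inverse, preserves degrees. -/
def SumIso {ι κ : Type} (P : ι → ShiftedIdeal K ν) (Q : κ → ShiftedIdeal K ν) : Prop :=
  ∃ φ : (⨁ c, LeftIdeal K (P c).elem) ≃ₗ[KLR K ν] (⨁ c, LeftIdeal K (Q c).elem),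
    ∀ n y, y ∈ sumPart P n ↔ φ y ∈ sumPart Q n

/-- The graded left `R(ν)`-modules `P` and `Q` are isomorphic. -/
def Iso (P Q : ShiftedIdeal K ν) : Prop :=
  ∃ φ : LeftIdeal K P.elem ≃ₗ[KLR K ν] LeftIdeal K Q.elem,
    ∀ n y, y ∈ P.part n ↔ φ y ∈ Q.part n

variable (K)

/-- `P_w = R(ν) ψ(1_w) {-⟨w⟩}`. -/
noncomputable def proj (w : List (Block D)) (h : (colors w : Multiset (Color D)) = ν) :
    ShiftedIdeal K ν where
  elem := psi K (idem K w h)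
  shift := -blockShift w

/-- `R(ν) 1_w`, without flip or shift. -/
noncomputable def ideal (w : List (Block D)) (h : (colors w : Multiset (Color D)) = ν) :
    ShiftedIdeal K ν where
  elem := idem K w h
  shift := 0

end Modules

section Serre

variable {D : Datum I}

/-- The generalized sequence `i^{(a)} u i^{(b)}`. -/
def serreWord (i : I) (hi : D.IsReal i) (u : List (Block D)) (a b : ℕ) : List (Block D) :=
  [.divided i hi a] ++ u ++ [.divided i hi b]

/-- The class of the sequences `i^m u`. -/
def serreClass (i : I) (hi : D.IsReal i) (u : List (Block D)) (m : ℕ) : Multiset (Color D) :=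
  Multiset.replicate m (Color.real i hi) + (colors u : Multiset (Color D))

theorem serreWord_class (i : I) (hi : D.IsReal i) (u : List (Block D)) {a b m : ℕ}
    (h : a + b = m) :
    (colors (serreWord i hi u a b) : Multiset (Color D)) = serreClass i hi u m := by
  subst h
  simp only [colors, serreWord, serreClass, List.flatMap_append, List.flatMap_cons,
    List.flatMap_nil, List.append_nil, Block.colors, ← Multiset.coe_add, Multiset.coe_replicate,
    Multiset.replicate_add]
  abel

/-- There is an isomorphism of graded left `R(ν)`-modules
`⨁_{0 ≤ c ≤ ⌊m/2⌋} P_{i^{(2c)} u i^{(m-2c)}} ≅ ⨁_{0 ≤ c ≤ ⌊(m-1)/2⌋} P_{i^{(2c+1)} u i^{(m-2c-1)}}`. -/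
def SerreIso (K : Type*) [Field K] (i : I) (hi : D.IsReal i) (u : List (Block D)) (m : ℕ) :
    Prop :=
  SumIso (K := K) (ν := serreClass i hi u m)
    (fun c : {c : ℕ // 2 * c ≤ m} =>
      proj K (serreWord i hi u (2 * c) (m - 2 * c))
        (serreWord_class i hi u (Nat.add_sub_of_le c.2)))
    (fun c : {c : ℕ // 2 * c + 1 ≤ m} =>
      proj K (serreWord i hi u (2 * c + 1) (m - (2 * c + 1)))
        (serreWord_class i hi u (Nat.add_sub_of_le c.2)))

theorem colors_swap (u v : List (Block D)) :
    (colors (v ++ u) : Multiset (Color D)) = (colors (u ++ v) : Multiset (Color D)) := by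
  simp only [colors, List.flatMap_append, ← Multiset.coe_add]
  exact add_comm _ _

end Serre

end BorcherdsKLR

open BorcherdsKLR

/-!
Right multiplication by an element of `R(ν)` is a homomorphism of left ideals, so an isomorphism of
direct sums of graded left ideals `R(ν) e` is a pair of mutually inverse matrices of homogeneous
elements (`iso_of_mul`, `sumIso_of_matrix`).  Elements of `R(ν)` are written as products of total
crossings and dots, the idempotent `1_l` of a list of colours `l` being kept on the left; an equation
between such products is proved under the idempotent of the sequence it starts from, and
`mul_mul_congr` moves the idempotent through the factors that are already known.

*Quantum Serre relations.*  Let `c` be the real colour `i`, let `u` be the colours in the middle, and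
let `N = m - 1`, the degree in the dots of the strand `c` of its double crossing with all of `u`
(`crossDegree`).  Put `Λ_a = 1 · τ_{w₀} · τ_{w₀} · F` on the sequence `c^a u c^{m-a}`, with the
longest elements on both powers of `c` and the flip `F` of the diagram carried by `u`
(`serreElem`).  Since `τ_{w₀}` acts on dots as a divided difference that takes the staircase
`x_1^{a-1} ⋯ x_{a-1}` to `1`, the projective `P_{i^{(a)} u i^{(m-a)}}` is isomorphic to a shift of
`R(ν) Λ_a` (`iso_proj_serreElem`).  These left ideals form a complex: its differential `d` moves the
leftmost strand of the right hand power of `c` across `u` to the left end, and there is a map `d'`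
in the opposite direction that moves the rightmost strand of the left hand power across `u` to the
right end (`SerreData.mul_desc`, `SerreData.mul_asc`).  Both have square zero, because the crossing
of the two strands moved slides through `u` and is absorbed by a longest element.  The braid
relation for two strands `c` with the strands `u` between them (`listOne_mul_braid_eq`) expresses
`Λ_{a+1} (d' d - d d')` through a polynomial in the dots with leading term `∑ x^s y^t`,
`s + t = N - 1`, followed by divided differences on both sides; for degree reasons these keep only
the term `x^a y^{N-1-a}` and take it to a sign (`SerreData.mul_homotopy`).  So `d` and `d'`, with
suitable signs, form a matrix of square one on the sum of all the `R(ν) Λ_a` which exchanges even and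
odd `a` (`sumIso_of_homotopy`).

*Commutation relations.*  For `a i j = 0` the crossing of a block of colour `i` with a block of colour
`j` is invertible and of degree zero, and diagrams without dots slide through it
(`iso_ideal_of_orthogonal`).
-/

namespace BorcherdsKLR

/-! ### Local relations for the total dots and crossings -/

section LocalRelations

variable {I : Type*} (K : Type*) [Field K] {D : Datum I} (ν : Multiset (Color D))

open Classical in
/-- The idempotent `1_l` of the sequence given by a list of colours `l`; it is `0` if `l` does not
belong to the class `ν`, so that identities for it need no hypothesis on the class. -/
noncomputable def listOne (l : List (Color D)) : KLR K ν :=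
  if h : (l : Multiset (Color D)) = ν then gen K (Gen.one (Seq.ofList l h)) else 0

local notation "𝟙" => listOne K ν
local notation "τ" => crossAt K ν
local notation "ξ" => dotAt K ν

variable {ν}

theorem mk_eq_of_rel {a b : FreeAlgebra K (Gen ν)} (h : Rel K ν a b) :
    RingQuot.mkAlgHom K (Rel K ν) a = RingQuot.mkAlgHom K (Rel K ν) b :=
  RingQuot.mkAlgHom_rel K h

theorem gen_one_mul_gen_one (s : Seq ν) :
    gen K (Gen.one s) * gen K (Gen.one s) = gen K (Gen.one s) := by
  simpa [gen] using mk_eq_of_rel K (Rel.one_mul_one s)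

theorem gen_one_mul_gen_one_of_ne {s t : Seq ν} (h : s ≠ t) :
    gen K (Gen.one s) * gen K (Gen.one t) = 0 := by
  simpa [gen] using mk_eq_of_rel K (Rel.one_mul_one_of_ne s t h)

theorem sum_gen_one : ∑ s : Seq ν, gen K (Gen.one s) = 1 := by
  simpa [gen] using mk_eq_of_rel K (Rel.sum_one (ν := ν))

/-- Elements of `R(ν)` can be compared one bottom sequence at a time. -/
theorem eq_of_mul_gen_one {a b : KLR K ν}
    (h : ∀ s, a * gen K (Gen.one s) = b * gen K (Gen.one s)) : a = b := by
  rw [← mul_one a, ← mul_one b, ← sum_gen_one, Finset.mul_sum, Finset.mul_sum]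
  exact Finset.sum_congr rfl fun s _ => h s

theorem gen_cross_mul_one (k : ℕ) (hk : k + 1 < Multiset.card ν) (s : Seq ν) :
    gen K (Gen.cross k hk s) * gen K (Gen.one s) = gen K (Gen.cross k hk s) := by
  simpa [gen] using mk_eq_of_rel K (Rel.cross_mul_one k hk s)

theorem gen_one_mul_cross (k : ℕ) (hk : k + 1 < Multiset.card ν) (s : Seq ν) :
    gen K (Gen.one (s.swap k hk)) * gen K (Gen.cross k hk s) = gen K (Gen.cross k hk s) := by
  simpa [gen] using mk_eq_of_rel K (Rel.one_mul_cross k hk s)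

theorem gen_dot_mul_one (k : ℕ) (hk : k < Multiset.card ν) (s : Seq ν) :
    gen K (Gen.dot k hk s) * gen K (Gen.one s) = gen K (Gen.dot k hk s) := by
  simpa [gen] using mk_eq_of_rel K (Rel.dot_mul_one k hk s)

theorem gen_one_mul_gen_dot (k : ℕ) (hk : k < Multiset.card ν) (s : Seq ν) :
    gen K (Gen.one s) * gen K (Gen.dot k hk s) = gen K (Gen.dot k hk s) := by
  simpa [gen] using mk_eq_of_rel K (Rel.one_mul_dot k hk s)

theorem crossAt_mul_gen_one (k : ℕ) (hk : k + 1 < Multiset.card ν) (s : Seq ν) :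
    τ k * gen K (Gen.one s) = gen K (Gen.cross k hk s) := by
  rw [crossAt, dif_pos hk, Finset.sum_mul, Finset.sum_eq_single s]
  · exact gen_cross_mul_one K k hk s
  · intro t _ h
    rw [← gen_cross_mul_one, mul_assoc, gen_one_mul_gen_one_of_ne K h, mul_zero]
  · simp

theorem dotAt_mul_gen_one (k : ℕ) (hk : k < Multiset.card ν) (s : Seq ν) :
    ξ k * gen K (Gen.one s) = gen K (Gen.dot k hk s) := by
  rw [dotAt, dif_pos hk, Finset.sum_mul, Finset.sum_eq_single s]
  · exact gen_dot_mul_one K k hk s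
  · intro t _ h
    rw [← gen_dot_mul_one, mul_assoc, gen_one_mul_gen_one_of_ne K h, mul_zero]
  · simp

theorem gen_one_mul_dotAt (k : ℕ) (s : Seq ν) :
    gen K (Gen.one s) * ξ k = ξ k * gen K (Gen.one s) := by
  by_cases hk : k < Multiset.card ν
  · rw [dotAt_mul_gen_one K k hk s, dotAt, dif_pos hk, Finset.mul_sum, Finset.sum_eq_single s]
    · rw [gen_one_comm_dot K k hk s, gen_dot_mul_one]
    · intro t _ h
      rw [← gen_dot_mul_one, ← gen_one_comm_dot K k hk t, ← mul_assoc,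
        gen_one_mul_gen_one_of_ne K h.symm, zero_mul]
    · simp
  · simp [dotAt, hk]

theorem gen_one_mul_crossAt (k : ℕ) (hk : k + 1 < Multiset.card ν) (s : Seq ν) :
    gen K (Gen.one (s.swap k hk)) * τ k = τ k * gen K (Gen.one s) := by
  rw [crossAt_mul_gen_one K k hk s, crossAt, dif_pos hk, Finset.mul_sum, Finset.sum_eq_single s]
  · exact gen_one_mul_cross K k hk s
  · intro t _ h
    rw [← gen_one_mul_cross, ← mul_assoc, gen_one_mul_gen_one_of_ne, zero_mul]
    intro h2
    apply h
    rw [← Seq.swap_swap t k hk, ← h2, Seq.swap_swap]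
  · simp

theorem crossAt_mul_gen_cross (k l : ℕ) (hk : k + 1 < Multiset.card ν)
    (hl : l + 1 < Multiset.card ν) (s : Seq ν) :
    τ l * gen K (Gen.cross k hk s) =
      gen K (Gen.cross l hl (s.swap k hk)) * gen K (Gen.cross k hk s) := by
  conv_lhs => rw [← gen_one_mul_cross, ← mul_assoc, crossAt_mul_gen_one K l hl]

theorem dotAt_mul_gen_cross (k l : ℕ) (hk : k + 1 < Multiset.card ν)
    (hl : l < Multiset.card ν) (s : Seq ν) :
    ξ l * gen K (Gen.cross k hk s) =
      gen K (Gen.dot l hl (s.swap k hk)) * gen K (Gen.cross k hk s) := by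
  conv_lhs => rw [← gen_one_mul_cross, ← mul_assoc, dotAt_mul_gen_one K l hl]

theorem dotAt_comm (k l : ℕ) : Commute (ξ k) (ξ l) := by
  by_cases hk : k < Multiset.card ν
  · by_cases hl : l < Multiset.card ν
    · refine eq_of_mul_gen_one K fun s => ?_
      have key : ∀ (k l : ℕ) (hk : k < Multiset.card ν) (hl : l < Multiset.card ν),
          ξ k * ξ l * gen K (Gen.one s) = gen K (Gen.dot k hk s) * gen K (Gen.dot l hl s) := by
        intro k l hk hl
        rw [← dotAt_mul_gen_one K k hk, mul_assoc, mul_assoc, dotAt_mul_gen_one K l hl,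
          gen_one_mul_gen_dot]
      rw [key k l hk hl, key l k hl hk]
      exact gen_dot_comm_dot K k l hk hl s
    · rw [show ξ l = 0 by simp [dotAt, hl]]; exact Commute.zero_right _
  · rw [show ξ k = 0 by simp [dotAt, hk]]; exact Commute.zero_left _

theorem dotAt_comm_crossAt {l k : ℕ} (h : l ≠ k) (h' : l ≠ k + 1) : Commute (ξ l) (τ k) := by
  by_cases hk : k + 1 < Multiset.card ν
  · by_cases hl : l < Multiset.card ν
    · refine eq_of_mul_gen_one K fun s => ?_
      rw [mul_assoc, crossAt_mul_gen_one K k hk, dotAt_mul_gen_cross K k l hk hl, mul_assoc,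
        dotAt_mul_gen_one K l hl, ← gen_one_mul_gen_dot K l hl s, ← mul_assoc,
        crossAt_mul_gen_one K k hk]
      have := mk_eq_of_rel K (Rel.dot_comm_cross l k hl hk s h h')
      rw [map_mul, map_mul] at this
      exact this
    · rw [show ξ l = 0 by simp [dotAt, hl]]; exact Commute.zero_left _
  · rw [show τ k = 0 by simp [crossAt, hk]]; exact Commute.zero_right _

theorem crossAt_comm_of_lt {k l : ℕ} (h : k + 1 < l) : Commute (τ k) (τ l) := by
  by_cases hl : l + 1 < Multiset.card ν
  · have hk : k + 1 < Multiset.card ν := by omega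
    refine eq_of_mul_gen_one K fun s => ?_
    rw [mul_assoc, mul_assoc, crossAt_mul_gen_one K k hk, crossAt_mul_gen_one K l hl,
      crossAt_mul_gen_cross K _ _ hk hl, crossAt_mul_gen_cross K _ _ hl hk]
    have := mk_eq_of_rel K (Rel.cross_comm_cross k l hk hl s h)
    rw [map_mul, map_mul] at this
    exact this
  · rw [show τ l = 0 by simp [crossAt, hl]]; exact Commute.zero_right _

theorem crossAt_comm {k l : ℕ} (h : k + 1 < l ∨ l + 1 < k) : Commute (τ k) (τ l) :=
  h.elim (crossAt_comm_of_lt K) fun h => (crossAt_comm_of_lt K h).symm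

theorem Seq.at_ofList (l : List (Color D)) (h : (l : Multiset (Color D)) = ν) (k : ℕ)
    (hk : k < Multiset.card ν) (hk' : k < l.length) : (Seq.ofList l h).at k hk = l[k] := rfl

theorem Seq.swap_ofList {A B : List (Color D)} {a b : Color D} {p : ℕ} (hp : A.length = p)
    (h : ((A ++ a :: b :: B : List (Color D)) : Multiset (Color D)) = ν)
    (h' : ((A ++ b :: a :: B : List (Color D)) : Multiset (Color D)) = ν)
    (hk : p + 1 < Multiset.card ν) :
    (Seq.ofList _ h).swap p hk = Seq.ofList _ h' := by
  subst hp
  apply Seq.ext_at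
  intro k hk2
  have hc : Multiset.card ν = (A ++ a :: b :: B).length := by rw [← h, Multiset.coe_card]
  simp only [List.length_append, List.length_cons] at hc
  rw [Seq.at_swap, Seq.at_ofList _ _ _ _ (by simp), Seq.at_ofList _ _ _ _ (by simp),
    Seq.at_ofList _ _ _ _ (by simp; omega), Seq.at_ofList _ _ _ _ (by simp; omega)]
  split_ifs with h1 h2
  · subst h1; simp
  · subst h2; simp
  · simp only [List.getElem_append]
    split_ifs with h3
    · rfl
    · obtain ⟨t, rfl⟩ : ∃ t, k = A.length + (t + 2) := ⟨k - A.length - 2, by omega⟩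
      simp

theorem coe_swap_eq {A B : List (Color D)} {a b : Color D} :
    ((A ++ b :: a :: B : List (Color D)) : Multiset (Color D)) =
      ((A ++ a :: b :: B : List (Color D)) : Multiset (Color D)) :=
  Multiset.coe_eq_coe.2 (List.Perm.append_left _ (List.Perm.swap _ _ _))

theorem listOne_of_eq {l : List (Color D)} (h : (l : Multiset (Color D)) = ν) :
    𝟙 l = gen K (Gen.one (Seq.ofList l h)) := dif_pos h

theorem listOne_of_ne {l : List (Color D)} (h : (l : Multiset (Color D)) ≠ ν) :
    𝟙 l = 0 := dif_neg h

theorem listOne_mul_self (l : List (Color D)) : 𝟙 l * 𝟙 l = 𝟙 l := by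
  by_cases h : (l : Multiset (Color D)) = ν
  · rw [listOne_of_eq K h, gen_one_mul_gen_one]
  · rw [listOne_of_ne K h, mul_zero]

theorem listOne_comm_dotAt (l : List (Color D)) (k : ℕ) : Commute (𝟙 l) (ξ k) := by
  by_cases h : (l : Multiset (Color D)) = ν
  · rw [listOne_of_eq K h]; exact gen_one_mul_dotAt K k _
  · rw [listOne_of_ne K h]; exact Commute.zero_left _

/-- Reading off the relations of `R(ν)` at a sequence `A, a, b, B`: either its idempotent vanishes,
or it is the idempotent of a sequence in `ν` with the expected entries. -/
theorem listOne_cases {A B : List (Color D)} {a b : Color D} {p : ℕ} (hp : A.length = p)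
    {P : KLR K ν → KLR K ν → Prop} (h0 : P 0 0)
    (h : ∀ (hk : p + 1 < Multiset.card ν) (s : Seq ν), s.at p (Nat.lt_of_succ_lt hk) = a →
      s.at (p + 1) hk = b → P (gen K (Gen.one s)) (gen K (Gen.one (s.swap p hk)))) :
    P (𝟙 (A ++ a :: b :: B)) (𝟙 (A ++ b :: a :: B)) := by
  by_cases hl : ((A ++ a :: b :: B : List (Color D)) : Multiset (Color D)) = ν
  · have hl' := (coe_swap_eq (A := A) (B := B) (a := a) (b := b)).trans hl
    have hc : Multiset.card ν = (A ++ a :: b :: B).length := by rw [← hl, Multiset.coe_card]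
    simp only [List.length_append, List.length_cons] at hc
    rw [listOne_of_eq K hl, listOne_of_eq K hl', ← Seq.swap_ofList hp hl hl' (by omega)]
    subst hp
    apply h
    · rw [Seq.at_ofList _ _ _ _ (by simp)]; simp
    · rw [Seq.at_ofList _ _ _ _ (by simp)]; simp
  · rw [listOne_of_ne K hl, listOne_of_ne K (by rwa [coe_swap_eq])]; exact h0

variable {A B : List (Color D)} {a b c : Color D} {p : ℕ}

theorem listOne_mul_crossAt (hp : A.length = p) :
    𝟙 (A ++ a :: b :: B) * τ p = τ p * 𝟙 (A ++ b :: a :: B) := by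
  refine listOne_cases K hp (P := fun x y => x * τ p = τ p * y) (by simp) ?_
  intro hk s _ _
  conv_lhs => rw [← Seq.swap_swap s p hk]
  exact gen_one_mul_crossAt K p hk _

theorem gen_one_mul_crossAt_sq (hk : p + 1 < Multiset.card ν) (s : Seq ν) :
    gen K (Gen.one s) * τ p * τ p =
      gen K (Gen.cross p hk (s.swap p hk)) * gen K (Gen.cross p hk s) := by
  conv_lhs => rw [← Seq.swap_swap s p hk]
  rw [gen_one_mul_crossAt, mul_assoc, gen_one_mul_crossAt, crossAt_mul_gen_one K p hk,
    crossAt_mul_gen_cross]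

theorem listOne_mul_crossAt_sq_real (hp : A.length = p) (h : SameReal a b) :
    𝟙 (A ++ a :: b :: B) * τ p * τ p = 0 := by
  refine listOne_cases K hp (P := fun x _ => x * τ p * τ p = 0) (by simp) ?_
  rintro hk s rfl rfl
  rw [gen_one_mul_crossAt_sq K hk]
  simpa [gen] using mk_eq_of_rel K (Rel.double_real p hk s h)

theorem listOne_mul_crossAt_sq_orthogonal (hp : A.length = p) (h : D.a a.idx b.idx = 0) :
    𝟙 (A ++ a :: b :: B) * τ p * τ p = 𝟙 (A ++ a :: b :: B) := by
  refine listOne_cases K hp (P := fun x _ => x * τ p * τ p = x) (by simp) ?_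
  rintro hk s rfl rfl
  rw [gen_one_mul_crossAt_sq K hk]
  simpa [gen] using mk_eq_of_rel K (Rel.double_orthogonal p hk s h)

theorem gen_dot_pow_mul_one (s : Seq ν) (k : ℕ) (hk : k < Multiset.card ν) (n : ℕ) :
    gen K (Gen.dot k hk s) ^ n * gen K (Gen.one s) = gen K (Gen.one s) * ξ k ^ n := by
  induction n with
  | zero => simp
  | succ n ih =>
    rw [pow_succ, mul_assoc, ← gen_one_comm_dot K k hk, ← mul_assoc, ih, pow_succ, mul_assoc,
      ← dotAt_mul_gen_one K k hk, ← gen_one_mul_dotAt, ← mul_assoc (ξ k ^ n),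
      ← (show Commute (gen K (Gen.one s)) (ξ k ^ n) from
        (show Commute _ _ from gen_one_mul_dotAt K k s).pow_right n).eq, mul_assoc, ← mul_assoc,
      gen_one_mul_gen_one]

theorem listOne_mul_crossAt_sq_ne (hp : A.length = p) (hab : a ≠ b)
    (h : D.a a.idx b.idx ≠ 0) :
    𝟙 (A ++ a :: b :: B) * τ p * τ p = 𝟙 (A ++ a :: b :: B) *
      (ξ p ^ (-((b.mult : ℤ) * a.mult * D.a a.idx b.idx)).toNat +
        ξ (p + 1) ^ (-((b.mult : ℤ) * a.mult * D.a b.idx a.idx)).toNat) := by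
  refine listOne_cases K hp (P := fun x _ => x * τ p * τ p = x * (ξ p ^ _ + ξ (p + 1) ^ _))
    (by simp) ?_
  rintro hk s h1 h2
  have := mk_eq_of_rel K (Rel.double_ne p hk s a b h1 h2 hab h)
  rw [gen_one_mul_crossAt_sq K hk]
  simp only [map_mul, map_add, map_pow, add_mul] at this
  refine this.trans ?_
  rw [mul_add, ← gen_dot_pow_mul_one K s p (by omega),
    ← gen_dot_pow_mul_one K s (p + 1) hk]
  rfl

theorem gen_one_mul_cross_dot {s : Seq ν} {k l : ℕ} (hk : k + 1 < Multiset.card ν)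
    (hl : l < Multiset.card ν) :
    gen K (Gen.one (s.swap k hk)) * τ k * ξ l =
      gen K (Gen.cross k hk s) * gen K (Gen.dot l hl s) := by
  rw [gen_one_mul_crossAt, mul_assoc, gen_one_mul_dotAt, dotAt_mul_gen_one K l hl,
    ← crossAt_mul_gen_one K k hk, mul_assoc, gen_one_mul_gen_dot]

theorem gen_one_mul_dot_cross {s : Seq ν} {k l : ℕ} (hk : k + 1 < Multiset.card ν)
    (hl : l < Multiset.card ν) :
    gen K (Gen.one (s.swap k hk)) * ξ l * τ k =
      gen K (Gen.dot l hl (s.swap k hk)) * gen K (Gen.cross k hk s) := by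
  rw [gen_one_mul_dotAt, mul_assoc, gen_one_mul_crossAt, crossAt_mul_gen_one K k hk,
    dotAt_mul_gen_cross K k l hk hl]

theorem listOne_mul_dot_cross_left (hp : A.length = p) (h : ¬ SameReal a b) :
    𝟙 (A ++ a :: b :: B) * ξ p * τ p = 𝟙 (A ++ a :: b :: B) * τ p * ξ (p + 1) := by
  refine listOne_cases K hp (P := fun x _ => x * ξ p * τ p = x * τ p * ξ (p + 1)) (by simp) ?_
  rintro hk s h1 h2
  obtain ⟨t, rfl⟩ : ∃ t : Seq ν, t.swap p hk = s := ⟨_, Seq.swap_swap s p hk⟩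
  rw [gen_one_mul_cross_dot K hk hk, gen_one_mul_dot_cross K hk (by omega)]
  rw [Seq.at_swap_left] at h1
  rw [Seq.at_swap_right] at h2
  simpa [gen] using mk_eq_of_rel K (Rel.slide_left p hk t
    (by rw [h1, h2]; exact fun h' => h h'.symm))

theorem listOne_mul_dot_cross_right (hp : A.length = p) (h : ¬ SameReal a b) :
    𝟙 (A ++ a :: b :: B) * ξ (p + 1) * τ p = 𝟙 (A ++ a :: b :: B) * τ p * ξ p := by
  refine listOne_cases K hp (P := fun x _ => x * ξ (p + 1) * τ p = x * τ p * ξ p) (by simp) ?_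
  rintro hk s h1 h2
  obtain ⟨t, rfl⟩ : ∃ t : Seq ν, t.swap p hk = s := ⟨_, Seq.swap_swap s p hk⟩
  rw [gen_one_mul_cross_dot K hk (by omega), gen_one_mul_dot_cross K hk hk]
  rw [Seq.at_swap_left] at h1
  rw [Seq.at_swap_right] at h2
  simpa [gen] using (mk_eq_of_rel K (Rel.slide_right p hk t
    (by rw [h1, h2]; exact fun h' => h h'.symm))).symm

theorem listOne_mul_dot_cross_left_real (hp : A.length = p) (h : SameReal a b) :
    𝟙 (A ++ a :: b :: B) * ξ p * τ p =
      𝟙 (A ++ a :: b :: B) * τ p * ξ (p + 1) + 𝟙 (A ++ a :: b :: B) := by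
  refine listOne_cases K hp (P := fun x _ => x * ξ p * τ p = x * τ p * ξ (p + 1) + x)
    (by simp) ?_
  rintro hk s h1 h2
  have e := s.swap_eq_self p hk (by rw [h1, h2, h.eq])
  have := mk_eq_of_rel K (Rel.slide_left_real p hk s (by rw [h1, h2]; exact h))
  have h3 := gen_one_mul_cross_dot K (s := s) hk hk
  have h4 := gen_one_mul_dot_cross K (s := s) hk (Nat.lt_of_succ_lt hk)
  rw [e] at h3 h4
  rw [h3, h4, add_comm, ← sub_eq_iff_eq_add]
  simpa [gen, e] using this

theorem listOne_mul_dot_cross_right_real (hp : A.length = p) (h : SameReal a b) :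
    𝟙 (A ++ a :: b :: B) * ξ (p + 1) * τ p =
      𝟙 (A ++ a :: b :: B) * τ p * ξ p - 𝟙 (A ++ a :: b :: B) := by
  refine listOne_cases K hp (P := fun x _ => x * ξ (p + 1) * τ p = x * τ p * ξ p - x)
    (by simp) ?_
  rintro hk s h1 h2
  have e := s.swap_eq_self p hk (by rw [h1, h2, h.eq])
  have := mk_eq_of_rel K (Rel.slide_right_real p hk s (by rw [h1, h2]; exact h))
  have h3 := gen_one_mul_cross_dot K (s := s) hk (Nat.lt_of_succ_lt hk)
  have h4 := gen_one_mul_dot_cross K (s := s) hk hk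
  rw [e] at h3 h4
  rw [h3, h4, eq_sub_iff_add_eq, ← eq_sub_iff_add_eq', eq_comm]
  simpa [gen, e] using this

theorem gen_one_mul_crossAt_braid (hk : p + 2 < Multiset.card ν) (s : Seq ν) :
    gen K (Gen.one (((s.swap p (by omega)).swap (p + 1) hk).swap p (by omega))) *
        τ p * τ (p + 1) * τ p =
      gen K (Gen.cross p (by omega) ((s.swap p (by omega)).swap (p + 1) hk)) *
        gen K (Gen.cross (p + 1) hk (s.swap p (by omega))) *
        gen K (Gen.cross p (by omega) s) := by
  rw [gen_one_mul_crossAt K p (by omega), mul_assoc (τ p), gen_one_mul_crossAt K (p + 1) hk,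
    mul_assoc, mul_assoc, gen_one_mul_crossAt K p (by omega), crossAt_mul_gen_one K p (by omega),
    crossAt_mul_gen_cross K p (p + 1) _ hk, ← mul_assoc, crossAt_mul_gen_cross K (p + 1) p hk]

theorem gen_one_mul_crossAt_braid' (hk : p + 2 < Multiset.card ν) (s : Seq ν) :
    gen K (Gen.one (((s.swap (p + 1) hk).swap p (by omega)).swap (p + 1) hk)) *
        τ (p + 1) * τ p * τ (p + 1) =
      gen K (Gen.cross (p + 1) (by omega) ((s.swap (p + 1) hk).swap p (by omega))) *
        gen K (Gen.cross p (by omega) (s.swap (p + 1) hk)) *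
        gen K (Gen.cross (p + 1) (by omega) s) := by
  rw [gen_one_mul_crossAt K (p + 1) hk, mul_assoc (τ (p + 1)),
    gen_one_mul_crossAt K p (by omega), mul_assoc, mul_assoc, gen_one_mul_crossAt K (p + 1) hk,
    crossAt_mul_gen_one K (p + 1) hk, crossAt_mul_gen_cross K (p + 1) p hk (by omega),
    ← mul_assoc, crossAt_mul_gen_cross K p (p + 1) _ hk]

/-- The version of `listOne_cases` for three adjacent strands. -/
theorem listOne_cases_three {A B : List (Color D)} {a b c : Color D} {p : ℕ} (hp : A.length = p)
    {P : KLR K ν → Prop} (h0 : P 0)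
    (h : ∀ (hk : p + 2 < Multiset.card ν) (s : Seq ν), s.at p (by omega) = a →
      s.at (p + 1) (by omega) = b → s.at (p + 2) hk = c → P (gen K (Gen.one s))) :
    P (𝟙 (A ++ a :: b :: c :: B)) := by
  by_cases hl : ((A ++ a :: b :: c :: B : List (Color D)) : Multiset (Color D)) = ν
  · have hc : Multiset.card ν = (A ++ a :: b :: c :: B).length := by rw [← hl, Multiset.coe_card]
    simp only [List.length_append, List.length_cons] at hc
    rw [listOne_of_eq K hl]
    subst hp
    apply h (by omega)
    · rw [Seq.at_ofList _ _ _ _ (by simp)]; simp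
    · rw [Seq.at_ofList _ _ _ _ (by simp)]; simp
    · rw [Seq.at_ofList _ _ _ _ (by simp)]; simp
  · rw [listOne_of_ne K hl]; exact h0

/-- Every sequence is the top of a braid of three strands, in both of its forms. -/
theorem Seq.eq_swap_braid (s : Seq ν) (k : ℕ) (hk : k + 2 < Multiset.card ν) :
    ∃ t : Seq ν, ((t.swap k (by omega)).swap (k + 1) hk).swap k (by omega) = s ∧
      ((t.swap (k + 1) hk).swap k (by omega)).swap (k + 1) hk = s ∧
      t.at k (by omega) = s.at (k + 2) hk ∧ t.at (k + 1) (by omega) = s.at (k + 1) (by omega) ∧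
      t.at (k + 2) hk = s.at k (by omega) := by
  have e : ((((((s.swap k (by omega)).swap (k + 1) hk).swap k (by omega)).swap k (by omega)).swap
      (k + 1) hk).swap k (by omega)) = s := by
    rw [Seq.swap_swap, Seq.swap_swap, Seq.swap_swap]
  refine ⟨((s.swap k (by omega)).swap (k + 1) hk).swap k (by omega), e, ?_, ?_, ?_, ?_⟩
  · rw [← Seq.swap_braid, e]
  all_goals
    simp only [Seq.at_swap]
    split_ifs <;> first | rfl | omega

theorem listOne_mul_braid (hp : A.length = p) (h : ¬ BraidException a b c) :
    𝟙 (A ++ a :: b :: c :: B) * τ p * τ (p + 1) * τ p =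
      𝟙 (A ++ a :: b :: c :: B) * τ (p + 1) * τ p * τ (p + 1) := by
  refine listOne_cases_three K hp
    (P := fun x => x * τ p * τ (p + 1) * τ p = x * τ (p + 1) * τ p * τ (p + 1)) (by simp) ?_
  intro hk s h1 h2 h3
  obtain ⟨t, e1, e2, ha, hb, hc⟩ := s.eq_swap_braid p hk
  have h4 := gen_one_mul_crossAt_braid K hk t
  have h5 := gen_one_mul_crossAt_braid' K hk t
  rw [e1] at h4
  rw [e2] at h5
  rw [h4, h5]
  simpa [gen] using mk_eq_of_rel K (Rel.braid p hk t
    (by rw [ha, hb, hc, h1, h2, h3]; exact fun h' => h h'.symm))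

theorem listOne_mul_braid_real (hp : A.length = p) (h : BraidException a b c) :
    𝟙 (A ++ a :: b :: c :: B) * τ p * τ (p + 1) * τ p =
      𝟙 (A ++ a :: b :: c :: B) * τ (p + 1) * τ p * τ (p + 1) +
      𝟙 (A ++ a :: b :: c :: B) *
        ∑ t ∈ Finset.range (-((b.mult : ℤ) * D.a a.idx b.idx)).toNat,
          ξ p ^ t * ξ (p + 2) ^ ((-((b.mult : ℤ) * D.a a.idx b.idx)).toNat - 1 - t) := by
  refine listOne_cases_three K hp
    (P := fun x => x * τ p * τ (p + 1) * τ p = x * τ (p + 1) * τ p * τ (p + 1) +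
      x * ∑ t ∈ Finset.range _, ξ p ^ t * ξ (p + 2) ^ (_ - 1 - t)) (by simp) ?_
  intro hk s h1 h2 h3
  obtain ⟨t, e1, e2, ha, hb, hc⟩ := s.eq_swap_braid p hk
  have e : t = s := by
    apply Seq.ext_at
    intro l hl
    have := h.1.eq
    rw [← e1]
    simp only [Seq.at_swap]
    split_ifs <;> grind
  subst e
  have h4 := gen_one_mul_crossAt_braid K hk t
  have h5 := gen_one_mul_crossAt_braid' K hk t
  rw [e1] at h4
  rw [e2] at h5
  rw [h4, h5, ← sub_eq_iff_eq_add', Finset.mul_sum]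
  have := mk_eq_of_rel K (Rel.braid_real p hk t a b h1 h2 (by rw [h3]; exact h))
  simp only [map_mul, map_sub, map_sum, map_pow] at this
  refine this.trans (Finset.sum_congr rfl fun n _ => ?_)
  have c1 : Commute (gen K (Gen.one t)) (gen K (Gen.dot p (by omega) t)) :=
    gen_one_comm_dot K p _ t
  have k1 := gen_dot_pow_mul_one K t p (by omega) n
  have k2 := gen_dot_pow_mul_one K t (p + 2) hk
    ((-((b.mult : ℤ) * D.a a.idx b.idx)).toNat - 1 - n)
  rw [← mul_assoc, ← k1, mul_assoc (gen K _ ^ n), ← k2, ← mul_assoc]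
  rfl

end LocalRelations

/-! ### Moving strands across groups of strands -/

section CrossingWords

variable {I : Type*} (K : Type*) [Field K] {D : Datum I} (ν : Multiset (Color D))

local notation "𝟙" => listOne K ν
local notation "τ" => crossAt K ν

/-- `τ_{p+l-1} ⋯ τ_{p+1} τ_p`: going down, the strand in position `p + l` at the top moves to the
left across `l` strands. -/
noncomputable def descAt (p l : ℕ) : KLR K ν := ((List.range' p l).reverse.map τ).prod

/-- `τ_p τ_{p+1} ⋯ τ_{p+l-1}`: going down, the strand in position `p` at the top moves to the right
across `l` strands. -/
noncomputable def ascAt (p l : ℕ) : KLR K ν := ((List.range' p l).map τ).prod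

local notation "δ" => descAt K ν
local notation "α" => ascAt K ν

variable {K ν}

@[simp] theorem descAt_zero (p : ℕ) : δ p 0 = 1 := rfl

@[simp] theorem ascAt_zero (p : ℕ) : α p 0 = 1 := rfl

theorem descAt_succ (p l : ℕ) : δ p (l + 1) = τ (p + l) * δ p l := by
  simp [descAt, List.range'_concat]

theorem descAt_succ' (p l : ℕ) : δ p (l + 1) = δ (p + 1) l * τ p := by
  simp [descAt, List.range'_succ]

theorem ascAt_succ (p l : ℕ) : α p (l + 1) = α p l * τ (p + l) := by
  simp [ascAt, List.range'_concat]

theorem ascAt_succ' (p l : ℕ) : α p (l + 1) = τ p * α (p + 1) l := by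
  simp [ascAt, List.range'_succ]

theorem descAt_add (p l k : ℕ) : δ p (l + k) = δ (p + l) k * δ p l := by
  induction k with
  | zero => simp
  | succ k ih => rw [← add_assoc, descAt_succ, ih, descAt_succ, ← mul_assoc, add_assoc]

theorem ascAt_add (p l k : ℕ) : α p (l + k) = α p l * α (p + l) k := by
  induction k with
  | zero => simp
  | succ k ih => rw [← add_assoc, ascAt_succ, ih, ascAt_succ, mul_assoc, add_assoc]

theorem commute_descAt {z : KLR K ν} {p l : ℕ}
    (h : ∀ k, p ≤ k → k < p + l → Commute z (τ k)) : Commute z (δ p l) := by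
  refine Commute.list_prod_right _ _ fun y hy => ?_
  obtain ⟨k, hk, rfl⟩ := List.mem_map.1 hy
  rw [List.mem_reverse, List.mem_range'_1] at hk
  exact h k hk.1 hk.2

theorem commute_ascAt {z : KLR K ν} {p l : ℕ}
    (h : ∀ k, p ≤ k → k < p + l → Commute z (τ k)) : Commute z (α p l) := by
  refine Commute.list_prod_right _ _ fun y hy => ?_
  obtain ⟨k, hk, rfl⟩ := List.mem_map.1 hy
  rw [List.mem_range'_1] at hk
  exact h k hk.1 hk.2

theorem crossAt_comm_descAt {k p l : ℕ} (h : k + 1 < p ∨ p + l < k) :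
    Commute (τ k) (δ p l) :=
  commute_descAt fun j h1 h2 => crossAt_comm K (by omega)

theorem crossAt_comm_ascAt {k p l : ℕ} (h : k + 1 < p ∨ p + l < k) :
    Commute (τ k) (α p l) :=
  commute_ascAt fun j h1 h2 => crossAt_comm K (by omega)

/-- An equation `e' x = e' y` can be used behind a factor `d` that takes `e` to `e'`. -/
theorem mul_mul_congr {R : Type*} [Semigroup R] {e e' d x y : R} (h : e * d = d * e')
    (h' : e' * x = e' * y) : e * (d * x) = e * (d * y) := by
  rw [← mul_assoc, h, mul_assoc, h', ← mul_assoc, ← h, mul_assoc]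

variable {A B u : List (Color D)} {b b' : Color D} {p l : ℕ}

theorem listOne_mul_descAt (hp : A.length = p) (hl : u.length = l) :
    𝟙 (A ++ (u ++ b :: B)) * δ p l = δ p l * 𝟙 (A ++ b :: (u ++ B)) := by
  induction u generalizing A p l with
  | nil => subst hl; simp
  | cons d u ih =>
    subst hl
    have h1 := ih (A := A ++ [d]) (p := p + 1) (by simp [hp]) rfl
    simp only [List.append_assoc, List.singleton_append] at h1
    rw [List.length_cons, descAt_succ', List.cons_append, ← mul_assoc, h1, mul_assoc,
      listOne_mul_crossAt K hp, ← mul_assoc, List.cons_append]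

theorem listOne_mul_ascAt (hp : A.length = p) (hl : u.length = l) :
    𝟙 (A ++ b :: (u ++ B)) * α p l = α p l * 𝟙 (A ++ (u ++ b :: B)) := by
  induction u generalizing A p l with
  | nil => subst hl; simp
  | cons d u ih =>
    subst hl
    have h1 := ih (A := A ++ [d]) (p := p + 1) (by simp [hp]) rfl
    simp only [List.append_assoc, List.singleton_append] at h1
    rw [List.length_cons, ascAt_succ', List.cons_append, ← mul_assoc, listOne_mul_crossAt K hp,
      mul_assoc, h1, ← mul_assoc, List.cons_append]

theorem listOne_mul_descAt_mul_ascAt (hp : A.length = p) (hl : u.length = l)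
    (h : ∀ d ∈ u, D.a d.idx b.idx = 0) :
    𝟙 (A ++ (u ++ b :: B)) * δ p l * α p l = 𝟙 (A ++ (u ++ b :: B)) := by
  induction u generalizing A p l with
  | nil => subst hl; simp
  | cons d u ih =>
    subst hl
    have h1 := ih (A := A ++ [d]) (p := p + 1) (by simp [hp]) rfl (fun x hx => h x (by simp [hx]))
    have h2 := listOne_mul_descAt (K := K) (ν := ν) (A := A ++ [d]) (u := u) (b := b) (B := B)
      (p := p + 1) (by simp [hp]) rfl
    simp only [List.append_assoc, List.singleton_append] at h1 h2
    have h3 := listOne_mul_crossAt_sq_orthogonal K (ν := ν) (B := u ++ B) hp (h d (by simp))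
    rw [List.length_cons, ascAt_succ', descAt_succ', List.cons_append, ← mul_assoc, ← mul_assoc, h2,
      mul_assoc (δ _ _), mul_assoc (δ _ _), h3, ← h2, h1]

theorem listOne_mul_ascAt_mul_descAt (hp : A.length = p) (hl : u.length = l)
    (h : ∀ d ∈ u, D.a b.idx d.idx = 0) :
    𝟙 (A ++ b :: (u ++ B)) * α p l * δ p l = 𝟙 (A ++ b :: (u ++ B)) := by
  induction u generalizing A p l with
  | nil => subst hl; simp
  | cons d u ih =>
    subst hl
    have h1 := ih (A := A ++ [d]) (p := p + 1) (by simp [hp]) rfl (fun x hx => h x (by simp [hx]))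
    simp only [List.append_assoc, List.singleton_append] at h1
    rw [List.length_cons, ascAt_succ', descAt_succ', List.cons_append, ← mul_assoc, ← mul_assoc,
      listOne_mul_crossAt K hp, mul_assoc (τ p), mul_assoc (τ p), h1,
      ← listOne_mul_crossAt K hp, listOne_mul_crossAt_sq_orthogonal K hp (h d (by simp))]

theorem exists_eq_append_cons_cons {k : ℕ} (h : k + 1 < u.length) :
    ∃ u₁ d e u₂, u = u₁ ++ d :: e :: u₂ ∧ u₁.length = k := by
  refine ⟨u.take k, u[k], u[k + 1], u.drop (k + 2), ?_, by simp; omega⟩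
  rw [List.getElem_cons_drop, List.getElem_cons_drop, List.take_append_drop]

/-- A crossing slides along a strand that moves to the left across it. -/
theorem listOne_mul_crossAt_mul_descAt (hp : A.length = p) (hl : u.length = l)
    (h : ∀ d ∈ u, ¬ SameReal d b) {k : ℕ} (hk : k + 1 < l) :
    𝟙 (A ++ (u ++ b :: B)) * τ (p + k) * δ p l =
      𝟙 (A ++ (u ++ b :: B)) * δ p l * τ (p + k + 1) := by
  subst hl
  obtain ⟨u₁, d, e, u₂, rfl, h1⟩ := exists_eq_append_cons_cons hk
  have hlen : (u₁ ++ d :: e :: u₂).length = k + (1 + (1 + u₂.length)) := by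
    simp [h1]; omega
  have h2 := listOne_mul_descAt (K := K) (ν := ν) (A := A ++ u₁ ++ [d, e]) (u := u₂) (b := b)
    (B := B) (p := p + k + 1 + 1) (by simp [hp, h1]; omega) rfl
  have h3 := listOne_mul_braid K (ν := ν) (A := A ++ u₁) (a := d) (b := e) (c := b) (B := u₂ ++ B)
    (p := p + k) (by simp [hp, h1]) (fun hb => h d (by simp) hb.1)
  simp only [List.append_assoc, List.cons_append, List.nil_append] at h2 h3
  have h4 : δ p (k + (1 + (1 + u₂.length))) =
      δ (p + k + 1 + 1) u₂.length * (τ (p + k + 1) * (τ (p + k) * δ p k)) := by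
    rw [descAt_add, descAt_add, descAt_add, descAt_succ, descAt_succ]
    simp [mul_assoc]
  rw [List.append_assoc, List.cons_append, List.cons_append]
  have h5 : τ (p + k) * δ p (k + (1 + (1 + u₂.length))) =
      δ (p + k + 1 + 1) u₂.length * (τ (p + k) * τ (p + k + 1) * τ (p + k) * δ p k) := by
    rw [h4, ← mul_assoc, (crossAt_comm_descAt (by omega)).eq]
    simp only [mul_assoc]
  have h6 : δ p (k + (1 + (1 + u₂.length))) * τ (p + k + 1) =
      δ (p + k + 1 + 1) u₂.length * (τ (p + k + 1) * τ (p + k) * τ (p + k + 1) * δ p k) := by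
    rw [h4]
    simp only [mul_assoc]
    rw [(crossAt_comm_descAt (K := K) (ν := ν) (k := p + k + 1) (p := p) (l := k) (by omega)).eq]
  rw [hlen, mul_assoc, mul_assoc, h5, h6]
  refine mul_mul_congr h2 ?_
  simp only [← mul_assoc, h3]

theorem listOne_mul_crossAt_mul_ascAt (hp : A.length = p) (hl : u.length = l)
    (h : ∀ d ∈ u, ¬ SameReal d b) {k : ℕ} (hk : k + 1 < l) :
    𝟙 (A ++ b :: (u ++ B)) * τ (p + k + 1) * α p l =
      𝟙 (A ++ b :: (u ++ B)) * α p l * τ (p + k) := by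
  subst hl
  obtain ⟨u₁, d, e, u₂, rfl, h1⟩ := exists_eq_append_cons_cons hk
  have hlen : (u₁ ++ d :: e :: u₂).length = k + (1 + (1 + u₂.length)) := by
    simp [h1]; omega
  have h2 := listOne_mul_ascAt (K := K) (ν := ν) (A := A) (u := u₁) (b := b)
    (B := d :: e :: u₂ ++ B) hp h1
  have h3 := listOne_mul_braid K (ν := ν) (A := A ++ u₁) (a := b) (b := d) (c := e) (B := u₂ ++ B)
    (p := p + k) (by simp [hp, h1]) (fun hb => h e (by simp) hb.1.symm)
  simp only [List.append_assoc, List.cons_append] at h2 h3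
  have h4 : α p (k + (1 + (1 + u₂.length))) =
      α p k * (τ (p + k) * (τ (p + k + 1) * α (p + k + 1 + 1) u₂.length)) := by
    rw [ascAt_add, ascAt_add, ascAt_add, ascAt_succ, ascAt_succ]
    simp
  rw [List.append_assoc, List.cons_append, List.cons_append]
  have h5 : τ (p + k + 1) * α p (k + (1 + (1 + u₂.length))) =
      α p k * (τ (p + k + 1) * τ (p + k) * τ (p + k + 1) * α (p + k + 1 + 1) u₂.length) := by
    rw [h4, ← mul_assoc, (crossAt_comm_ascAt (by omega)).eq]
    simp only [mul_assoc]
  have h6 : α p (k + (1 + (1 + u₂.length))) * τ (p + k) =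
      α p k * (τ (p + k) * τ (p + k + 1) * τ (p + k) * α (p + k + 1 + 1) u₂.length) := by
    rw [h4]
    simp only [mul_assoc]
    rw [(crossAt_comm_ascAt (K := K) (ν := ν) (k := p + k) (p := p + k + 1 + 1) (by omega)).eq]
  rw [hlen, mul_assoc, mul_assoc, h5, h6]
  refine mul_mul_congr h2 ?_
  simp only [← mul_assoc, h3]

/-- A crossing of two strands slides through a group of strands that both of them cross. -/
theorem listOne_mul_crossAt_mul_descAt_descAt (hp : A.length = p) (hl : u.length = l)
    (h : ∀ d ∈ u, ¬ SameReal d b') :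
    𝟙 (A ++ (u ++ b :: b' :: B)) * τ (p + l) * (δ p l * δ (p + 1) l) =
      𝟙 (A ++ (u ++ b :: b' :: B)) * (δ p l * δ (p + 1) l) * τ p := by
  induction u generalizing A p l with
  | nil => subst hl; simp
  | cons d u ih =>
    subst hl
    have h1 := ih (A := A ++ [d]) (p := p + 1) (by simp [hp]) rfl (fun x hx => h x (by simp [hx]))
    have h2 := listOne_mul_descAt (K := K) (ν := ν) (A := A ++ [d]) (u := u) (b := b)
      (B := b' :: B) (p := p + 1) (by simp [hp]) rfl
    have h3 := listOne_mul_descAt (K := K) (ν := ν) (A := A ++ [d, b]) (u := u) (b := b')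
      (B := B) (p := p + 1 + 1) (by simp [hp]) rfl
    have h4 := listOne_mul_braid K (ν := ν) (A := A) (a := d) (b := b) (c := b') (B := u ++ B)
      hp (fun hb => h d (by simp) hb.1)
    simp only [List.append_assoc, List.cons_append, List.nil_append]
      at h1 h2 h3
    have h5 : δ p (u.length + 1) * δ (p + 1) (u.length + 1) =
        δ (p + 1) u.length * δ (p + 1 + 1) u.length * (τ p * τ (p + 1)) := by
      rw [descAt_succ', descAt_succ', mul_assoc, ← mul_assoc (τ p),
        (crossAt_comm_descAt (by omega)).eq]
      simp only [mul_assoc]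
    have h6 : 𝟙 (A ++ d :: (u ++ b :: b' :: B)) * (δ (p + 1) u.length * δ (p + 1 + 1) u.length) =
        δ (p + 1) u.length * δ (p + 1 + 1) u.length * 𝟙 (A ++ d :: b :: b' :: (u ++ B)) := by
      rw [← mul_assoc, h2, mul_assoc, h3, ← mul_assoc]
    rw [List.length_cons, h5, ← add_assoc, add_right_comm, List.cons_append, ← mul_assoc, h1,
      mul_assoc, mul_assoc, mul_assoc (𝟙 _), mul_assoc (δ _ _ * _)]
    refine mul_mul_congr h6 ?_
    simp only [← mul_assoc, h4]

theorem listOne_mul_ascAt_ascAt_mul_crossAt (hp : A.length = p) (hl : u.length = l)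
    (h : ∀ d ∈ u, ¬ SameReal d b) :
    𝟙 (A ++ b :: b' :: (u ++ B)) * (α (p + 1) l * α p l) * τ (p + l) =
      𝟙 (A ++ b :: b' :: (u ++ B)) * τ p * (α (p + 1) l * α p l) := by
  induction u generalizing A p l with
  | nil => subst hl; simp
  | cons d u ih =>
    subst hl
    have h1 := ih (A := A ++ [d]) (p := p + 1) (by simp [hp]) rfl (fun x hx => h x (by simp [hx]))
    have h2 := listOne_mul_crossAt K (ν := ν) (A := A ++ [b]) (a := b') (b := d) (B := u ++ B)
      (p := p + 1) (by simp [hp])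
    have h3 := listOne_mul_crossAt K (ν := ν) (A := A) (a := b) (b := d) (B := b' :: (u ++ B)) hp
    have h4 := listOne_mul_braid K (ν := ν) (A := A) (a := b) (b := b') (c := d) (B := u ++ B)
      hp (fun hb => h d (by simp) hb.1.symm)
    simp only [List.append_assoc, List.cons_append, List.nil_append]
      at h1 h2 h3 ⊢
    have h5 : α (p + 1) (u.length + 1) * α p (u.length + 1) =
        τ (p + 1) * (τ p * (α (p + 1 + 1) u.length * α (p + 1) u.length)) := by
      rw [ascAt_succ', ascAt_succ', mul_assoc, ← mul_assoc (α _ _),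
        ← (crossAt_comm_ascAt (by omega)).eq]
      simp only [mul_assoc]
    have h6 : 𝟙 (A ++ b :: b' :: d :: (u ++ B)) * (τ (p + 1) * τ p) =
        τ (p + 1) * τ p * 𝟙 (A ++ d :: b :: b' :: (u ++ B)) := by
      rw [← mul_assoc, h2, mul_assoc, h3, ← mul_assoc]
    rw [List.length_cons, h5, show p + (u.length + 1) = p + 1 + u.length by omega]
    rw [← mul_assoc (τ (p + 1)), mul_assoc, mul_assoc (τ (p + 1) * τ p)]
    refine (mul_mul_congr h6 ((mul_assoc _ _ _).symm.trans (h1.trans (mul_assoc _ _ _)))).trans ?_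
    simp only [← mul_assoc, h4]

end CrossingWords

/-! ### Diagrams made of crossings inside a block, and the crossing of two blocks -/

section Blocks

variable {I : Type*} (K : Type*) [Field K] {D : Datum I} (ν : Multiset (Color D))

local notation "𝟙" => listOne K ν
local notation "τ" => crossAt K ν
local notation "δ" => descAt K ν
local notation "α" => ascAt K ν

/-- Linear combinations of diagrams on `q` strands without dots, as functions of the position of
the leftmost of these strands: the same diagram has to be placed at different positions when other
strands move past it. -/
noncomputable def wordSpan (q : ℕ) : Submodule K (ℕ → KLR K ν) :=
  Submodule.span K
    {f | ∃ w : List ℕ, (∀ k ∈ w, k + 1 < q) ∧ f = fun p => (w.map fun k => τ (p + k)).prod}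

variable {K ν}

theorem one_mem_wordSpan (q : ℕ) : (fun _ => 1) ∈ wordSpan K ν q :=
  Submodule.subset_span ⟨[], by simp, by simp⟩

theorem redWord_lt : ∀ (n : ℕ) (ω : Equiv.Perm (Fin n)), ∀ k ∈ redWord n ω, k + 1 < n
  | 0, _, k, hk => by simp [redWord] at hk
  | n + 1, ω, k, hk => by
    rw [redWord, List.mem_append, List.mem_reverse, List.mem_range'_1] at hk
    rcases hk with hk | hk
    · exact (redWord_lt n _ k hk).trans (Nat.lt_succ_self n)
    · have := (ω.symm (Fin.last n)).is_lt
      omega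

theorem tauAt_mem_wordSpan {n : ℕ} (ω : Equiv.Perm (Fin n)) :
    (fun p => tauAt K ν p n ω) ∈ wordSpan K ν n :=
  Submodule.subset_span ⟨redWord n ω, redWord_lt n ω, rfl⟩

theorem symmetrizerAt_mem_wordSpan (n : ℕ) :
    (fun p => symmetrizerAt K ν p n) ∈ wordSpan K ν n := by
  have : (fun p => symmetrizerAt K ν p n) =
      ((n.factorial : K)⁻¹) • ∑ ω : Equiv.Perm (Fin n), fun p => tauAt K ν p n ω := by
    ext p
    simp [symmetrizerAt, Finset.sum_apply]
  rw [this]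
  exact Submodule.smul_mem _ _ (Submodule.sum_mem _ fun ω _ => tauAt_mem_wordSpan ω)

variable {q : ℕ} {F : ℕ → KLR K ν}

theorem commute_of_mem_wordSpan (hF : F ∈ wordSpan K ν q) {z : KLR K ν} {p : ℕ}
    (h : ∀ k, p ≤ k → k + 1 < p + q → Commute z (τ k)) : Commute z (F p) := by
  induction hF using Submodule.span_induction with
  | mem f hf =>
    obtain ⟨w, hw, rfl⟩ := hf
    refine Commute.list_prod_right _ _ fun y hy => ?_
    obtain ⟨k, hk, rfl⟩ := List.mem_map.1 hy
    have := hw k hk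
    exact h _ (by omega) (by omega)
  | zero => exact Commute.zero_right _
  | add f g _ _ hf hg => exact hf.add_right hg
  | smul c f _ hf => exact hf.smul_right c

variable {A B u : List (Color D)} {b : Color D} {p l : ℕ}

theorem listOne_mul_word_mul_descAt (w : List ℕ) (hp : A.length = p) (hl : u.length = l)
    (h : ∀ d ∈ u, ¬ SameReal d b) (hw : ∀ k ∈ w, k + 1 < l) :
    𝟙 (A ++ (u ++ b :: B)) * ((w.map fun k => τ (p + k)).prod * δ p l) =
      𝟙 (A ++ (u ++ b :: B)) * (δ p l * (w.map fun k => τ (p + 1 + k)).prod) := by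
  induction w generalizing u with
  | nil => simp
  | cons k w ih =>
    have hk := hw k (by simp)
    subst hl
    obtain ⟨u₁, d, e, u₂, hu, h1⟩ := exists_eq_append_cons_cons hk
    have hperm : (u₁ ++ e :: d :: u₂).length = u.length := by rw [hu]; simp
    have h2 := listOne_mul_crossAt K (ν := ν) (A := A ++ u₁) (a := d) (b := e)
      (B := u₂ ++ b :: B) (p := p + k) (by simp [hp, h1])
    have h3 := ih hperm (fun x hx => h x (by rw [hu]; simp at hx ⊢; tauto))
      (fun x hx => hw x (by simp [hx]))
    have h4 := listOne_mul_crossAt_mul_descAt (K := K) (ν := ν) (B := B) hp rfl h hk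
    simp only [List.append_assoc, List.cons_append] at h2 h3
    have hu' : A ++ (u ++ b :: B) = A ++ (u₁ ++ d :: e :: (u₂ ++ b :: B)) := by simp [hu]
    rw [List.map_cons, List.prod_cons, List.map_cons, List.prod_cons, mul_assoc, hu',
      mul_mul_congr h2 h3, ← hu', ← mul_assoc, ← mul_assoc, h4, ← mul_assoc, ← mul_assoc,
      add_right_comm]

theorem listOne_mul_word_mul_ascAt (w : List ℕ) (hp : A.length = p) (hl : u.length = l)
    (h : ∀ d ∈ u, ¬ SameReal d b) (hw : ∀ k ∈ w, k + 1 < l) :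
    𝟙 (A ++ b :: (u ++ B)) * ((w.map fun k => τ (p + 1 + k)).prod * α p l) =
      𝟙 (A ++ b :: (u ++ B)) * (α p l * (w.map fun k => τ (p + k)).prod) := by
  induction w generalizing u with
  | nil => simp
  | cons k w ih =>
    have hk := hw k (by simp)
    subst hl
    obtain ⟨u₁, d, e, u₂, hu, h1⟩ := exists_eq_append_cons_cons hk
    have hperm : (u₁ ++ e :: d :: u₂).length = u.length := by rw [hu]; simp
    have h2 := listOne_mul_crossAt K (ν := ν) (A := A ++ b :: u₁) (a := d) (b := e)
      (B := u₂ ++ B) (p := p + 1 + k) (by simp [hp, h1]; omega)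
    have h3 := ih hperm (fun x hx => h x (by rw [hu]; simp at hx ⊢; tauto))
      (fun x hx => hw x (by simp [hx]))
    have h4 := listOne_mul_crossAt_mul_ascAt (K := K) (ν := ν) (B := B) hp rfl h hk
    simp only [List.append_assoc, List.cons_append] at h2 h3
    have hu' : A ++ b :: (u ++ B) = A ++ b :: (u₁ ++ d :: e :: (u₂ ++ B)) := by simp [hu]
    rw [List.map_cons, List.prod_cons, List.map_cons, List.prod_cons, mul_assoc, hu',
      mul_mul_congr h2 h3, ← hu', ← mul_assoc, ← mul_assoc, add_right_comm, h4, ← mul_assoc,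
      ← mul_assoc]

/-- Diagrams of crossings slide along a strand that moves to the left across them. -/
theorem listOne_mul_wordSpan_mul_descAt (hF : F ∈ wordSpan K ν l) (hp : A.length = p)
    (hl : u.length = l) (h : ∀ d ∈ u, ¬ SameReal d b) :
    𝟙 (A ++ (u ++ b :: B)) * (F p * δ p l) = 𝟙 (A ++ (u ++ b :: B)) * (δ p l * F (p + 1)) := by
  induction hF using Submodule.span_induction with
  | mem f hf =>
    obtain ⟨w, hw, rfl⟩ := hf
    exact listOne_mul_word_mul_descAt w hp hl h hw
  | zero => simp
  | add f g _ _ hf hg => simp only [Pi.add_apply, add_mul, mul_add, hf, hg]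
  | smul c f _ hf => simp only [Pi.smul_apply, smul_mul_assoc, mul_smul_comm, hf]

theorem listOne_mul_wordSpan_mul_ascAt (hF : F ∈ wordSpan K ν l) (hp : A.length = p)
    (hl : u.length = l) (h : ∀ d ∈ u, ¬ SameReal d b) :
    𝟙 (A ++ b :: (u ++ B)) * (F (p + 1) * α p l) =
      𝟙 (A ++ b :: (u ++ B)) * (α p l * F p) := by
  induction hF using Submodule.span_induction with
  | mem f hf =>
    obtain ⟨w, hw, rfl⟩ := hf
    exact listOne_mul_word_mul_ascAt w hp hl h hw
  | zero => simp
  | add f g _ _ hf hg => simp only [Pi.add_apply, add_mul, mul_add, hf, hg]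
  | smul c f _ hf => simp only [Pi.smul_apply, smul_mul_assoc, mul_smul_comm, hf]

/-- The idempotent of a sequence commutes with the diagrams on a block of strands of one colour. -/
theorem listOne_comm_crossAt_replicate {c : Color D} {m k : ℕ} (hp : A.length = p)
    (hk : p ≤ k) (hk' : k + 1 < p + m) :
    Commute (𝟙 (A ++ (List.replicate m c ++ B))) (τ k) := by
  obtain ⟨t, rfl⟩ := Nat.exists_eq_add_of_le hk
  obtain ⟨n, rfl⟩ : ∃ n, m = t + (n + 2) := ⟨m - t - 2, by omega⟩
  have h := listOne_mul_crossAt K (ν := ν) (A := A ++ List.replicate t c) (a := c) (b := c)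
    (B := List.replicate n c ++ B) (p := p + t) (by simp [hp])
  simp only [List.append_assoc] at h
  rw [List.replicate_add, List.replicate_succ, List.replicate_succ]
  simp only [List.append_assoc, List.cons_append]
  exact h

variable (K ν) in
/-- The crossing of `l` strands, the leftmost being in position `p` at the top, with the next `k`
strands. -/
noncomputable def blockCross : ℕ → ℕ → ℕ → KLR K ν
  | _, _, 0 => 1
  | p, l, k + 1 => descAt K ν p l * blockCross (p + 1) l k

variable (K ν) in
/-- The flip of `blockCross`: the crossing of `k` strands, the leftmost being in position `p` at the
top, with the next `l` strands. -/
noncomputable def blockCrossInv : ℕ → ℕ → ℕ → KLR K ν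
  | _, _, 0 => 1
  | p, l, k + 1 => blockCrossInv (p + 1) l k * ascAt K ν p l

variable {v : List (Color D)} {k : ℕ}

theorem listOne_mul_blockCross (hp : A.length = p) (hl : u.length = l) (hk : v.length = k) :
    𝟙 (A ++ (u ++ (v ++ B))) * blockCross K ν p l k =
      blockCross K ν p l k * 𝟙 (A ++ (v ++ (u ++ B))) := by
  induction v generalizing A p k with
  | nil => subst hk; simp [blockCross]
  | cons d v ih =>
    subst hk
    have h1 := ih (A := A ++ [d]) (p := p + 1) (by simp [hp]) rfl
    simp only [List.append_assoc, List.singleton_append] at h1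
    rw [List.length_cons, blockCross, List.cons_append, ← mul_assoc,
      listOne_mul_descAt hp hl, mul_assoc, h1, mul_assoc, List.cons_append]

theorem listOne_mul_blockCrossInv (hp : A.length = p) (hl : u.length = l) (hk : v.length = k) :
    𝟙 (A ++ (v ++ (u ++ B))) * blockCrossInv K ν p l k =
      blockCrossInv K ν p l k * 𝟙 (A ++ (u ++ (v ++ B))) := by
  induction v generalizing A p k with
  | nil => subst hk; simp [blockCrossInv]
  | cons d v ih =>
    subst hk
    have h1 := ih (A := A ++ [d]) (p := p + 1) (by simp [hp]) rfl
    simp only [List.append_assoc, List.singleton_append] at h1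
    rw [List.length_cons, blockCrossInv, List.cons_append, ← mul_assoc, h1, mul_assoc,
      listOne_mul_ascAt hp hl, mul_assoc, List.cons_append]

theorem listOne_mul_blockCross_mul_blockCrossInv (hp : A.length = p) (hl : u.length = l)
    (hk : v.length = k) (h : ∀ d ∈ u, ∀ e ∈ v, D.a d.idx e.idx = 0) :
    𝟙 (A ++ (u ++ (v ++ B))) * (blockCross K ν p l k * blockCrossInv K ν p l k) =
      𝟙 (A ++ (u ++ (v ++ B))) := by
  induction v generalizing A p k with
  | nil => subst hk; simp [blockCross, blockCrossInv]
  | cons d v ih =>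
    subst hk
    have h1 := ih (A := A ++ [d]) (p := p + 1) (by simp [hp]) rfl
      (fun x hx y hy => h x hx y (by simp [hy]))
    simp only [List.append_assoc, List.singleton_append, ← mul_assoc] at h1
    have h2 := listOne_mul_descAt (K := K) (ν := ν) (B := v ++ B) (b := d) hp hl
    rw [List.length_cons, blockCross, blockCrossInv, List.cons_append, ← mul_assoc, ← mul_assoc,
      ← mul_assoc, h2, mul_assoc (δ p l), mul_assoc (δ p l), h1, ← h2,
      listOne_mul_descAt_mul_ascAt hp hl fun x hx => h x hx d (by simp)]

theorem listOne_mul_blockCrossInv_mul_blockCross (hp : A.length = p) (hl : u.length = l)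
    (hk : v.length = k) (h : ∀ d ∈ u, ∀ e ∈ v, D.a e.idx d.idx = 0) :
    𝟙 (A ++ (v ++ (u ++ B))) * (blockCrossInv K ν p l k * blockCross K ν p l k) =
      𝟙 (A ++ (v ++ (u ++ B))) := by
  induction v generalizing A p k with
  | nil => subst hk; simp [blockCross, blockCrossInv]
  | cons d v ih =>
    subst hk
    have h1 := ih (A := A ++ [d]) (p := p + 1) (by simp [hp]) rfl
      (fun x hx y hy => h x hx y (by simp [hy]))
    have h3 := listOne_mul_blockCrossInv (K := K) (ν := ν) (A := A ++ [d]) (B := B) (u := u)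
      (v := v) (p := p + 1) (by simp [hp]) hl rfl
    have h2 := listOne_mul_ascAt_mul_descAt (K := K) (ν := ν) (B := v ++ B) (b := d) hp hl
      fun x hx => h x hx d (by simp)
    simp only [List.append_assoc, List.singleton_append] at h1 h3
    rw [List.length_cons, blockCross, blockCrossInv, List.cons_append, mul_assoc]
    refine (mul_mul_congr h3 (y := blockCross K ν (p + 1) l v.length) ?_).trans h1
    rw [← mul_assoc, ← mul_assoc, h2]

theorem crossAt_comm_blockCross {j : ℕ} (hj : j + 1 < p) :
    Commute (τ j) (blockCross K ν p l k) := by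
  induction k generalizing p with
  | zero => exact Commute.one_right _
  | succ k ih =>
    exact (crossAt_comm_descAt (Or.inl hj)).mul_right (ih (by omega))

/-- A crossing in the right hand block slides through the crossing of two blocks. -/
theorem listOne_mul_crossAt_mul_blockCross (hp : A.length = p) (hl : u.length = l)
    (hk : v.length = k) (h : ∀ d ∈ u, ∀ e ∈ v, ¬ SameReal d e) {j : ℕ} (hj : j + 1 < k) :
    𝟙 (A ++ (u ++ (v ++ B))) * (τ (p + l + j) * blockCross K ν p l k) =
      𝟙 (A ++ (u ++ (v ++ B))) * (blockCross K ν p l k * τ (p + j)) := by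
  induction j generalizing A p v k with
  | zero =>
    subst hk
    obtain ⟨v₁, d, e, v, rfl, h1⟩ := exists_eq_append_cons_cons hj
    obtain rfl := List.length_eq_zero_iff.1 h1
    have h2 := listOne_mul_crossAt_mul_descAt_descAt (K := K) (ν := ν) (B := v ++ B) (b := d)
      (b' := e) hp hl fun x hx => h x hx e (by simp)
    simp only [List.nil_append, List.length_cons, List.cons_append, blockCross, add_zero]
    rw [← mul_assoc (δ p l), ← mul_assoc, ← mul_assoc, h2, mul_assoc _ (τ p),
      (crossAt_comm_blockCross (by omega)).eq]
    simp only [mul_assoc]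
  | succ j ih =>
    subst hk
    obtain ⟨d, v, rfl⟩ := List.exists_cons_of_length_pos (l := v) (by omega)
    rw [List.length_cons] at hj
    have h1 := ih (A := A ++ [d]) (p := p + 1) (v := v) (by simp [hp]) rfl
      (fun x hx y hy => h x hx y (by simp [hy])) (by omega)
    have h2 := listOne_mul_descAt (K := K) (ν := ν) (B := v ++ B) (b := d) hp hl
    simp only [List.append_assoc, List.singleton_append] at h1
    rw [List.length_cons, List.cons_append, blockCross, ← mul_assoc (τ _),
      (crossAt_comm_descAt (by omega)).eq, mul_assoc, mul_assoc,
      show p + l + (j + 1) = p + 1 + l + j by omega, show p + (j + 1) = p + 1 + j by omega]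
    exact mul_mul_congr h2 h1

theorem listOne_mul_wordSpan_mul_blockCross_right (hF : F ∈ wordSpan K ν k) (hp : A.length = p)
    (hl : u.length = l) (hk : v.length = k) (h : ∀ d ∈ u, ∀ e ∈ v, ¬ SameReal d e) :
    𝟙 (A ++ (u ++ (v ++ B))) * (F (p + l) * blockCross K ν p l k) =
      𝟙 (A ++ (u ++ (v ++ B))) * (blockCross K ν p l k * F p) := by
  induction hF using Submodule.span_induction with
  | zero => simp
  | add f g _ _ hf hg => simp only [Pi.add_apply, add_mul, mul_add, hf, hg]
  | smul c f _ hf => simp only [Pi.smul_apply, smul_mul_assoc, mul_smul_comm, hf]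
  | mem f hf =>
    obtain ⟨w, hw, rfl⟩ := hf
    dsimp only
    induction w generalizing v with
    | nil => simp
    | cons j w ih =>
      have hj := hw j (by simp)
      subst hk
      obtain ⟨v₁, d, e, v₂, hv, h1⟩ := exists_eq_append_cons_cons hj
      have hperm : (v₁ ++ e :: d :: v₂).length = v.length := by rw [hv]; simp
      have h2 := listOne_mul_crossAt K (ν := ν) (A := A ++ (u ++ v₁)) (a := d) (b := e)
        (B := v₂ ++ B) (p := p + l + j) (by simp [hp, h1, hl]; omega)
      have h3 := ih hperm (fun x hx y hy => h x hx y (by rw [hv]; simp at hy ⊢; tauto))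
        (fun x hx => hw x (by simp [hx]))
      have h4 := listOne_mul_crossAt_mul_blockCross (K := K) (ν := ν) (B := B) hp hl rfl h hj
      simp only [List.append_assoc, List.cons_append] at h2 h3
      have hu' : A ++ (u ++ (v ++ B)) = A ++ (u ++ (v₁ ++ d :: e :: (v₂ ++ B))) := by simp [hv]
      rw [List.map_cons, List.prod_cons, List.map_cons, List.prod_cons, mul_assoc, hu',
        mul_mul_congr h2 h3, ← hu', ← mul_assoc, ← mul_assoc, mul_assoc _ (τ _), h4]
      simp only [mul_assoc]

theorem listOne_mul_wordSpan_mul_blockCross_left (hF : F ∈ wordSpan K ν l) (hp : A.length = p)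
    (hl : u.length = l) (hk : v.length = k) (h : ∀ d ∈ u, ∀ e ∈ v, ¬ SameReal d e) :
    𝟙 (A ++ (u ++ (v ++ B))) * (F p * blockCross K ν p l k) =
      𝟙 (A ++ (u ++ (v ++ B))) * (blockCross K ν p l k * F (p + k)) := by
  induction v generalizing A p k with
  | nil => subst hk; simp [blockCross]
  | cons d v ih =>
    subst hk
    have h1 := ih (A := A ++ [d]) (p := p + 1) (by simp [hp]) rfl
      (fun x hx y hy => h x hx y (by simp [hy]))
    have h2 := listOne_mul_descAt (K := K) (ν := ν) (B := v ++ B) (b := d) hp hl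
    have h3 := listOne_mul_wordSpan_mul_descAt (K := K) (ν := ν) (B := v ++ B) (b := d) hF hp hl
      fun x hx => h x hx d (by simp)
    simp only [List.append_assoc, List.singleton_append] at h1
    rw [List.length_cons, List.cons_append, blockCross, ← mul_assoc (F p), ← mul_assoc, h3,
      mul_assoc, mul_assoc, mul_assoc (δ p l), show p + (v.length + 1) = p + 1 + v.length by omega]
    exact mul_mul_congr h2 h1

end Blocks

/-! ### The nilHecke relations on strands of one real colour -/

section NilHecke

variable {I : Type*} {K : Type*} [Field K] {D : Datum I} {ν : Multiset (Color D)}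

local notation "𝟙" => listOne K ν
local notation "τ" => crossAt K ν
local notation "ξ" => dotAt K ν
local notation "δ" => descAt K ν
local notation "α" => ascAt K ν

/-- `neg_mul` for the ring structure of `KLR K ν`, in a form that can be used for rewriting. -/
theorem KLR.neg_mul (a b : KLR K ν) : -a * b = -(a * b) := _root_.neg_mul a b

/-- On `e`, the dots and crossings of the `m` strands from position `p` on satisfy the relations of
the nilHecke algebra. -/
structure IsNilHecke (e : KLR K ν) (p m : ℕ) : Prop where
  idem : e * e = e
  comm_dot : ∀ k, Commute e (ξ k)
  comm_cross : ∀ k, p ≤ k → k + 1 < p + m → Commute e (τ k)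
  sq : ∀ k, p ≤ k → k + 1 < p + m → e * τ k * τ k = 0
  braid : ∀ k, p ≤ k → k + 2 < p + m →
    e * τ k * τ (k + 1) * τ k = e * τ (k + 1) * τ k * τ (k + 1)
  slide_left : ∀ k, p ≤ k → k + 1 < p + m → e * ξ k * τ k = e * τ k * ξ (k + 1) + e
  slide_right : ∀ k, p ≤ k → k + 1 < p + m → e * ξ (k + 1) * τ k = e * τ k * ξ k - e

theorem isNilHecke_listOne {A B : List (Color D)} {c : Color D} {p m : ℕ} (hp : A.length = p)
    (hc : D.IsReal c.idx) : IsNilHecke (𝟙 (A ++ (List.replicate m c ++ B))) p m := by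
  have two : ∀ k, p ≤ k → k + 1 < p + m → ∃ A' B', A'.length = k ∧
      A ++ (List.replicate m c ++ B) = A' ++ c :: c :: B' := by
    intro k hk hk'
    obtain ⟨t, rfl⟩ := Nat.exists_eq_add_of_le hk
    obtain ⟨n, rfl⟩ : ∃ n, m = t + (n + 2) := ⟨m - t - 2, by omega⟩
    exact ⟨A ++ List.replicate t c, List.replicate n c ++ B, by simp [hp],
      by rw [List.replicate_add]; simp [List.replicate_succ]⟩
  have hcc : SameReal c c := ⟨rfl, hc⟩
  refine ⟨listOne_mul_self K _, listOne_comm_dotAt K _, fun k hk hk' =>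
    listOne_comm_crossAt_replicate hp hk hk', ?_, ?_, ?_, ?_⟩
  · intro k hk hk'
    obtain ⟨A', B', h1, h2⟩ := two k hk hk'
    rw [h2, listOne_mul_crossAt_sq_real K h1 hcc]
  · intro k hk hk'
    obtain ⟨t, rfl⟩ := Nat.exists_eq_add_of_le hk
    obtain ⟨n, rfl⟩ : ∃ n, m = t + (n + 3) := ⟨m - t - 3, by omega⟩
    have h2 : A ++ (List.replicate (t + (n + 3)) c ++ B) =
        (A ++ List.replicate t c) ++ c :: c :: c :: (List.replicate n c ++ B) := by
      rw [List.replicate_add]; simp [List.replicate_succ]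
    rw [h2, listOne_mul_braid K (by simp [hp]) (fun h => h.2.1 rfl)]
  · intro k hk hk'
    obtain ⟨A', B', h1, h2⟩ := two k hk hk'
    rw [h2, listOne_mul_dot_cross_left_real K h1 hcc]
  · intro k hk hk'
    obtain ⟨A', B', h1, h2⟩ := two k hk hk'
    rw [h2, listOne_mul_dot_cross_right_real K h1 hcc]

variable {e : KLR K ν} {p m : ℕ}

theorem IsNilHecke.mono (H : IsNilHecke e p m) {p' m' : ℕ} (h : p ≤ p')
    (h' : p' + m' ≤ p + m) : IsNilHecke e p' m' :=
  ⟨H.idem, H.comm_dot, fun k hk hk' => H.comm_cross k (by omega) (by omega),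
    fun k hk hk' => H.sq k (by omega) (by omega), fun k hk hk' => H.braid k (by omega) (by omega),
    fun k hk hk' => H.slide_left k (by omega) (by omega),
    fun k hk hk' => H.slide_right k (by omega) (by omega)⟩

theorem IsNilHecke.comm_desc (H : IsNilHecke e p m) {l : ℕ} (hl : l + 1 ≤ m) :
    Commute e (δ p l) :=
  commute_descAt fun k h1 h2 => H.comm_cross k (by omega) (by omega)

theorem IsNilHecke.comm_asc (H : IsNilHecke e p m) {l : ℕ} (hl : l + 1 ≤ m) :
    Commute e (α p l) :=
  commute_ascAt fun k h1 h2 => H.comm_cross k (by omega) (by omega)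

theorem IsNilHecke.cross_mul_desc (H : IsNilHecke e p m) {l k : ℕ} (hl : l + 1 ≤ m)
    (hk : k + 1 < l) : e * (τ (p + k) * δ p l) = e * (δ p l * τ (p + k + 1)) := by
  obtain ⟨s, rfl⟩ : ∃ s, l = k + (1 + (1 + s)) := ⟨l - k - 2, by omega⟩
  have h4 : δ p (k + (1 + (1 + s))) =
      δ (p + k + 1 + 1) s * (τ (p + k + 1) * (τ (p + k) * δ p k)) := by
    rw [descAt_add, descAt_add, descAt_add, descAt_succ, descAt_succ]
    simp [mul_assoc]
  have h5 : τ (p + k) * δ p (k + (1 + (1 + s))) =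
      δ (p + k + 1 + 1) s * (τ (p + k) * τ (p + k + 1) * τ (p + k) * δ p k) := by
    rw [h4, ← mul_assoc, (crossAt_comm_descAt (by omega)).eq]
    simp only [mul_assoc]
  have h6 : δ p (k + (1 + (1 + s))) * τ (p + k + 1) =
      δ (p + k + 1 + 1) s * (τ (p + k + 1) * τ (p + k) * τ (p + k + 1) * δ p k) := by
    rw [h4]
    simp only [mul_assoc]
    rw [(crossAt_comm_descAt (K := K) (ν := ν) (k := p + k + 1) (p := p) (l := k) (by omega)).eq]
  rw [h5, h6]
  refine mul_mul_congr ((H.mono (p' := p + k + 1 + 1) (m' := s + 1) (by omega)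
    (by omega)).comm_desc le_rfl).eq ?_
  simp only [← mul_assoc, H.braid (p + k) (by omega) (by omega)]

theorem IsNilHecke.cross_mul_asc (H : IsNilHecke e p m) {l k : ℕ} (hl : l + 1 ≤ m)
    (hk : k + 1 < l) : e * (τ (p + k + 1) * α p l) = e * (α p l * τ (p + k)) := by
  obtain ⟨s, rfl⟩ : ∃ s, l = k + (1 + (1 + s)) := ⟨l - k - 2, by omega⟩
  have h4 : α p (k + (1 + (1 + s))) =
      α p k * (τ (p + k) * (τ (p + k + 1) * α (p + k + 1 + 1) s)) := by
    rw [ascAt_add, ascAt_add, ascAt_add, ascAt_succ, ascAt_succ]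
    simp
  have h5 : τ (p + k + 1) * α p (k + (1 + (1 + s))) =
      α p k * (τ (p + k + 1) * τ (p + k) * τ (p + k + 1) * α (p + k + 1 + 1) s) := by
    rw [h4, ← mul_assoc, (crossAt_comm_ascAt (by omega)).eq]
    simp only [mul_assoc]
  have h6 : α p (k + (1 + (1 + s))) * τ (p + k) =
      α p k * (τ (p + k) * τ (p + k + 1) * τ (p + k) * α (p + k + 1 + 1) s) := by
    rw [h4]
    simp only [mul_assoc]
    rw [(crossAt_comm_ascAt (K := K) (ν := ν) (k := p + k) (p := p + k + 1 + 1) (by omega)).eq]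
  rw [h5, h6]
  refine mul_mul_congr (H.comm_asc (by omega)).eq ?_
  simp only [← mul_assoc, H.braid (p + k) (by omega) (by omega)]

theorem IsNilHecke.comm_wordSpan (H : IsNilHecke e p m) {F : ℕ → KLR K ν} {l p' : ℕ}
    (hF : F ∈ wordSpan K ν l) (hp : p ≤ p') (hl : p' + l ≤ p + m) : Commute e (F p') :=
  commute_of_mem_wordSpan hF fun k h1 h2 => H.comm_cross k (by omega) (by omega)

theorem IsNilHecke.wordSpan_mul_desc (H : IsNilHecke e p m) {l : ℕ} (hl : l + 1 ≤ m)
    {F : ℕ → KLR K ν} (hF : F ∈ wordSpan K ν l) :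
    e * (F p * δ p l) = e * (δ p l * F (p + 1)) := by
  induction hF using Submodule.span_induction with
  | zero => simp
  | add f g _ _ hf hg => simp only [Pi.add_apply, add_mul, mul_add, hf, hg]
  | smul c f _ hf => simp only [Pi.smul_apply, smul_mul_assoc, mul_smul_comm, hf]
  | mem f hf =>
    obtain ⟨w, hw, rfl⟩ := hf
    dsimp only
    induction w with
    | nil => simp
    | cons k w ih =>
      have hk := hw k (by simp)
      have h3 := ih (fun x hx => hw x (by simp [hx]))
      rw [List.map_cons, List.prod_cons, List.map_cons, List.prod_cons, mul_assoc,
        mul_mul_congr (H.comm_cross (p + k) (by omega) (by omega)).eq h3, ← mul_assoc (τ _),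
        ← mul_assoc, H.cross_mul_desc hl hk, add_right_comm]
      simp only [mul_assoc]

theorem IsNilHecke.wordSpan_mul_asc (H : IsNilHecke e p m) {l : ℕ} (hl : l + 1 ≤ m)
    {F : ℕ → KLR K ν} (hF : F ∈ wordSpan K ν l) :
    e * (F (p + 1) * α p l) = e * (α p l * F p) := by
  induction hF using Submodule.span_induction with
  | zero => simp
  | add f g _ _ hf hg => simp only [Pi.add_apply, add_mul, mul_add, hf, hg]
  | smul c f _ hf => simp only [Pi.smul_apply, smul_mul_assoc, mul_smul_comm, hf]
  | mem f hf =>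
    obtain ⟨w, hw, rfl⟩ := hf
    dsimp only
    induction w with
    | nil => simp
    | cons k w ih =>
      have hk := hw k (by simp)
      have h3 := ih (fun x hx => hw x (by simp [hx]))
      rw [List.map_cons, List.prod_cons, List.map_cons, List.prod_cons, mul_assoc,
        mul_mul_congr (H.comm_cross (p + 1 + k) (by omega) (by omega)).eq h3, ← mul_assoc (τ _),
        ← mul_assoc, add_right_comm, H.cross_mul_asc hl hk]
      simp only [mul_assoc]

variable (K ν) in
/-- `τ_{w₀}` for the longest element `w₀` of `S_m`, on the `m` strands from position `p` on, with the
reduced expression `w₀ = w₀' s_{m-1} ⋯ s_1`, where `w₀'` is the longest element of `S_{m-1}`. -/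
noncomputable def longestAt (p : ℕ) : ℕ → KLR K ν
  | 0 => 1
  | m + 1 => longestAt p m * descAt K ν p m

local notation "ω₀" => longestAt K ν

theorem strip_revPerm (n : ℕ) : strip (Fin.revPerm : Equiv.Perm (Fin (n + 1))) = Fin.revPerm := by
  ext k
  have h := congrArg Fin.val (strip_apply (Fin.revPerm : Equiv.Perm (Fin (n + 1))) k)
  simp only [Fin.val_castSucc] at h
  rw [h]
  simp

theorem tauAt_revPerm (p m : ℕ) : tauAt K ν p m Fin.revPerm = ω₀ p m := by
  induction m with
  | zero => rfl
  | succ m ih =>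
    rw [longestAt, ← ih, tauAt, tauAt, redWord, strip_revPerm, List.map_append, List.prod_append]
    congr 1
    rw [descAt]
    simp [List.range'_eq_map_range, Function.comp_def]

theorem longestAt_mem_wordSpan (m : ℕ) : (fun p => ω₀ p m) ∈ wordSpan K ν m := by
  simp only [← tauAt_revPerm]
  exact tauAt_mem_wordSpan _

theorem IsNilHecke.longest_succ_desc (H : IsNilHecke e p m) {l : ℕ} (hl : l + 1 ≤ m) :
    e * ω₀ p (l + 1) = e * (δ p l * ω₀ (p + 1) l) :=
  H.wordSpan_mul_desc hl (longestAt_mem_wordSpan l)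

theorem longestAt_succ_asc (p l : ℕ) : ω₀ p (l + 1) = α p l * ω₀ p l := by
  induction l with
  | zero => simp [longestAt]
  | succ l ih =>
    have h := commute_of_mem_wordSpan (longestAt_mem_wordSpan (K := K) (ν := ν) l) (p := p)
      (z := τ (p + l)) fun k h1 h2 => crossAt_comm K (by omega)
    rw [longestAt, ih, descAt_succ, ascAt_succ, ← mul_assoc, mul_assoc (α p l), ← h.eq,
      mul_assoc, mul_assoc, mul_assoc, ← ih, longestAt]

theorem IsNilHecke.longest_succ_asc' (H : IsNilHecke e p m) {l : ℕ} (hl : l + 1 ≤ m) :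
    e * ω₀ p (l + 1) = e * (ω₀ (p + 1) l * α p l) := by
  rw [longestAt_succ_asc, H.wordSpan_mul_asc hl (longestAt_mem_wordSpan l)]

/-- Crossings are absorbed by the longest element, as double crossings of one real colour vanish. -/
theorem IsNilHecke.longest_mul_cross (H : IsNilHecke e p m) {k : ℕ} (hk : p ≤ k)
    (hk' : k + 1 < p + m) : e * ω₀ p m * τ k = 0 := by
  induction m with
  | zero => omega
  | succ l ih =>
    by_cases h : k + 1 < p + l
    · rw [longestAt_succ_asc, ← mul_assoc, (H.comm_asc le_rfl).eq, mul_assoc, mul_assoc,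
        ← mul_assoc e, ih (H.mono le_rfl (by omega)) h, mul_zero]
    · obtain ⟨t, rfl⟩ : ∃ t, l = t + 1 := ⟨l - 1, by omega⟩
      obtain rfl : k = p + t := by omega
      rw [H.longest_succ_asc' le_rfl, ascAt_succ, ← mul_assoc, ← mul_assoc,
        (H.comm_wordSpan (longestAt_mem_wordSpan _) (by omega) (by omega)).eq,
        mul_assoc _ e, ((H.mono le_rfl (by omega)).comm_asc le_rfl).eq, mul_assoc, mul_assoc,
        mul_assoc, ← mul_assoc e, H.sq _ (by omega) (by omega), mul_zero, mul_zero]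

/-- The version of `mul_mul_congr` for an element `z` that absorbs `e`. -/
theorem mul_mul_congr_of_absorb {R : Type*} [Semigroup R] {z e d x y : R} (hz : z * e = z)
    (h : Commute e d) (h' : e * x = e * y) : z * d * x = z * d * y := by
  rw [← hz, mul_assoc z, mul_assoc z, mul_assoc z, mul_assoc e, mul_assoc e, mul_mul_congr h.eq h']

theorem mul_congr_of_absorb {R : Type*} [Semigroup R] {z e x y : R} (hz : z * e = z)
    (h' : e * x = e * y) : z * x = z * y := by
  rw [← hz, mul_assoc z, mul_assoc z, h']

/-- On an element annihilated by a crossing, this crossing acts as a divided difference. -/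
theorem IsNilHecke.mul_dot_pow_mul_cross_left (H : IsNilHecke e p m) {z : KLR K ν} {k : ℕ}
    (hz : z * e = z) (hk : p ≤ k) (hk' : k + 1 < p + m) (h : z * τ k = 0) (c : ℕ) :
    z * ξ k ^ c * τ k = ∑ i ∈ Finset.range c, z * ξ k ^ i * ξ (k + 1) ^ (c - 1 - i) := by
  induction c with
  | zero => simp [h]
  | succ c ih =>
    have h1 : z * ξ k ^ c * (ξ k * τ k) = z * ξ k ^ c * (τ k * ξ (k + 1) + 1) := by
      refine mul_mul_congr_of_absorb hz ((H.comm_dot k).pow_right c) ?_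
      rw [← mul_assoc, H.slide_left k hk hk', mul_add, mul_one, mul_assoc]
    rw [pow_succ, ← mul_assoc, mul_assoc _ _ (τ k), h1, mul_add, ← mul_assoc, ih, mul_one,
      Finset.sum_range_succ, Finset.sum_mul]
    congr 1
    · refine Finset.sum_congr rfl fun i hi => ?_
      rw [Finset.mem_range] at hi
      rw [mul_assoc, ← pow_succ]
      congr 2
      omega
    · simp

theorem IsNilHecke.mul_dot_pow_mul_cross_right (H : IsNilHecke e p m) {z : KLR K ν} {k : ℕ}
    (hz : z * e = z) (hk : p ≤ k) (hk' : k + 1 < p + m) (h : z * τ k = 0) (c : ℕ) :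
    z * ξ (k + 1) ^ c * τ k =
      -∑ i ∈ Finset.range c, z * ξ (k + 1) ^ i * ξ k ^ (c - 1 - i) := by
  induction c with
  | zero => simp [h]
  | succ c ih =>
    have h1 : z * ξ (k + 1) ^ c * (ξ (k + 1) * τ k) = z * ξ (k + 1) ^ c * (τ k * ξ k - 1) := by
      refine mul_mul_congr_of_absorb hz ((H.comm_dot (k + 1)).pow_right c) ?_
      rw [← mul_assoc, H.slide_right k hk hk', mul_sub, mul_one, mul_assoc]
    rw [pow_succ, ← mul_assoc, mul_assoc _ _ (τ k), h1, mul_sub, ← mul_assoc, ih, mul_one,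
      Finset.sum_range_succ, neg_add, KLR.neg_mul, Finset.sum_mul, sub_eq_add_neg]
    congr 2
    · refine Finset.sum_congr rfl fun i hi => ?_
      rw [Finset.mem_range] at hi
      rw [mul_assoc, ← pow_succ]
      congr 2
      omega
    · simp

/-- The iterated divided difference of a power of the first dot vanishes below degree `n`, and is `1`
in degree `n`. -/
theorem IsNilHecke.mul_dot_pow_mul_asc {n : ℕ} (H : IsNilHecke e p (n + 1)) {z : KLR K ν}
    (hz : z * e = z) (h : ∀ k, p ≤ k → k < p + n → z * τ k = 0) {c : ℕ} (hc : c ≤ n) :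
    z * ξ p ^ c * α p n = if c = n then z else 0 := by
  induction n generalizing p z c with
  | zero =>
    obtain rfl : c = 0 := by omega
    simp
  | succ n ih =>
    rw [ascAt_succ', ← mul_assoc, H.mul_dot_pow_mul_cross_left hz le_rfl (by omega)
      (h p le_rfl (by omega)), Finset.sum_mul]
    have key : ∀ i ∈ Finset.range c, z * ξ p ^ i * ξ (p + 1) ^ (c - 1 - i) * α (p + 1) n =
        if c - 1 - i = n then z * ξ p ^ i else 0 := by
      intro i hi
      rw [Finset.mem_range] at hi
      refine ih (H.mono (by omega) (by omega)) ?_ ?_ (by omega)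
      · rw [mul_assoc, ← ((H.comm_dot p).pow_right i).eq, ← mul_assoc, hz]
      · intro k h1 h2
        rw [mul_assoc, ((dotAt_comm_crossAt K (l := p) (k := k) (by omega)
          (by omega)).pow_left i).eq, ← mul_assoc, h k (by omega) (by omega), zero_mul]
    rw [Finset.sum_congr rfl key]
    split_ifs with hcn
    · subst hcn
      rw [Finset.sum_eq_single 0]
      · simp
      · intro i hi hi0
        rw [Finset.mem_range] at hi
        rw [if_neg (by omega)]
      · simp
    · refine Finset.sum_eq_zero fun i hi => ?_
      rw [Finset.mem_range] at hi
      rw [if_neg (by omega)]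

/-- The iterated divided difference of a power of the last dot vanishes below degree `n`, and is a
sign in degree `n`. -/
theorem IsNilHecke.mul_dot_pow_mul_desc {n : ℕ} (H : IsNilHecke e p (n + 1)) {z : KLR K ν}
    (hz : z * e = z) (h : ∀ k, p ≤ k → k < p + n → z * τ k = 0) {c : ℕ} (hc : c ≤ n) :
    z * ξ (p + n) ^ c * δ p n = if c = n then (-1 : K) ^ n • z else 0 := by
  induction n generalizing z c with
  | zero =>
    obtain rfl : c = 0 := by omega
    simp
  | succ n ih =>
    rw [descAt_succ, ← mul_assoc, ← add_assoc,
      H.mul_dot_pow_mul_cross_right hz (by omega) (by omega) (h (p + n) (by omega) (by omega)),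
      KLR.neg_mul, Finset.sum_mul]
    have key : ∀ i ∈ Finset.range c,
        z * ξ (p + n + 1) ^ i * ξ (p + n) ^ (c - 1 - i) * δ p n =
          if c - 1 - i = n then (-1 : K) ^ n • (z * ξ (p + n + 1) ^ i) else 0 := by
      intro i hi
      rw [Finset.mem_range] at hi
      refine ih (H.mono (by omega) (by omega)) ?_ ?_ (by omega)
      · rw [mul_assoc, ← ((H.comm_dot _).pow_right i).eq, ← mul_assoc, hz]
      · intro k h1 h2
        rw [mul_assoc, ((dotAt_comm_crossAt K (l := p + n + 1) (k := k) (by omega)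
          (by omega)).pow_left i).eq, ← mul_assoc, h k (by omega) (by omega), zero_mul]
    rw [Finset.sum_congr rfl key]
    split_ifs with hcn
    · subst hcn
      rw [Finset.sum_eq_single 0]
      · rw [if_pos (by omega), pow_zero, mul_one, pow_succ, mul_neg_one]
        exact (neg_smul ((-1 : K) ^ n) z).symm
      · intro i hi hi0
        rw [Finset.mem_range] at hi
        rw [if_neg (by omega)]
      · simp
    · rw [Finset.sum_eq_zero, neg_zero]
      intro i hi
      rw [Finset.mem_range] at hi
      rw [if_neg (by omega)]

variable (K ν) in
/-- `x_1^{m-1} x_2^{m-2} ⋯ x_{m-1}`, on the `m` strands from position `p` on. -/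
noncomputable def staircaseAt (p m : ℕ) : KLR K ν :=
  ((List.range m).map fun t => ξ (p + t) ^ (m - 1 - t)).prod

theorem staircaseAt_succ (p m : ℕ) :
    staircaseAt K ν p (m + 1) = ξ p ^ m * staircaseAt K ν (p + 1) m := by
  have h : ∀ t ∈ List.range m, ((fun t => ξ (p + t) ^ (m + 1 - 1 - t)) ∘ Nat.succ) t =
      ξ (p + 1 + t) ^ (m - 1 - t) := by
    intro t _
    rw [Function.comp_apply, show p + t.succ = p + 1 + t by omega,
      show m + 1 - 1 - t.succ = m - 1 - t by omega]
  rw [staircaseAt, staircaseAt, List.range_succ_eq_map, List.map_cons, List.prod_cons,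
    List.map_map, List.map_congr_left h]
  rfl

theorem commute_staircaseAt {z : KLR K ν}
    (h : ∀ k, p ≤ k → k < p + m → Commute z (ξ k)) : Commute z (staircaseAt K ν p m) := by
  refine Commute.list_prod_right _ _ fun y hy => ?_
  obtain ⟨k, hk, rfl⟩ := List.mem_map.1 hy
  rw [List.mem_range] at hk
  exact (h _ (by omega) (by omega)).pow_right _

theorem nilHeckeAt_eq (p m : ℕ) : nilHeckeAt K ν p m = staircaseAt K ν p m * ω₀ p m := by
  rw [nilHeckeAt, tauAt_revPerm]; rfl

/-- The longest element, as a divided difference, takes the staircase monomial to `1`. -/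
theorem IsNilHecke.mul_staircase_mul_longest (H : IsNilHecke e p m) {z : KLR K ν}
    (hz : z * e = z) (h : ∀ k, p ≤ k → k + 1 < p + m → z * τ k = 0) :
    z * (staircaseAt K ν p m * ω₀ p m) = z := by
  induction m generalizing p z with
  | zero => simp [staircaseAt, longestAt]
  | succ m ih =>
    have h1 := ih (p := p + 1) (z := z * ξ p ^ m) (H.mono (by omega) (by omega))
      (by rw [mul_assoc, ← ((H.comm_dot _).pow_right m).eq, ← mul_assoc, hz]) (by
        intro k h1 h2
        rw [mul_assoc, ((dotAt_comm_crossAt K (l := p) (k := k) (by omega)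
          (by omega)).pow_left m).eq, ← mul_assoc, h k (by omega) (by omega), zero_mul])
    have h2 := H.mul_dot_pow_mul_asc hz (fun k h1 h2 => h k h1 (by omega)) (c := m) le_rfl
    rw [if_pos rfl] at h2
    conv_rhs => rw [← h2, ← h1]
    rw [← mul_assoc, mul_mul_congr_of_absorb hz (commute_staircaseAt fun k _ _ => H.comm_dot k)
      (H.longest_succ_asc' le_rfl), staircaseAt_succ]
    simp only [mul_assoc]

/-! ### The flip -/

theorem psi_add (a b : KLR K ν) : psi K (a + b) = psi K a + psi K b := by simp [psi]

theorem psi_zero : psi K (0 : KLR K ν) = 0 := by simp [psi]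

theorem psi_smul (c : K) (a : KLR K ν) : psi K (c • a) = c • psi K a := by simp [psi]

theorem psi_sum {ι : Type*} (s : Finset ι) (f : ι → KLR K ν) :
    psi K (∑ i ∈ s, f i) = ∑ i ∈ s, psi K (f i) := by simp [psi]

theorem psi_pow (a : KLR K ν) (n : ℕ) : psi K (a ^ n) = psi K a ^ n := by simp [psi]

theorem psi_list_prod (l : List (KLR K ν)) :
    psi K l.prod = (l.map (psi K)).reverse.prod := by
  induction l with
  | nil => simp [psi_one]
  | cons a l ih => simp [psi_mul, ih]

theorem psi_crossAt (k : ℕ) : psi K (τ k) = τ k := by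
  by_cases hk : k + 1 < Multiset.card ν
  · rw [crossAt, dif_pos hk, psi_sum]
    refine Finset.sum_bij' (fun s _ => s.swap k hk) (fun s _ => s.swap k hk) (by simp) (by simp)
      (fun s _ => Seq.swap_swap s k hk) (fun s _ => Seq.swap_swap s k hk) ?_
    intro s _
    rw [psi_gen]; rfl
  · rw [crossAt, dif_neg hk, psi_zero]

theorem psi_dotAt (k : ℕ) : psi K (ξ k) = ξ k := by
  by_cases hk : k < Multiset.card ν
  · rw [dotAt, dif_pos hk, psi_sum]
    exact Finset.sum_congr rfl fun s _ => psi_gen K _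
  · rw [dotAt, dif_neg hk, psi_zero]

theorem psi_descAt (p l : ℕ) : psi K (δ p l) = α p l := by
  induction l with
  | zero => simp [psi_one]
  | succ l ih => rw [descAt_succ, psi_mul, ih, psi_crossAt, ascAt_succ]

theorem psi_staircaseAt (p m : ℕ) : psi K (staircaseAt K ν p m) = staircaseAt K ν p m := by
  induction m generalizing p with
  | zero => simp [staircaseAt, psi_one]
  | succ m ih =>
    rw [staircaseAt_succ, psi_mul, ih, psi_pow, psi_dotAt]
    exact (commute_staircaseAt fun k _ _ => (dotAt_comm K p k).pow_left m).eq.symm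

theorem psi_mem_wordSpan {F : ℕ → KLR K ν} {q : ℕ} (hF : F ∈ wordSpan K ν q) :
    (fun p => psi K (F p)) ∈ wordSpan K ν q := by
  induction hF using Submodule.span_induction with
  | mem f hf =>
    obtain ⟨w, hw, rfl⟩ := hf
    refine Submodule.subset_span ⟨w.reverse, by simpa using hw, ?_⟩
    ext p
    rw [psi_list_prod, List.map_map, List.map_reverse]
    congr 3
    ext k
    exact psi_crossAt _
  | zero => simp only [Pi.zero_apply, psi_zero]; exact Submodule.zero_mem _
  | add f g _ _ hf hg => simp only [Pi.add_apply, psi_add]; exact Submodule.add_mem _ hf hg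
  | smul c f _ hf => simp only [Pi.smul_apply, psi_smul]; exact Submodule.smul_mem _ c hf

/-- The reduced expression of `w₀` in `longestAt` and its reverse give the same element. -/
theorem IsNilHecke.mul_psi_longest (H : IsNilHecke e p m) :
    e * psi K (ω₀ p m) = e * ω₀ p m := by
  induction m with
  | zero => simp [longestAt, psi_one]
  | succ m ih =>
    rw [longestAt, psi_mul, psi_descAt, ← longestAt, longestAt_succ_asc]
    exact mul_mul_congr (H.comm_asc le_rfl).eq (ih (H.mono le_rfl (by omega)))

end NilHecke

/-! ### Polynomials in the dots -/

section Polynomials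

variable {I : Type*} (K : Type*) [Field K] {D : Datum I} (ν : Multiset (Color D))

local notation "𝟙" => listOne K ν
local notation "τ" => crossAt K ν
local notation "ξ" => dotAt K ν
local notation "δ" => descAt K ν
local notation "α" => ascAt K ν

open scoped IsMulCommutative in
theorem exists_dotPoly :
    ∃ f : MvPolynomial ℕ K →ₐ[K] KLR K ν, ∀ k, f (MvPolynomial.X k) = ξ k := by
  let S := Algebra.adjoin K (Set.range ξ)
  have : IsMulCommutative S := Algebra.isMulCommutative_adjoin K (by
    rintro _ ⟨k, rfl⟩ _ ⟨l, rfl⟩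
    exact (dotAt_comm K k l).eq)
  refine ⟨S.val.comp (MvPolynomial.aeval fun k : ℕ =>
    (⟨ξ k, Algebra.subset_adjoin ⟨k, rfl⟩⟩ : S)), fun k => ?_⟩
  rw [AlgHom.comp_apply, MvPolynomial.aeval_X]
  rfl

/-- The evaluation of polynomials at the dots. -/
noncomputable def dotPoly : MvPolynomial ℕ K →ₐ[K] KLR K ν := (exists_dotPoly K ν).choose

variable {K ν}

@[simp] theorem dotPoly_X (k : ℕ) : dotPoly K ν (MvPolynomial.X k) = ξ k :=
  (exists_dotPoly K ν).choose_spec k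

theorem listOne_comm_dotPoly (l : List (Color D)) (f : MvPolynomial ℕ K) :
    Commute (𝟙 l) (dotPoly K ν f) := by
  induction f using MvPolynomial.induction_on with
  | C a => rw [← MvPolynomial.algebraMap_eq, AlgHom.commutes]; exact (Algebra.commutes a _).symm
  | add f g hf hg => rw [map_add]; exact hf.add_right hg
  | mul_X f k hf => rw [map_mul, dotPoly_X]; exact hf.mul_right (listOne_comm_dotAt K l k)

variable {A B u : List (Color D)} {a b : Color D} {p q : ℕ}

/-- A crossing of strands that are not of the same real colour permutes the dots. -/
theorem listOne_mul_dotPoly_mul_crossAt (hp : A.length = p) (h : ¬ SameReal a b)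
    (f : MvPolynomial ℕ K) :
    𝟙 (A ++ a :: b :: B) * (dotPoly K ν f * τ p) =
      𝟙 (A ++ a :: b :: B) *
        (τ p * dotPoly K ν (MvPolynomial.rename (Equiv.swap p (p + 1)) f)) := by
  induction f using MvPolynomial.induction_on with
  | C a =>
    rw [MvPolynomial.rename_C, ← MvPolynomial.algebraMap_eq, AlgHom.commutes, Algebra.commutes]
  | add f g hf hg => simp only [map_add, add_mul, mul_add, hf, hg]
  | mul_X f k hf =>
    have hX : 𝟙 (A ++ a :: b :: B) * (ξ k * τ p) =
        𝟙 (A ++ a :: b :: B) * (τ p * ξ (Equiv.swap p (p + 1) k)) := by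
      rcases eq_or_ne k p with rfl | h1
      · rw [Equiv.swap_apply_left, ← mul_assoc, ← mul_assoc, listOne_mul_dot_cross_left K hp h]
      · rcases eq_or_ne k (p + 1) with rfl | h2
        · rw [Equiv.swap_apply_right, ← mul_assoc, ← mul_assoc,
            listOne_mul_dot_cross_right K hp h]
        · rw [Equiv.swap_apply_of_ne_of_ne h1 h2, (dotAt_comm_crossAt K h1 h2).eq]
    rw [map_mul, dotPoly_X, mul_assoc, mul_mul_congr (listOne_comm_dotPoly _ f).eq hX, map_mul,
      MvPolynomial.rename_X, map_mul, dotPoly_X, ← mul_assoc (dotPoly K ν f), ← mul_assoc, hf]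
    simp only [mul_assoc]

/-- A strand moving to the left carries its dot along. -/
theorem exists_listOne_mul_dotPoly_mul_descAt (hp : A.length = p) (hq : u.length = q)
    (h : ∀ d ∈ u, ¬ SameReal d b) :
    ∃ e : Equiv.Perm ℕ, (∀ x, x < p → e x = x) ∧ (∀ x, p + q < x → e x = x) ∧ e (p + q) = p ∧
      ∀ f, 𝟙 (A ++ (u ++ b :: B)) * (dotPoly K ν f * δ p q) =
        𝟙 (A ++ (u ++ b :: B)) * (δ p q * dotPoly K ν (MvPolynomial.rename e f)) := by
  induction u generalizing A p q with
  | nil =>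
    subst hq
    exact ⟨1, by simp, by simp, by simp, by simp⟩
  | cons d u ih =>
    subst hq
    obtain ⟨e, h1, h2, h3, h4⟩ := ih (A := A ++ [d]) (p := p + 1) (by simp [hp]) rfl
      (fun x hx => h x (by simp [hx]))
    have h5 := listOne_mul_descAt (K := K) (ν := ν) (A := A ++ [d]) (u := u) (b := b) (B := B)
      (p := p + 1) (by simp [hp]) rfl
    simp only [List.append_assoc, List.singleton_append] at h4 h5
    rw [List.length_cons]
    refine ⟨Equiv.swap p (p + 1) * e, ?_, ?_, ?_, ?_⟩
    · intro x hx
      rw [Equiv.Perm.mul_apply, h1 x (by omega),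
        Equiv.swap_apply_of_ne_of_ne (by omega) (by omega)]
    · intro x hx
      rw [Equiv.Perm.mul_apply, h2 x (by omega),
        Equiv.swap_apply_of_ne_of_ne (by omega) (by omega)]
    · rw [Equiv.Perm.mul_apply, show p + (u.length + 1) = p + 1 + u.length by omega, h3,
        Equiv.swap_apply_right]
    · intro f
      have h6 := listOne_mul_dotPoly_mul_crossAt (K := K) (ν := ν) (B := u ++ B) hp
        (h d (by simp)) (MvPolynomial.rename e f)
      rw [descAt_succ', List.cons_append, ← mul_assoc (dotPoly K ν f), ← mul_assoc, h4, mul_assoc,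
        mul_assoc, mul_assoc, mul_mul_congr h5 h6, MvPolynomial.rename_rename]
      rfl

variable (K) in
/-- The polynomial `y^m + z^l` to which a double crossing of a strand of colour `c` carrying the
variable `y` and a strand of colour `d` carrying the variable `z` is equal; it is `1` if the colours
are orthogonal. -/
noncomputable def doublePoly (c d : Color D) (y z : ℕ) : MvPolynomial ℕ K :=
  if D.a c.idx d.idx = 0 then 1 else
    MvPolynomial.X y ^ (-((d.mult : ℤ) * c.mult * D.a c.idx d.idx)).toNat +
      MvPolynomial.X z ^ (-((d.mult : ℤ) * c.mult * D.a d.idx c.idx)).toNat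

theorem Datum.a_eq_zero_comm (D : Datum I) (i j : I) : D.a i j = 0 ↔ D.a j i = 0 := by
  have key : ∀ i j, D.a i j = 0 → D.a j i = 0 := by
    intro i j h
    have h2 := D.symm i j
    rw [h, mul_zero] at h2
    exact (mul_eq_zero.1 h2.symm).resolve_left (D.r_pos _).ne'
  exact ⟨key i j, key j i⟩

theorem listOne_mul_crossAt_sq_eq_doublePoly (hp : A.length = p) (hab : a.idx ≠ b.idx) :
    𝟙 (A ++ a :: b :: B) * (τ p * τ p) =
      𝟙 (A ++ a :: b :: B) * dotPoly K ν (doublePoly K a b p (p + 1)) := by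
  rw [doublePoly]
  split_ifs with h
  · rw [← mul_assoc, listOne_mul_crossAt_sq_orthogonal K hp h, map_one, mul_one]
  · rw [← mul_assoc, listOne_mul_crossAt_sq_ne K hp (fun h' => hab (by rw [h'])) h]
    simp only [map_add, map_pow, dotPoly_X]

theorem listOne_mul_crossAt_sq_eq_doublePoly' (hp : A.length = p) (hab : a.idx ≠ b.idx) :
    𝟙 (A ++ a :: b :: B) * (τ p * τ p) =
      𝟙 (A ++ a :: b :: B) * dotPoly K ν (doublePoly K b a (p + 1) p) := by
  rw [listOne_mul_crossAt_sq_eq_doublePoly hp hab, doublePoly, doublePoly]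
  by_cases h : D.a a.idx b.idx = 0
  · rw [if_pos h, if_pos ((D.a_eq_zero_comm _ _).1 h)]
  · rw [if_neg h, if_neg (fun h' => h ((D.a_eq_zero_comm _ _).1 h')), add_comm,
      mul_comm (b.mult : ℤ)]

variable (K) in
/-- The polynomial of the double crossing of a strand of colour `c`, carrying the variable `y`, with
the strands of the colours `u`, which carry the variables `p, p + 1, …`. -/
noncomputable def doubleListPoly (c : Color D) (y : ℕ) : ℕ → List (Color D) → MvPolynomial ℕ K
  | _, [] => 1
  | p, d :: u => doublePoly K c d y p * doubleListPoly c y (p + 1) u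

variable (K) in
/-- `∑ x^i y^{n-1-i}` over `i < n`, the divided difference of `x^n`. -/
noncomputable def geomPoly (x y n : ℕ) : MvPolynomial ℕ K :=
  ∑ i ∈ Finset.range n, MvPolynomial.X x ^ i * MvPolynomial.X y ^ (n - 1 - i)

variable (K) in
/-- The divided difference of `doubleListPoly` in the variables `x` and `y`. -/
noncomputable def braidPoly (c : Color D) (x y : ℕ) : ℕ → List (Color D) → MvPolynomial ℕ K
  | _, [] => 0
  | p, d :: u => geomPoly K x y (-((d.mult : ℤ) * D.a c.idx d.idx)).toNat *
        doubleListPoly K c y (p + 1) u + doublePoly K c d x p * braidPoly c x y (p + 1) u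

theorem rename_doublePoly (e : Equiv.Perm ℕ) (c d : Color D) (y z : ℕ) :
    MvPolynomial.rename e (doublePoly K c d y z) = doublePoly K c d (e y) (e z) := by
  unfold doublePoly
  split_ifs <;> simp

theorem rename_geomPoly (e : Equiv.Perm ℕ) (x y n : ℕ) :
    MvPolynomial.rename e (geomPoly K x y n) = geomPoly K (e x) (e y) n := by
  simp [geomPoly]

theorem rename_doubleListPoly (e : Equiv.Perm ℕ) (c : Color D) (y p : ℕ)
    (u : List (Color D)) (h : ∀ k, p ≤ k → k < p + u.length → e k = k) :
    MvPolynomial.rename e (doubleListPoly K c y p u) = doubleListPoly K c (e y) p u := by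
  induction u generalizing p with
  | nil => simp [doubleListPoly]
  | cons d u ih =>
    rw [List.length_cons] at h
    rw [doubleListPoly, map_mul, rename_doublePoly, ih _ fun k h1 h2 => h k (by omega) (by omega),
      h p le_rfl (by omega), doubleListPoly]

theorem rename_braidPoly (e : Equiv.Perm ℕ) (c : Color D) (x y p : ℕ)
    (u : List (Color D)) (h : ∀ k, p ≤ k → k < p + u.length → e k = k) :
    MvPolynomial.rename e (braidPoly K c x y p u) = braidPoly K c (e x) (e y) p u := by
  induction u generalizing p with
  | nil => simp [braidPoly]
  | cons d u ih =>
    rw [List.length_cons] at h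
    have h' : ∀ k, p + 1 ≤ k → k < p + 1 + u.length → e k = k :=
      fun k h1 h2 => h k (by omega) (by omega)
    rw [braidPoly, map_add, map_mul, map_mul, rename_doublePoly, ih _ h', rename_geomPoly,
      rename_doubleListPoly _ _ _ _ _ h', h p le_rfl (by omega), braidPoly]

variable {c : Color D}

theorem not_sameReal_of_ne {a b : Color D} (h : a.idx ≠ b.idx) : ¬ SameReal a b := fun h' => h h'.1

/-- The double crossing of a strand with the group of strands on its left. -/
theorem listOne_mul_descAt_mul_ascAt_eq (hp : A.length = p) (hq : u.length = q)
    (h : ∀ d ∈ u, d.idx ≠ c.idx) :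
    𝟙 (A ++ (u ++ c :: B)) * (δ p q * α p q) =
      𝟙 (A ++ (u ++ c :: B)) * dotPoly K ν (doubleListPoly K c (p + q) p u) := by
  induction u generalizing A p q with
  | nil => subst hq; simp [doubleListPoly]
  | cons d u ih =>
    subst hq
    have hd := h d (by simp)
    have hu : ∀ x ∈ u, x.idx ≠ c.idx := fun x hx => h x (by simp [hx])
    have h1 := ih (A := A ++ [d]) (p := p + 1) (by simp [hp]) rfl hu
    obtain ⟨e, he1, -, he3, he4⟩ := exists_listOne_mul_dotPoly_mul_descAt (K := K) (ν := ν)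
      (A := A ++ [d]) (u := u) (b := c) (B := B) (p := p + 1) (by simp [hp]) rfl
      (fun x hx => not_sameReal_of_ne (hu x hx))
    have h5 := listOne_mul_descAt (K := K) (ν := ν) (A := A ++ [d]) (u := u) (b := c) (B := B)
      (p := p + 1) (by simp [hp]) rfl
    have h6 := listOne_mul_crossAt_sq_eq_doublePoly' (K := K) (ν := ν) (B := u ++ B) hp hd
    have h7 := he4 (doublePoly K c d (p + 1 + u.length) p)
    rw [rename_doublePoly, he3, he1 p (by omega)] at h7
    simp only [List.append_assoc, List.singleton_append] at h1 h5 h7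
    have h8 : 𝟙 (A ++ d :: c :: (u ++ B)) * (τ p * (τ p * α (p + 1) u.length)) =
        𝟙 (A ++ d :: c :: (u ++ B)) *
          (dotPoly K ν (doublePoly K c d (p + 1) p) * α (p + 1) u.length) := by
      rw [← mul_assoc (τ p), ← mul_assoc, h6, mul_assoc]
    rw [List.length_cons, List.cons_append, descAt_succ', ascAt_succ', mul_assoc,
      mul_mul_congr h5 h8, ← mul_assoc (δ _ _), ← mul_assoc, ← h7, mul_assoc, mul_assoc,
      mul_mul_congr (listOne_comm_dotPoly _ _).eq h1, ← map_mul, doubleListPoly,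
      show p + (u.length + 1) = p + 1 + u.length by omega]

/-- The double crossing of a strand with the group of strands on its right. -/
theorem listOne_mul_ascAt_mul_descAt_eq (hp : A.length = p) (hq : u.length = q)
    (h : ∀ d ∈ u, d.idx ≠ c.idx) :
    𝟙 (A ++ c :: (u ++ B)) * (α p q * δ p q) =
      𝟙 (A ++ c :: (u ++ B)) * dotPoly K ν (doubleListPoly K c p (p + 1) u) := by
  induction u generalizing A p q with
  | nil => subst hq; simp [doubleListPoly]
  | cons d u ih =>
    subst hq
    have hd := (h d (by simp)).symm
    have hu : ∀ x ∈ u, x.idx ≠ c.idx := fun x hx => h x (by simp [hx])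
    have h1 := ih (A := A ++ [d]) (p := p + 1) (by simp [hp]) rfl hu
    have h2 := listOne_mul_crossAt K (ν := ν) (a := c) (b := d) (B := u ++ B) hp
    have h6 := listOne_mul_crossAt_sq_eq_doublePoly (K := K) (ν := ν) (B := u ++ B) hp hd
    have h7 := listOne_mul_dotPoly_mul_crossAt (K := K) (ν := ν) (B := u ++ B) hp
      (not_sameReal_of_ne hd) (doubleListPoly K c p (p + 1 + 1) u)
    rw [rename_doubleListPoly _ _ _ _ _ (fun k h1 h2 =>
      Equiv.swap_apply_of_ne_of_ne (by omega) (by omega)), Equiv.swap_apply_left] at h7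
    simp only [List.append_assoc, List.singleton_append] at h1
    have h8 : 𝟙 (A ++ d :: c :: (u ++ B)) * (α (p + 1) u.length * (δ (p + 1) u.length * τ p)) =
        𝟙 (A ++ d :: c :: (u ++ B)) *
          (dotPoly K ν (doubleListPoly K c (p + 1) (p + 1 + 1) u) * τ p) := by
      rw [← mul_assoc (α _ _), ← mul_assoc, h1, mul_assoc]
    rw [List.length_cons, List.cons_append, descAt_succ', ascAt_succ', mul_assoc,
      mul_mul_congr h2 h8, ← mul_assoc (τ p), ← mul_assoc, ← h7, mul_assoc, mul_assoc,
      mul_mul_congr (listOne_comm_dotPoly _ _).eq h6, ← map_mul, doubleListPoly, mul_comm]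

/-- The braid relation of two strands of the same real colour with one strand between them. -/
theorem listOne_mul_braid_eq_geomPoly {d : Color D} (hp : A.length = p) (hc : D.IsReal c.idx)
    (hd : d.idx ≠ c.idx) :
    𝟙 (A ++ c :: d :: c :: B) * (τ p * τ (p + 1) * τ p) =
      𝟙 (A ++ c :: d :: c :: B) * (τ (p + 1) * τ p * τ (p + 1) +
        dotPoly K ν (geomPoly K p (p + 2) (-((d.mult : ℤ) * D.a c.idx d.idx)).toNat)) := by
  by_cases ha : D.a c.idx d.idx = 0
  · have := listOne_mul_braid K (ν := ν) (a := c) (b := d) (c := c) (B := B) hp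
      (fun h => h.2.2 ha)
    rw [ha, mul_zero, neg_zero, Int.toNat_zero, geomPoly, Finset.sum_range_zero, map_zero, add_zero]
    simp only [← mul_assoc, this]
  · have := listOne_mul_braid_real K (ν := ν) (a := c) (b := d) (c := c) (B := B) hp
      ⟨⟨rfl, hc⟩, hd.symm, ha⟩
    simp only [← mul_assoc, this, mul_add, geomPoly, map_sum, map_mul, map_pow, dotPoly_X]

/-- The braid relation for a group of strands between two strands of the same real colour.  In the
induction the leftmost strand `d` of the group is treated last: its braid relation and its double
crossing give the two summands of `braidPoly`. -/
theorem listOne_mul_braid_eq (hp : A.length = p) (hq : u.length = q) (hc : D.IsReal c.idx)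
    (h : ∀ d ∈ u, d.idx ≠ c.idx) :
    𝟙 (A ++ c :: (u ++ c :: B)) * (α p q * τ (p + q) * δ p q) =
      𝟙 (A ++ c :: (u ++ c :: B)) * (δ (p + 1) q * τ p * α (p + 1) q +
        dotPoly K ν (braidPoly K c p (p + q + 1) (p + 1) u)) := by
  induction u generalizing A p q with
  | nil => subst hq; simp [braidPoly]
  | cons d u ih =>
    subst hq
    have hd := h d (by simp)
    have hu : ∀ x ∈ u, x.idx ≠ c.idx := fun x hx => h x (by simp [hx])
    have h1 := ih (A := A ++ [d]) (p := p + 1) (by simp [hp]) rfl hu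
    have h2 := listOne_mul_crossAt K (ν := ν) (a := c) (b := d) (B := u ++ c :: B) hp
    have h3 := listOne_mul_descAt (K := K) (ν := ν) (A := A ++ [c, d]) (u := u) (b := c) (B := B)
      (p := p + 2) (by simp [hp]) rfl
    have h4 := listOne_mul_braid_eq_geomPoly (K := K) (ν := ν) (B := u ++ B) hp hc hd
    have h5 := listOne_mul_descAt_mul_ascAt_eq (K := K) (ν := ν) (A := A ++ [c, d]) (u := u)
      (c := c) (B := B) (p := p + 2) (by simp [hp]) rfl hu
    obtain ⟨e, he1, -, he3, he4⟩ := exists_listOne_mul_dotPoly_mul_descAt (K := K) (ν := ν)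
      (A := A ++ [c, d]) (u := u) (b := c) (B := B) (p := p + 2) (by simp [hp]) rfl
      (fun x hx => not_sameReal_of_ne (hu x hx))
    have h6 := listOne_mul_crossAt_sq_eq_doublePoly (K := K) (ν := ν) (B := u ++ c :: B) hp hd.symm
    have h7 := listOne_mul_dotPoly_mul_crossAt (K := K) (ν := ν) (B := u ++ c :: B) hp
      (not_sameReal_of_ne hd.symm) (braidPoly K c p (p + 1 + u.length + 1) (p + 1 + 1) u)
    rw [rename_braidPoly _ _ _ _ _ _ (fun k h1 h2 =>
      Equiv.swap_apply_of_ne_of_ne (by omega) (by omega)), Equiv.swap_apply_left,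
      Equiv.swap_apply_of_ne_of_ne (by omega) (by omega)] at h7
    have h9 := he4 (geomPoly K p (p + 2 + u.length) (-((d.mult : ℤ) * D.a c.idx d.idx)).toNat)
    rw [rename_geomPoly, he3, he1 p (by omega)] at h9
    simp only [List.append_assoc, List.cons_append, List.nil_append] at h1 h3 h5 h9
    set P := dotPoly K ν (braidPoly K c (p + 1) (p + 1 + u.length + 1) (p + 1 + 1) u) with hP
    set G := dotPoly K ν (geomPoly K p (p + 2) (-((d.mult : ℤ) * D.a c.idx d.idx)).toNat) with hG
    -- both summands given by the relation for the shorter group of strands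
    have k1 : 𝟙 (A ++ c :: d :: (u ++ c :: B)) * (τ p * (P * τ p)) =
        𝟙 (A ++ c :: d :: (u ++ c :: B)) * dotPoly K ν (doublePoly K c d p (p + 1) *
          braidPoly K c p (p + 1 + u.length + 1) (p + 1 + 1) u) := by
      rw [← mul_assoc (τ p), ← mul_assoc, ← h7, mul_assoc, mul_assoc,
        mul_mul_congr (listOne_comm_dotPoly _ _).eq h6, ← map_mul, mul_comm]
    have k2 : 𝟙 (A ++ c :: d :: (u ++ c :: B)) *
        (τ p * (δ (p + 2) u.length * (τ (p + 1) * (α (p + 2) u.length * τ p)))) =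
        𝟙 (A ++ c :: d :: (u ++ c :: B)) * (δ (p + 1) (u.length + 1) * τ p *
          α (p + 1) (u.length + 1)) +
        𝟙 (A ++ c :: d :: (u ++ c :: B)) *
          dotPoly K ν (geomPoly K p (p + 2 + u.length) (-((d.mult : ℤ) * D.a c.idx d.idx)).toNat *
          doubleListPoly K c (p + 2 + u.length) (p + 2) u) := by
      have c1 : Commute (τ p) (δ (p + 2) u.length) := crossAt_comm_descAt (by omega)
      have c2 : Commute (τ p) (α (p + 2) u.length) := crossAt_comm_ascAt (by omega)
      have k3 : 𝟙 (A ++ c :: d :: c :: (u ++ B)) *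
          (τ p * τ (p + 1) * τ p * α (p + 2) u.length) = 𝟙 (A ++ c :: d :: c :: (u ++ B)) *
          ((τ (p + 1) * τ p * τ (p + 1) + G) * α (p + 2) u.length) := by
        rw [← mul_assoc, h4, mul_assoc]
      rw [← c2.eq, ← mul_assoc (τ p), c1.eq, mul_assoc, ← mul_assoc (τ (p + 1)),
        ← mul_assoc (τ p) _ (α _ _), ← mul_assoc (τ p), mul_mul_congr h3 k3, add_mul, mul_add,
        mul_add, descAt_succ', ascAt_succ']
      congr 1
      · simp only [mul_assoc]
      · rw [← mul_assoc (δ _ _), ← mul_assoc, ← h9, mul_assoc, mul_assoc,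
          mul_mul_congr (listOne_comm_dotPoly _ _).eq h5, ← map_mul]
    have k4 : 𝟙 (A ++ d :: c :: (u ++ c :: B)) * (α (p + 1) u.length * τ (p + 1 + u.length) *
        δ (p + 1) u.length * τ p) = 𝟙 (A ++ d :: c :: (u ++ c :: B)) *
        ((δ (p + 1 + 1) u.length * τ (p + 1) * α (p + 1 + 1) u.length + P) * τ p) := by
      rw [← mul_assoc, h1, mul_assoc]
    have k5 : α p (u.length + 1) * τ (p + (u.length + 1)) * δ p (u.length + 1) = τ p *
        (α (p + 1) u.length * τ (p + 1 + u.length) * δ (p + 1) u.length * τ p) := by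
      rw [ascAt_succ', descAt_succ', show p + (u.length + 1) = p + 1 + u.length by omega]
      simp only [mul_assoc]
    rw [List.length_cons, List.cons_append, k5, mul_mul_congr h2 k4, add_mul, mul_add, mul_add,
      k1, mul_assoc, mul_assoc, k2, mul_add, braidPoly, map_add, mul_add, add_assoc,
      show p + (u.length + 1) + 1 = p + 2 + u.length by omega,
      show p + 1 + u.length + 1 = p + 2 + u.length by omega]

end Polynomials

/-! ### Leading terms -/

section LeadingTerms

variable {I : Type*} (K : Type*) [Field K] {D : Datum I}

open MvPolynomial

/-- Polynomials in the variables `x`, `y` and the variables in `S` whose total degree in `x` and `y`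
is less than `d`. -/
noncomputable def lowSpan (x y : ℕ) (S : Set ℕ) (d : ℤ) : Submodule K (MvPolynomial ℕ K) :=
  Submodule.span K {f | ∃ (i j : ℕ) (g : MvPolynomial ℕ K), ((i + j : ℕ) : ℤ) < d ∧
    g ∈ supported K S ∧ f = X x ^ i * X y ^ j * g}

variable {K} {x y : ℕ} {S : Set ℕ}

theorem mul_mem_lowSpan {d e k : ℤ} (h : d + e - 1 ≤ k) {f g : MvPolynomial ℕ K}
    (hf : f ∈ lowSpan K x y S d) (hg : g ∈ lowSpan K x y S e) : f * g ∈ lowSpan K x y S k := by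
  have h1 := Submodule.mul_mem_mul hf hg
  rw [lowSpan, lowSpan, Submodule.span_mul_span] at h1
  refine Submodule.span_mono ?_ h1
  rintro _ ⟨_, ⟨i, j, g, hij, hg, rfl⟩, _, ⟨i', j', g', hij', hg', rfl⟩, rfl⟩
  refine ⟨i + i', j + j', g * g', by push_cast at *; omega, mul_mem hg hg', ?_⟩
  simp only [pow_add]
  ring

theorem lowSpan_mono {d e : ℤ} (h : d ≤ e) : lowSpan K x y S d ≤ lowSpan K x y S e := by
  refine Submodule.span_mono ?_
  rintro _ ⟨i, j, g, hij, hg, rfl⟩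
  exact ⟨i, j, g, by omega, hg, rfl⟩

theorem pow_mul_pow_mem_lowSpan {i j : ℕ} {d : ℤ} (h : ((i + j : ℕ) : ℤ) < d) :
    (X x ^ i * X y ^ j : MvPolynomial ℕ K) ∈ lowSpan K x y S d :=
  Submodule.subset_span ⟨i, j, 1, h, one_mem _, by rw [mul_one]⟩

theorem geomPoly_mem_lowSpan (n : ℕ) : geomPoly K x y n ∈ lowSpan K x y S n := by
  refine Submodule.sum_mem _ fun i hi => pow_mul_pow_mem_lowSpan ?_
  rw [Finset.mem_range] at hi
  omega

theorem supported_mem_lowSpan {f : MvPolynomial ℕ K} (hf : f ∈ supported K S) {d : ℤ}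
    (h : 0 < d) : f ∈ lowSpan K x y S d :=
  Submodule.subset_span ⟨0, 0, f, by simpa using h, hf, by simp⟩

variable {c : Color D}

theorem doublePoly_sub_mem_lowSpan (hc : D.IsReal c.idx) {d : Color D} (hd : d.idx ≠ c.idx)
    {p : ℕ} (hp : p ∈ S) (w : ℕ) :
    doublePoly K c d w p - X w ^ (-((d.mult : ℤ) * D.a c.idx d.idx)).toNat ∈
      lowSpan K x y S (-((d.mult : ℤ) * D.a c.idx d.idx)).toNat := by
  have hm : c.mult = 1 := c.mult_eq_one (by
    unfold Datum.IsNeg; unfold Datum.IsReal at hc; omega)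
  rw [doublePoly, hm, Nat.cast_one, mul_one]
  split_ifs with h
  · simp [h]
  · rw [add_sub_cancel_left]
    refine supported_mem_lowSpan (pow_mem ?_ _) ?_
    · exact X_mem_supported.2 hp
    · have h1 := D.offDiag _ _ hd.symm
      have h2 := d.mult_pos
      have : 0 < (d.mult : ℤ) * -D.a c.idx d.idx := mul_pos (by omega) (by omega)
      rw [mul_neg] at this
      omega

/-- For a real colour `c`, the degree in the dot of a strand of colour `c` of its double crossing with
the strands `u`. -/
def crossDegree (c : Color D) (u : List (Color D)) : ℕ :=
  (u.map fun d => (-((d.mult : ℤ) * D.a c.idx d.idx)).toNat).sum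

theorem crossDegree_cons (c d : Color D) (u : List (Color D)) :
    crossDegree c (d :: u) = (-((d.mult : ℤ) * D.a c.idx d.idx)).toNat + crossDegree c u := by
  simp [crossDegree]

/-- The leading term of `doubleListPoly` in the variable `y`.  The variable `x` plays no role. -/
theorem doubleListPoly_sub_mem_lowSpan (hc : D.IsReal c.idx) {u : List (Color D)} {p : ℕ}
    (hu : ∀ d ∈ u, d.idx ≠ c.idx) (hS : ∀ k, p ≤ k → k < p + u.length → k ∈ S) :
    doubleListPoly K c y p u - X y ^ crossDegree c u ∈ lowSpan K x y S (crossDegree c u) := by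
  induction u generalizing p with
  | nil => simp [doubleListPoly, crossDegree]
  | cons d u ih =>
    rw [List.length_cons] at hS
    have h1 := ih (p := p + 1) (fun x hx => hu x (by simp [hx]))
      fun k h1 h2 => hS k (by omega) (by omega)
    have h2 := doublePoly_sub_mem_lowSpan (K := K) (x := x) (y := y) hc (hu d (by simp))
      (hS p le_rfl (by omega)) y
    rw [crossDegree_cons, doubleListPoly]
    generalize (-((d.mult : ℤ) * D.a c.idx d.idx)).toNat = n at *
    generalize crossDegree c u = N at *
    have h3 : X y ^ N ∈ lowSpan K x y S (N + 1) := by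
      simpa using pow_mul_pow_mem_lowSpan (K := K) (x := x) (y := y) (S := S) (i := 0) (j := N)
        (d := N + 1) (by simp)
    have h4 : X y ^ n ∈ lowSpan K x y S (n + 1) := by
      simpa using pow_mul_pow_mem_lowSpan (K := K) (x := x) (y := y) (S := S) (i := 0) (j := n)
        (d := n + 1) (by simp)
    have h5 : doubleListPoly K c y (p + 1) u ∈ lowSpan K x y S (N + 1) := by
      simpa using Submodule.add_mem _ (lowSpan_mono (by omega) h1) h3
    have h6 := Submodule.add_mem _ (mul_mem_lowSpan (k := ((n + N : ℕ) : ℤ)) (by omega) h2 h5)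
      (mul_mem_lowSpan (k := ((n + N : ℕ) : ℤ)) (by omega) h4 h1)
    convert h6 using 1
    rw [pow_add]
    ring

/-- The leading form of `braidPoly` in the variables `x` and `y`. -/
theorem braidPoly_sub_mem_lowSpan (hc : D.IsReal c.idx) {u : List (Color D)} {p : ℕ}
    (hu : ∀ d ∈ u, d.idx ≠ c.idx) (hS : ∀ k, p ≤ k → k < p + u.length → k ∈ S) :
    braidPoly K c x y p u - geomPoly K x y (crossDegree c u) ∈
      lowSpan K x y S ((crossDegree c u : ℤ) - 1) := by
  induction u generalizing p with
  | nil => simp [braidPoly, crossDegree, geomPoly]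
  | cons d u ih =>
    rw [List.length_cons] at hS
    have hS' : ∀ k, p + 1 ≤ k → k < p + 1 + u.length → k ∈ S :=
      fun k h1 h2 => hS k (by omega) (by omega)
    have h1 := ih (p := p + 1) (fun x hx => hu x (by simp [hx])) hS'
    have h0 := doubleListPoly_sub_mem_lowSpan (K := K) (x := x) (y := y) hc (p := p + 1)
      (fun x hx => hu x (by simp [hx])) hS'
    have h2 := doublePoly_sub_mem_lowSpan (K := K) (x := x) (y := y) hc (hu d (by simp))
      (hS p le_rfl (by omega)) x
    rw [crossDegree_cons, braidPoly]
    generalize (-((d.mult : ℤ) * D.a c.idx d.idx)).toNat = n at *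
    generalize crossDegree c u = N at *
    have h3 : X x ^ n ∈ lowSpan K x y S (n + 1) := by
      simpa using pow_mul_pow_mem_lowSpan (K := K) (x := x) (y := y) (S := S) (i := n) (j := 0)
        (d := n + 1) (by simp)
    have h4 : braidPoly K c x y (p + 1) u ∈ lowSpan K x y S N := by
      simpa using Submodule.add_mem _ (lowSpan_mono (by omega) h1) (geomPoly_mem_lowSpan N)
    have h5 : geomPoly K x y (n + N) = geomPoly K x y n * X y ^ N + X x ^ n * geomPoly K x y N := by
      rw [geomPoly, Finset.sum_range_add, geomPoly, geomPoly, Finset.sum_mul, Finset.mul_sum]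
      congr 1
      · refine Finset.sum_congr rfl fun i hi => ?_
        rw [Finset.mem_range] at hi
        rw [mul_assoc, ← pow_add]
        congr 2
        omega
      · refine Finset.sum_congr rfl fun i hi => ?_
        rw [pow_add, mul_assoc]
        congr 3
        omega
    have h6 := Submodule.add_mem _ (Submodule.add_mem _
      (mul_mem_lowSpan (k := ((n + N : ℕ) : ℤ) - 1) (by push_cast; omega)
        (geomPoly_mem_lowSpan n) h0)
      (mul_mem_lowSpan (k := ((n + N : ℕ) : ℤ) - 1) (by push_cast; omega) h2 h4))
      (mul_mem_lowSpan (k := ((n + N : ℕ) : ℤ) - 1) (by push_cast; omega) h3 h1)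
    convert h6 using 1
    rw [h5]
    ring

end LeadingTerms

/-! ### Isomorphisms given by right multiplication -/

section RightMultiplication

variable {I : Type*} {K : Type*} [Field K] {D : Datum I} {ν : Multiset (Color D)}

/-- Right multiplication by `g`, as a homomorphism of left ideals `R(ν) e → R(ν) f`. -/
noncomputable def mulRightIdeal {e f : KLR K ν} (g : KLR K ν)
    (h : e * g ∈ Submodule.span (KLR K ν) {f}) : LeftIdeal K e →ₗ[KLR K ν] LeftIdeal K f :=
  LinearMap.codRestrict _ ((LinearMap.toSpanSingleton (KLR K ν) (KLR K ν) g).comp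
    (Submodule.subtype _)) (by
      intro y
      obtain ⟨a, ha⟩ := Submodule.mem_span_singleton.1 y.2
      rw [LinearMap.comp_apply, Submodule.subtype_apply, LinearMap.toSpanSingleton_apply, ← ha,
        smul_eq_mul, smul_eq_mul, mul_assoc]
      exact Submodule.smul_mem _ a h)

theorem coe_mulRightIdeal {e f : KLR K ν} (g : KLR K ν)
    (h : e * g ∈ Submodule.span (KLR K ν) {f}) (y : LeftIdeal K e) :
    (mulRightIdeal g h y : KLR K ν) = y * g := rfl

theorem mul_mem_degPart {d d' : ℤ} {a b : KLR K ν} (ha : a ∈ degPart K ν d)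
    (hb : b ∈ degPart K ν d') : a * b ∈ degPart K ν (d + d') :=
  SetLike.GradedMul.mul_mem ha hb

/-- Elements `g` and `g'` whose right multiplications are inverse to each other give an isomorphism of
left ideals. -/
theorem iso_of_mul {P Q : ShiftedIdeal K ν} (g g' : KLR K ν)
    (h : P.elem * g ∈ Submodule.span (KLR K ν) {Q.elem})
    (h' : Q.elem * g' ∈ Submodule.span (KLR K ν) {P.elem})
    (hg : P.elem * (g * g') = P.elem) (hg' : Q.elem * (g' * g) = Q.elem)
    (hd : g ∈ degPart K ν (P.shift - Q.shift)) (hd' : g' ∈ degPart K ν (Q.shift - P.shift)) :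
    Iso P Q := by
  have inv : ∀ {e g g' : KLR K ν} (y : LeftIdeal K e), e * (g * g') = e →
      (y : KLR K ν) * g * g' = y := by
    rintro e g g' ⟨y, hy⟩ he
    obtain ⟨a, rfl⟩ := Submodule.mem_span_singleton.1 hy
    simp only [smul_eq_mul]
    rw [mul_assoc, mul_assoc, he]
  refine ⟨LinearEquiv.ofLinearMap (mulRightIdeal g h) (mulRightIdeal g' h') ?_ ?_, ?_⟩
  · ext1 y
    apply Subtype.ext
    exact inv y hg'
  · ext1 y
    apply Subtype.ext
    exact inv y hg
  · intro n y
    simp only [ShiftedIdeal.part, Set.mem_ofPred_eq, LinearEquiv.coe_ofLinearMap,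
      coe_mulRightIdeal]
    constructor
    · intro hy
      have := mul_mem_degPart hy hd
      rwa [sub_add_sub_cancel] at this
    · intro hy
      have := mul_mem_degPart hy hd'
      rwa [sub_add_sub_cancel, inv y hg] at this

theorem SumIso.trans {ι κ μ : Type} {P : ι → ShiftedIdeal K ν} {Q : κ → ShiftedIdeal K ν}
    {R : μ → ShiftedIdeal K ν} (h : SumIso P Q) (h' : SumIso Q R) : SumIso P R := by
  obtain ⟨φ, hφ⟩ := h
  obtain ⟨χ, hχ⟩ := h'
  exact ⟨φ.trans χ, fun n y => (hφ n y).trans (hχ n (φ y))⟩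

theorem SumIso.symm {ι κ : Type} {P : ι → ShiftedIdeal K ν} {Q : κ → ShiftedIdeal K ν}
    (h : SumIso P Q) : SumIso Q P := by
  obtain ⟨φ, hφ⟩ := h
  refine ⟨φ.symm, fun n y => ?_⟩
  rw [hφ, LinearEquiv.apply_symm_apply]

theorem sumIso_of_iso {ι : Type} {P Q : ι → ShiftedIdeal K ν} (h : ∀ c, Iso (P c) (Q c)) :
    SumIso P Q := by
  choose φ hφ using h
  refine ⟨DFinsupp.mapRange.linearEquiv φ, fun n y => forall_congr' fun c => ?_⟩
  exact hφ c n (y c)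

/-- Matrices that are inverse to each other give isomorphisms of direct sums of left ideals. -/
theorem sumIso_of_matrix {ι κ : Type} [Fintype ι] [Fintype κ] [DecidableEq ι] [DecidableEq κ]
    {P : ι → ShiftedIdeal K ν} {Q : κ → ShiftedIdeal K ν} (g : ι → κ → KLR K ν)
    (g' : κ → ι → KLR K ν)
    (h : ∀ c d, (P c).elem * g c d ∈ Submodule.span (KLR K ν) {(Q d).elem})
    (h' : ∀ d c, (Q d).elem * g' d c ∈ Submodule.span (KLR K ν) {(P c).elem})
    (hg : ∀ c c', ∑ d, (P c).elem * (g c d * g' d c') = if c = c' then (P c).elem else 0)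
    (hg' : ∀ d d', ∑ c, (Q d).elem * (g' d c * g c d') = if d = d' then (Q d).elem else 0)
    (hd : ∀ c d, g c d ∈ degPart K ν ((P c).shift - (Q d).shift))
    (hd' : ∀ d c, g' d c ∈ degPart K ν ((Q d).shift - (P c).shift)) :
    SumIso P Q := by
  have inv : ∀ {ι κ : Type} [Fintype ι] [Fintype κ] [DecidableEq ι] {e : ι → KLR K ν}
      (g : ι → κ → KLR K ν) (g' : κ → ι → KLR K ν) (y : ∀ c, LeftIdeal K (e c)),
      (∀ c c', ∑ d, e c * (g c d * g' d c') = if c = c' then e c else 0) → ∀ c',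
      ∑ d, (∑ c, (y c : KLR K ν) * g c d) * g' d c' = y c' := by
    intro ι κ _ _ _ e g g' y he c'
    simp only [Finset.sum_mul]
    rw [Finset.sum_comm, Finset.sum_eq_single c']
    · obtain ⟨a, ha⟩ := Submodule.mem_span_singleton.1 (y c').2
      have := he c' c'
      rw [if_pos rfl] at this
      rw [← ha, smul_eq_mul]
      simp only [mul_assoc]
      rw [← Finset.mul_sum, this]
    · intro c _ hc
      obtain ⟨a, ha⟩ := Submodule.mem_span_singleton.1 (y c).2
      have := he c c'
      rw [if_neg hc] at this
      rw [← ha, smul_eq_mul]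
      simp only [mul_assoc]
      rw [← Finset.mul_sum, this, mul_zero]
    · simp
  let φ : (∀ c, LeftIdeal K (P c).elem) →ₗ[KLR K ν] ∀ d, LeftIdeal K (Q d).elem :=
    LinearMap.pi fun d => ∑ c, (mulRightIdeal (g c d) (h c d)).comp (LinearMap.proj c)
  let χ : (∀ d, LeftIdeal K (Q d).elem) →ₗ[KLR K ν] ∀ c, LeftIdeal K (P c).elem :=
    LinearMap.pi fun c => ∑ d, (mulRightIdeal (g' d c) (h' d c)).comp (LinearMap.proj d)
  have hφ : ∀ y d, ((φ y d : LeftIdeal K (Q d).elem) : KLR K ν) =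
      ∑ c, (y c : KLR K ν) * g c d := by
    intro y d
    simp [φ, coe_mulRightIdeal]
  have hχ : ∀ y c, ((χ y c : LeftIdeal K (P c).elem) : KLR K ν) =
      ∑ d, (y d : KLR K ν) * g' d c := by
    intro y c
    simp [χ, coe_mulRightIdeal]
  have hχφ : ∀ y, χ (φ y) = y := by
    intro y
    funext c
    apply Subtype.ext
    rw [hχ]
    simp only [hφ]
    exact inv g g' y hg c
  have hφχ : ∀ y, φ (χ y) = y := by
    intro y
    funext d
    apply Subtype.ext
    rw [hφ]
    simp only [hχ]
    exact inv g' g y hg' d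
  have degφ : ∀ n y, (∀ c, y c ∈ (P c).part n) → ∀ d, φ y d ∈ (Q d).part n := by
    intro n y hy d
    change ((φ y d : LeftIdeal K (Q d).elem) : KLR K ν) ∈ degPart K ν (n - (Q d).shift)
    rw [hφ]
    refine Submodule.sum_mem _ fun c _ => ?_
    have := mul_mem_degPart (hy c) (hd c d)
    rwa [sub_add_sub_cancel] at this
  have degχ : ∀ n y, (∀ d, y d ∈ (Q d).part n) → ∀ c, χ y c ∈ (P c).part n := by
    intro n y hy c
    change ((χ y c : LeftIdeal K (P c).elem) : KLR K ν) ∈ degPart K ν (n - (P c).shift)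
    rw [hχ]
    refine Submodule.sum_mem _ fun d _ => ?_
    have := mul_mem_degPart (hy d) (hd' d c)
    rwa [sub_add_sub_cancel] at this
  let θ : (∀ c, LeftIdeal K (P c).elem) ≃ₗ[KLR K ν] ∀ d, LeftIdeal K (Q d).elem :=
    LinearEquiv.ofLinearMap φ χ (LinearMap.ext hφχ) (LinearMap.ext hχφ)
  let θ' : (∀ c, LeftIdeal K (P c).elem) ≃ₗ[KLR K ν] ⨁ d, LeftIdeal K (Q d).elem :=
    θ.trans (DirectSum.linearEquivFunOnFintype (KLR K ν) κ _).symm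
  refine ⟨(DirectSum.linearEquivFunOnFintype (KLR K ν) ι _).trans θ', fun n y => ?_⟩
  set y' : ∀ c, LeftIdeal K (P c).elem := DirectSum.linearEquivFunOnFintype (KLR K ν) ι _ y
  have h1 : y ∈ sumPart P n ↔ ∀ c, y' c ∈ (P c).part n := Iff.rfl
  have h2 : (DirectSum.linearEquivFunOnFintype (KLR K ν) ι _).trans θ' y ∈ sumPart Q n ↔
      ∀ d, φ y' d ∈ (Q d).part n := Iff.rfl
  rw [h1, h2]
  refine ⟨degφ n y', fun hy => ?_⟩
  have := degχ n _ hy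
  rwa [hχφ] at this

/-- If the matrix `S`, whose entries change the parity of the index, squares to the identity, then
the sum of the even terms of a family of left ideals is isomorphic to the sum of the odd ones. -/
theorem sumIso_even_odd (m : ℕ) (P : ℕ → ShiftedIdeal K ν) (S : ℕ → ℕ → KLR K ν)
    (hS : ∀ a b, a % 2 = b % 2 → S a b = 0)
    (hmem : ∀ a ≤ m, ∀ b ≤ m, (P a).elem * S a b ∈ Submodule.span (KLR K ν) {(P b).elem})
    (hsq : ∀ a ≤ m, ∀ a' ≤ m, ∑ b ∈ Finset.range (m + 1), (P a).elem * (S a b * S b a') =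
      if a = a' then (P a).elem else 0)
    (hdeg : ∀ a ≤ m, ∀ b ≤ m, S a b ∈ degPart K ν ((P a).shift - (P b).shift)) :
    SumIso (fun c : {c : ℕ // 2 * c ≤ m} => P (2 * c))
      (fun c : {c : ℕ // 2 * c + 1 ≤ m} => P (2 * c + 1)) := by
  classical
  have : Finite {c : ℕ // 2 * c ≤ m} :=
    Finite.of_injective (fun c => (⟨c.1, by omega⟩ : Fin (m + 1)))
      fun c d h => Subtype.ext (by simpa using h)
  have : Finite {c : ℕ // 2 * c + 1 ≤ m} :=
    Finite.of_injective (fun c => (⟨c.1, by omega⟩ : Fin (m + 1)))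
      fun c d h => Subtype.ext (by simpa using h)
  have := Fintype.ofFinite {c : ℕ // 2 * c ≤ m}
  have := Fintype.ofFinite {c : ℕ // 2 * c + 1 ≤ m}
  refine sumIso_of_matrix (fun c d => S (2 * c) (2 * d + 1)) (fun d c => S (2 * d + 1) (2 * c))
    (fun c d => hmem _ c.2 _ d.2) (fun d c => hmem _ d.2 _ c.2) ?_ ?_
    (fun c d => hdeg _ c.2 _ d.2) (fun d c => hdeg _ d.2 _ c.2)
  · intro c c'
    refine (Finset.sum_of_injOn (t := Finset.range (m + 1))
      (g := fun b => (P (2 * c)).elem * (S (2 * c) b * S b (2 * c')))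
      (fun d => 2 * d.1 + 1) ?_ ?_ ?_ ?_).trans ?_
    · intro d _ d' _ h
      exact Subtype.ext (by simpa using h)
    · intro d _
      have := d.2
      simp only [Finset.coe_range, Set.mem_Iio]
      omega
    · intro b hb hb'
      rw [Finset.mem_range] at hb
      rcases Nat.even_or_odd' b with ⟨t, rfl | rfl⟩
      · rw [hS (2 * c) (2 * t) (by omega), zero_mul, mul_zero]
      · exact absurd ⟨⟨t, by omega⟩, by simp, rfl⟩ hb'
    · exact fun _ _ => rfl
    · rw [hsq _ c.2 _ c'.2]
      simp [Subtype.ext_iff]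
  · intro d d'
    refine (Finset.sum_of_injOn (t := Finset.range (m + 1))
      (g := fun b => (P (2 * d + 1)).elem * (S (2 * d + 1) b * S b (2 * d' + 1)))
      (fun c => 2 * c.1) ?_ ?_ ?_ ?_).trans ?_
    · intro c _ c' _ h
      exact Subtype.ext (by simpa using h)
    · intro c _
      have := c.2
      simp only [Finset.coe_range, Set.mem_Iio]
      omega
    · intro b hb hb'
      rw [Finset.mem_range] at hb
      rcases Nat.even_or_odd' b with ⟨t, rfl | rfl⟩
      · exact absurd ⟨⟨t, by omega⟩, by simp, rfl⟩ hb'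
      · rw [hS (2 * d + 1) (2 * t + 1) (by omega), zero_mul, mul_zero]
    · exact fun _ _ => rfl
    · rw [hsq _ d.2 _ d'.2]
      simp [Subtype.ext_iff]

/-- A split exact complex of left ideals given by right multiplications: `d` is the differential and
`± d'` the contracting homotopy. -/
theorem sumIso_of_homotopy (m : ℕ) (P : ℕ → ShiftedIdeal K ν) (d d' : ℕ → KLR K ν)
    (hd : ∀ a < m, (P a).elem * d a ∈ Submodule.span (KLR K ν) {(P (a + 1)).elem})
    (hd' : ∀ a < m, (P (a + 1)).elem * d' a ∈ Submodule.span (KLR K ν) {(P a).elem})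
    (hdd : ∀ a, a + 2 ≤ m → (P a).elem * (d a * d (a + 1)) = 0)
    (hdd' : ∀ a, a + 2 ≤ m → (P (a + 2)).elem * (d' (a + 1) * d' a) = 0)
    (h : ∀ a, a + 2 ≤ m → (P (a + 1)).elem * (d' a * d a) - (P (a + 1)).elem *
      (d (a + 1) * d' (a + 1)) = (-1 : K) ^ a • (P (a + 1)).elem)
    (h0 : 0 < m → (P 0).elem * (d 0 * d' 0) = (P 0).elem)
    (hm : ∀ a, a + 1 = m → (P m).elem * (d' a * d a) = (-1 : K) ^ a • (P m).elem)
    (hpos : 0 < m)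
    (hdeg : ∀ a < m, d a ∈ degPart K ν ((P a).shift - (P (a + 1)).shift))
    (hdeg' : ∀ a < m, d' a ∈ degPart K ν ((P (a + 1)).shift - (P a).shift)) :
    SumIso (fun c : {c : ℕ // 2 * c ≤ m} => P (2 * c))
      (fun c : {c : ℕ // 2 * c + 1 ≤ m} => P (2 * c + 1)) := by
  have hs : ∀ n : ℕ, (-1 : K) ^ n * (-1) ^ n = 1 := fun n => by
    rw [← mul_pow]; simp
  refine sumIso_even_odd m P (fun a b => if b = a + 1 then d a else
    if a = b + 1 then (-1 : K) ^ b • d' b else 0) ?_ ?_ ?_ ?_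
  · intro a b hab
    rw [if_neg (by omega), if_neg (by omega)]
  · intro a ha b hb
    split_ifs with h1 h2
    · subst h1; exact hd a (by omega)
    · subst h2
      rw [mul_smul_comm, Algebra.smul_def]
      exact Submodule.smul_mem _ _ (hd' b (by omega))
    · rw [mul_zero]; exact Submodule.zero_mem _
  · intro a ha a' ha'
    rcases a with _ | a
    · rw [Finset.sum_eq_single_of_mem 1 (Finset.mem_range.2 (by omega))
        (fun b _ hb => by rw [if_neg hb, if_neg (by omega), zero_mul, mul_zero]), if_pos rfl]
      by_cases h1 : a' = 2
      · subst h1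
        rw [if_pos rfl, if_neg (by omega), hdd 0 ha']
      · rw [if_neg h1]
        by_cases h2 : a' = 0
        · subst h2
          rw [if_pos rfl, if_pos rfl, pow_zero, one_smul, h0 hpos]
        · rw [if_neg (by omega), if_neg (Ne.symm h2), mul_zero, mul_zero]
    · have key : ∀ F : ℕ → KLR K ν, (∀ b, b ≠ a → b ≠ a + 2 → F b = 0) →
          ∑ b ∈ Finset.range (m + 1), F b = F a + if a + 2 ≤ m then F (a + 2) else 0 := by
        intro F hF
        split_ifs with h1
        · exact Finset.sum_eq_add_of_mem a (a + 2) (Finset.mem_range.2 (by omega))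
            (Finset.mem_range.2 (by omega)) (by omega) fun b _ hb => hF b hb.1 hb.2
        · rw [add_zero]
          refine Finset.sum_eq_single_of_mem a (Finset.mem_range.2 (by omega)) fun b hb hb' => ?_
          exact hF b hb' (by rw [Finset.mem_range] at hb; omega)
      rw [key _ fun b hb hb' => by rw [if_neg (by omega), if_neg (by omega), zero_mul, mul_zero],
        if_neg (show a ≠ a + 1 + 1 by omega), if_pos rfl,
        if_pos (show a + 2 = a + 1 + 1 from rfl)]
      rcases lt_trichotomy a' (a + 1) with h1 | h1 | h1
      · rw [if_neg (show a' ≠ a + 2 + 1 by omega), if_neg (show a + 2 ≠ a' + 1 by omega),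
          if_neg (show a' ≠ a + 1 by omega), if_neg (show a + 1 ≠ a' by omega), mul_zero, mul_zero,
          ite_self, add_zero]
        split_ifs with h2
        · subst h2
          rw [smul_mul_smul_comm, mul_smul_comm, hdd' a' (by omega), smul_zero]
        · rw [mul_zero, mul_zero]
      · subst h1
        rw [if_neg (show a + 1 ≠ a + 2 + 1 by omega), if_pos (show a + 2 = a + 1 + 1 from rfl),
          if_pos rfl, if_pos rfl, smul_mul_assoc, mul_smul_comm]
        split_ifs with h2
        · have := congrArg (fun z => (-1 : K) ^ a • z) (h a h2)
          simp only [smul_sub, smul_smul, hs, one_smul] at this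
          have hneg : ∀ z : KLR K ν, (-1 : K) ^ (a + 1) • z = -((-1 : K) ^ a • z) := fun z => by
            rw [pow_succ, mul_neg_one]
            exact neg_smul _ z
          rw [mul_smul_comm, mul_smul_comm, hneg, ← sub_eq_add_neg, this]
        · rw [add_zero, show a + 1 = m by omega, hm a (by omega), smul_smul, hs, one_smul]
      · rw [if_neg (show a' ≠ a + 1 by omega), if_neg (show a ≠ a' + 1 by omega), mul_zero,
          mul_zero, zero_add, if_neg (show a + 1 ≠ a' by omega),
          if_neg (show a + 2 ≠ a' + 1 by omega)]
        split_ifs with h2 h3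
        · subst h3
          rw [hdd (a + 1) (by omega)]
        · rw [mul_zero, mul_zero]
        · rfl
  · intro a ha b hb
    split_ifs with h1 h2
    · subst h1; exact hdeg a (by omega)
    · subst h2; exact Submodule.smul_mem _ _ (hdeg' b (by omega))
    · exact Submodule.zero_mem _

end RightMultiplication

/-! ### Degrees of crossings -/

section Degrees

variable {I : Type*} {K : Type*} [Field K] {D : Datum I} {ν : Multiset (Color D)}

local notation "𝟙" => listOne K ν
local notation "τ" => crossAt K ν
local notation "ξ" => dotAt K ν
local notation "δ" => descAt K ν
local notation "α" => ascAt K ν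

/-- Degrees add up along a chain of elements that move idempotents into each other. -/
theorem mul_mul_mem_degPart {e e' d x : KLR K ν} {s t : ℤ} (he : e * e = e) (h : e * d = d * e')
    (hd : e * d ∈ degPart K ν s) (hx : e' * x ∈ degPart K ν t) :
    e * (d * x) ∈ degPart K ν (s + t) := by
  have h1 : e * (d * x) = e * d * (e' * x) := by
    rw [← mul_assoc (e * d) e' x, mul_assoc e d e', ← h, ← mul_assoc e e d, he, mul_assoc]
  rw [h1]
  exact mul_mem_degPart hd hx

theorem listOne_mem_degPart (l : List (Color D)) : 𝟙 l ∈ degPart K ν 0 := by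
  by_cases h : (l : Multiset (Color D)) = ν
  · have h1 := gen_mem_degPart K (Gen.one (Seq.ofList l h))
    rwa [Gen.deg, ← listOne_of_eq K h] at h1
  · rw [listOne_of_ne K h]
    exact Submodule.zero_mem _

variable {A B u v : List (Color D)} {a b : Color D} {p l k : ℕ}

/-- The degree of a crossing of strands of colours `c` and `d`. -/
def crossDeg (c d : Color D) : ℤ := -(c.mult * d.mult * D.r c.idx * D.a c.idx d.idx)

theorem crossDeg_comm (c d : Color D) : crossDeg c d = crossDeg d c := by
  rw [crossDeg, crossDeg]
  linear_combination -((c.mult : ℤ) * d.mult) * D.symm c.idx d.idx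

theorem listOne_mul_crossAt_mem_degPart (hp : A.length = p) :
    𝟙 (A ++ a :: b :: B) * τ p ∈ degPart K ν (crossDeg a b) := by
  rw [listOne_mul_crossAt K hp]
  by_cases h : ((A ++ b :: a :: B : List (Color D)) : Multiset (Color D)) = ν
  · have hc : p + 1 < Multiset.card ν := by
      rw [← h, Multiset.coe_card]; simp [hp]
    rw [listOne_of_eq K h, crossAt_mul_gen_one K p hc]
    have hd := gen_mem_degPart K (Gen.cross p hc (Seq.ofList _ h))
    have h1 : (Seq.ofList _ h).at p (Nat.lt_of_succ_lt hc) = b := by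
      simp [Seq.at, Seq.ofList, ← hp]
    have h2 : (Seq.ofList _ h).at (p + 1) hc = a := by
      simp [Seq.at, Seq.ofList, ← hp, List.getElem_append_right]
    rw [crossDeg_comm]
    rwa [Gen.deg, h1, h2] at hd
  · rw [listOne_of_ne K h, mul_zero]
    exact Submodule.zero_mem _

theorem listOne_mul_dotAt_mem_degPart (hp : A.length = p) :
    𝟙 (A ++ a :: B) * ξ p ∈ degPart K ν (2 * D.r a.idx) := by
  rw [(listOne_comm_dotAt K _ p).eq]
  by_cases h : ((A ++ a :: B : List (Color D)) : Multiset (Color D)) = ν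
  · have hc : p < Multiset.card ν := by
      rw [← h, Multiset.coe_card]; simp [hp]
    rw [listOne_of_eq K h, dotAt_mul_gen_one K p hc]
    have hd := gen_mem_degPart K (Gen.dot p hc (Seq.ofList _ h))
    have h1 : (Seq.ofList _ h).at p hc = a := by
      simp [Seq.at, Seq.ofList, ← hp]
    rwa [Gen.deg, h1] at hd
  · rw [listOne_of_ne K h, mul_zero]
    exact Submodule.zero_mem _

theorem listOne_mul_descAt_mem_degPart (hp : A.length = p) (hl : u.length = l) :
    𝟙 (A ++ (u ++ b :: B)) * δ p l ∈ degPart K ν (u.map fun d => crossDeg d b).sum := by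
  induction u generalizing A p l with
  | nil => subst hl; simpa using listOne_mem_degPart _
  | cons d u ih =>
    subst hl
    have h1 := ih (A := A ++ [d]) (p := p + 1) (by simp [hp]) rfl
    have h2 := listOne_mul_descAt (K := K) (ν := ν) (A := A ++ [d]) (B := B) (b := b)
      (p := p + 1) (u := u) (by simp [hp]) rfl
    have h3 := listOne_mul_crossAt_mem_degPart (K := K) (ν := ν) (B := u ++ B) (a := d) (b := b) hp
    simp only [List.append_assoc, List.singleton_append] at h1 h2
    rw [List.length_cons, descAt_succ', List.cons_append, List.map_cons, List.sum_cons, add_comm]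
    exact mul_mul_mem_degPart (listOne_mul_self K _) h2 h1 h3

theorem listOne_mul_ascAt_mem_degPart (hp : A.length = p) (hl : u.length = l) :
    𝟙 (A ++ b :: (u ++ B)) * α p l ∈ degPart K ν (u.map fun d => crossDeg d b).sum := by
  induction u generalizing A p l with
  | nil => subst hl; simpa using listOne_mem_degPart _
  | cons d u ih =>
    subst hl
    have h1 := ih (A := A ++ [d]) (p := p + 1) (by simp [hp]) rfl
    have h2 := listOne_mul_crossAt K (ν := ν) (B := u ++ B) (a := b) (b := d) hp
    have h3 := listOne_mul_crossAt_mem_degPart (K := K) (ν := ν) (B := u ++ B) (a := b) (b := d) hp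
    simp only [List.append_assoc, List.singleton_append] at h1
    rw [List.length_cons, ascAt_succ', List.cons_append, List.map_cons, List.sum_cons,
      crossDeg_comm]
    exact mul_mul_mem_degPart (listOne_mul_self K _) h2 h3 h1

theorem sum_crossDeg_eq_zero (h : ∀ d ∈ u, D.a d.idx b.idx = 0) :
    (u.map fun d => crossDeg d b).sum = 0 :=
  List.sum_eq_zero fun x hx => by
    obtain ⟨d, hd, rfl⟩ := List.mem_map.1 hx
    rw [crossDeg, h d hd, mul_zero, neg_zero]

theorem listOne_mul_blockCross_mem_degPart (hp : A.length = p) (hl : u.length = l)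
    (hk : v.length = k) (h : ∀ d ∈ u, ∀ e ∈ v, D.a d.idx e.idx = 0) :
    𝟙 (A ++ (u ++ (v ++ B))) * blockCross K ν p l k ∈ degPart K ν 0 := by
  induction v generalizing A p k with
  | nil => subst hk; simpa [blockCross] using listOne_mem_degPart _
  | cons d v ih =>
    subst hk
    have h1 := ih (A := A ++ [d]) (p := p + 1) (by simp [hp]) rfl
      (fun x hx y hy => h x hx y (by simp [hy]))
    have h2 := listOne_mul_descAt (K := K) (ν := ν) (B := v ++ B) (b := d) hp hl
    have h3 := listOne_mul_descAt_mem_degPart (K := K) (ν := ν) (B := v ++ B) (b := d) hp hl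
    rw [sum_crossDeg_eq_zero fun x hx => h x hx d (by simp)] at h3
    simp only [List.append_assoc, List.singleton_append] at h1
    rw [List.length_cons, blockCross, List.cons_append, ← add_zero (0 : ℤ)]
    exact mul_mul_mem_degPart (listOne_mul_self K _) h2 h3 h1

theorem listOne_mul_blockCrossInv_mem_degPart (hp : A.length = p) (hl : u.length = l)
    (hk : v.length = k) (h : ∀ d ∈ u, ∀ e ∈ v, D.a d.idx e.idx = 0) :
    𝟙 (A ++ (v ++ (u ++ B))) * blockCrossInv K ν p l k ∈ degPart K ν 0 := by
  induction v generalizing A p k with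
  | nil => subst hk; simpa [blockCrossInv] using listOne_mem_degPart _
  | cons d v ih =>
    subst hk
    have h1 := ih (A := A ++ [d]) (p := p + 1) (by simp [hp]) rfl
      (fun x hx y hy => h x hx y (by simp [hy]))
    have h2 := listOne_mul_blockCrossInv (K := K) (ν := ν) (A := A ++ [d]) (B := B) (u := u)
      (v := v) (p := p + 1) (by simp [hp]) hl rfl
    have h3 := listOne_mul_ascAt_mem_degPart (K := K) (ν := ν) (B := v ++ B) (b := d) hp hl
    rw [sum_crossDeg_eq_zero fun x hx => h x hx d (by simp)] at h3
    simp only [List.append_assoc, List.singleton_append] at h1 h2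
    rw [List.length_cons, blockCrossInv, List.cons_append, ← add_zero (0 : ℤ)]
    exact mul_mul_mem_degPart (listOne_mul_self K _) h2 h1 h3

theorem listOne_mul_longestAt_mem_degPart {c : Color D} (hc : D.IsReal c.idx) (hp : A.length = p)
    (m : ℕ) : 𝟙 (A ++ (List.replicate m c ++ B)) * longestAt K ν p m ∈
      degPart K ν (-(2 * ((m * (m - 1) / 2 : ℕ) * D.r c.idx))) := by
  induction m generalizing B with
  | zero => simpa [longestAt] using listOne_mem_degPart _
  | succ m ih =>
    have h1 := ih (B := c :: B)
    have h2 := listOne_mul_descAt_mem_degPart (K := K) (ν := ν) (A := A) (B := B) (b := c)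
      (u := List.replicate m c) hp List.length_replicate
    have h3 := (isNilHecke_listOne (K := K) (ν := ν) (A := A) (B := c :: B) (m := m) hp
      hc).comm_wordSpan (longestAt_mem_wordSpan m) le_rfl le_rfl
    have hcm : c.mult = 1 := c.mult_eq_one (by
      unfold Datum.IsNeg; unfold Datum.IsReal at hc; omega)
    have h4 : (List.map (fun d => crossDeg d c) (List.replicate m c)).sum =
        -(2 * (m * D.r c.idx)) := by
      rw [List.map_replicate, List.sum_replicate, crossDeg, hcm, show D.a c.idx c.idx = 2 from hc,
        nsmul_eq_mul]
      push_cast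
      ring
    rw [h4] at h2
    have h5 : A ++ (List.replicate (m + 1) c ++ B) = A ++ (List.replicate m c ++ c :: B) := by
      rw [List.replicate_succ']; simp
    rw [h5, longestAt, Nat.triangle_succ]
    convert mul_mul_mem_degPart (listOne_mul_self K _) h3.eq h1 h2 using 1
    push_cast
    ring_nf

theorem listOne_mul_staircaseAt_mem_degPart {c : Color D} (hp : A.length = p) (m : ℕ) :
    𝟙 (A ++ (List.replicate m c ++ B)) * staircaseAt K ν p m ∈
      degPart K ν (2 * ((m * (m - 1) / 2 : ℕ) * D.r c.idx)) := by
  induction m generalizing A p with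
  | zero => simpa [staircaseAt] using listOne_mem_degPart _
  | succ m ih =>
    have h1 := ih (A := A ++ [c]) (p := p + 1) (by simp [hp])
    have h2 := listOne_mul_dotAt_mem_degPart (K := K) (ν := ν) (a := c)
      (B := List.replicate m c ++ B) hp
    have h3 : ∀ n : ℕ, 𝟙 (A ++ c :: (List.replicate m c ++ B)) * ξ p ^ n ∈
        degPart K ν (n * (2 * D.r c.idx)) := by
      intro n
      induction n with
      | zero => simpa using listOne_mem_degPart _
      | succ n ih' =>
        have := mul_mul_mem_degPart (listOne_mul_self K _)
          (((listOne_comm_dotAt K (ν := ν) _ p).pow_right n).eq) ih' h2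
        rw [pow_succ]
        convert this using 2
        push_cast
        ring
    simp only [List.append_assoc, List.singleton_append] at h1
    rw [staircaseAt_succ, List.replicate_succ, List.cons_append, Nat.triangle_succ]
    convert mul_mul_mem_degPart (listOne_mul_self K _)
      (((listOne_comm_dotAt K (ν := ν) _ p).pow_right m).eq) (h3 m) h1 using 2
    push_cast
    ring

end Degrees

/-! ### Commutation of blocks of orthogonal colours -/

section Commutation

variable {I : Type*} {K : Type*} [Field K] {D : Datum I} {ν : Multiset (Color D)}

local notation "𝟙" => listOne K ν

/-- Diagrams without dots on disjoint groups of strands commute. -/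
theorem commute_wordSpan {F G : ℕ → KLR K ν} {q r p p' : ℕ} (hF : F ∈ wordSpan K ν q)
    (hG : G ∈ wordSpan K ν r) (h : p + q ≤ p') : Commute (F p) (G p') :=
  commute_of_mem_wordSpan hG fun _ h1 _ =>
    (commute_of_mem_wordSpan hF fun _ _ h2 => crossAt_comm K (by omega)).symm

/-- A matching of idempotents `e` and `e'` by elements of degree zero inverse to each other, which
intertwine the generators, gives an isomorphism of left ideals. -/
theorem iso_of_intertwine {P Q : ShiftedIdeal K ν} {e e' g g' : KLR K ν}
    (hP : P.elem * e = P.elem) (hQ : Q.elem * e' = Q.elem) (hQ' : e' * Q.elem = Q.elem)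
    (hg : e * g = g * e') (hg' : e' * g' = g' * e) (h₁ : e * (g * g') = e)
    (h₂ : e' * (g' * g) = e') (h : P.elem * g = g * Q.elem) (hs : P.shift = Q.shift)
    (hd : e * g ∈ degPart K ν 0) (hd' : e' * g' ∈ degPart K ν 0) : Iso P Q := by
  have h' : Q.elem * g' = e' * g' * P.elem := by
    calc Q.elem * g' = e' * (g' * g) * Q.elem * g' := by rw [h₂, hQ']
      _ = e' * g' * (P.elem * e * (g * g')) := by
        rw [hP, ← mul_assoc P.elem, h]; simp only [mul_assoc]
      _ = e' * g' * P.elem := by rw [mul_assoc P.elem, h₁, hP]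
  refine iso_of_mul (e * g) (e' * g') ?_ ?_ ?_ ?_ (by rwa [hs, sub_self]) (by rwa [hs, sub_self])
  · rw [← mul_assoc, hP, h]
    exact Submodule.smul_mem _ g (Submodule.mem_span_singleton_self _)
  · rw [← mul_assoc, hQ, h']
    exact Submodule.smul_mem _ (e' * g') (Submodule.mem_span_singleton_self _)
  · calc P.elem * (e * g * (e' * g')) = P.elem * e * (g * e' * g') := by simp only [mul_assoc]
      _ = P.elem * (e * (e * (g * g'))) := by rw [← hg]; simp only [mul_assoc]
      _ = P.elem := by rw [h₁, ← mul_assoc, hP, hP]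
  · calc Q.elem * (e' * g' * (e * g)) = Q.elem * e' * (g' * e * g) := by simp only [mul_assoc]
      _ = Q.elem * (e' * (e' * (g' * g))) := by rw [← hg']; simp only [mul_assoc]
      _ = Q.elem := by rw [h₂, ← mul_assoc, hQ, hQ]

theorem listOne_comm_of_mem_wordSpan_replicate {F : ℕ → KLR K ν} {c : Color D} {n : ℕ}
    (hF : F ∈ wordSpan K ν n) {A B : List (Color D)} {p : ℕ} (hp : A.length = p) :
    Commute (𝟙 (A ++ (List.replicate n c ++ B))) (F p) :=
  commute_of_mem_wordSpan hF fun _ h1 h2 => listOne_comm_crossAt_replicate hp h1 h2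

/-- Blocks with orthogonal colours commute: the crossing of the two blocks is invertible of degree
zero, and the diagrams carried by the blocks slide through it. -/
theorem iso_ideal_of_orthogonal {x y : Block D} {h : (colors ([x] ++ [y]) : Multiset _) = ν}
    {h' : (colors ([y] ++ [x]) : Multiset _) = ν} {c d : Color D} {l k : ℕ}
    (hx : x.colors = List.replicate l c) (hy : y.colors = List.replicate k d)
    (hx' : (fun p => x.elem K ν p) ∈ wordSpan K ν l)
    (hy' : (fun p => y.elem K ν p) ∈ wordSpan K ν k) (ha : D.a c.idx d.idx = 0) :
    Iso (ideal K ([x] ++ [y]) h) (ideal K ([y] ++ [x]) h') := by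
  have ha' : D.a d.idx c.idx = 0 := (D.a_eq_zero_comm _ _).1 ha
  have hxy : ∀ a ∈ List.replicate l c, ∀ b ∈ List.replicate k d, D.a a.idx b.idx = 0 := by
    intro a ha1 b hb
    rw [List.eq_of_mem_replicate ha1, List.eq_of_mem_replicate hb, ha]
  have hxy' : ∀ a ∈ List.replicate l c, ∀ b ∈ List.replicate k d, D.a b.idx a.idx = 0 :=
    fun a h1 b h2 => (D.a_eq_zero_comm _ _).1 (hxy a h1 b h2)
  have hns : ∀ a ∈ List.replicate l c, ∀ b ∈ List.replicate k d, ¬ SameReal a b := by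
    rintro a h1 b h2 ⟨h3, h4⟩
    have h5 := hxy a h1 b h2
    rw [← h3] at h5
    unfold Datum.IsReal at h4
    omega
  have c1 : colors ([x] ++ [y]) = [] ++ (List.replicate l c ++ (List.replicate k d ++ [])) := by
    simp [colors, hx, hy]
  have c2 : colors ([y] ++ [x]) = [] ++ (List.replicate k d ++ (List.replicate l c ++ [])) := by
    simp [colors, hx, hy]
  have e1 : (ideal K ([x] ++ [y]) h).elem = x.elem K ν 0 * y.elem K ν l *
      𝟙 ([] ++ (List.replicate l c ++ (List.replicate k d ++ []))) := by
    rw [← c1, listOne_of_eq K h]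
    simp [ideal, idem, blocksElem, hx]
  have e2 : (ideal K ([y] ++ [x]) h').elem = y.elem K ν 0 * x.elem K ν k *
      𝟙 ([] ++ (List.replicate k d ++ (List.replicate l c ++ []))) := by
    rw [← c2, listOne_of_eq K h']
    simp [ideal, idem, blocksElem, hy]
  have m1 := listOne_comm_of_mem_wordSpan_replicate (c := c) (A := []) (p := 0)
    (B := List.replicate k d ++ []) hx' rfl
  have m2 := listOne_comm_of_mem_wordSpan_replicate (c := d) (A := [] ++ List.replicate l c)
    (B := []) (p := l) hy' (by simp)
  have m3 := listOne_comm_of_mem_wordSpan_replicate (c := d) (A := []) (p := 0)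
    (B := List.replicate l c ++ []) hy' rfl
  have m4 := listOne_comm_of_mem_wordSpan_replicate (c := c) (A := [] ++ List.replicate k d)
    (B := []) (p := k) hx' (by simp)
  have s1 := listOne_mul_wordSpan_mul_blockCross_left (K := K) (ν := ν) (A := []) (B := []) (p := 0)
    hx' rfl List.length_replicate List.length_replicate hns
  have s2 := listOne_mul_wordSpan_mul_blockCross_right (K := K) (ν := ν) (A := []) (B := []) (p := 0)
    hy' rfl List.length_replicate List.length_replicate hns
  have hg := listOne_mul_blockCross (K := K) (ν := ν) (A := []) (B := []) (p := 0) rfl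
    (List.length_replicate (n := l) (a := c)) (List.length_replicate (n := k) (a := d))
  have hcomm := commute_wordSpan (p := 0) (p' := k) hy' hx' (by omega)
  simp only [List.append_assoc, zero_add] at m2 m4 s1 s2
  refine iso_of_intertwine (e := 𝟙 ([] ++ (List.replicate l c ++ (List.replicate k d ++ []))))
    (e' := 𝟙 ([] ++ (List.replicate k d ++ (List.replicate l c ++ []))))
    (g := blockCross K ν 0 l k) (g' := blockCrossInv K ν 0 l k) ?_ ?_ ?_ hg
    (listOne_mul_blockCrossInv rfl List.length_replicate List.length_replicate)
    (listOne_mul_blockCross_mul_blockCrossInv rfl List.length_replicate List.length_replicate hxy)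
    (listOne_mul_blockCrossInv_mul_blockCross rfl List.length_replicate List.length_replicate hxy')
    ?_ rfl
    (listOne_mul_blockCross_mem_degPart rfl List.length_replicate List.length_replicate hxy)
    (listOne_mul_blockCrossInv_mem_degPart rfl List.length_replicate List.length_replicate hxy)
  · rw [e1, mul_assoc, listOne_mul_self]
  · rw [e2, mul_assoc, listOne_mul_self]
  · rw [e2, ← ((m3.mul_right m4).eq), ← mul_assoc, listOne_mul_self]
  · rw [e1, e2, ← ((m3.mul_right m4).eq), ← ((m1.mul_right m2).eq), ← mul_assoc _ (𝟙 _), ← hg,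
      mul_assoc, mul_assoc, mul_mul_congr m1.eq s2, ← mul_assoc (x.elem K ν 0), ← mul_assoc, s1,
      ← mul_assoc, ← mul_assoc, mul_assoc _ _ (y.elem K ν 0), hcomm.symm.eq, ← mul_assoc]

end Commutation

/-! ### Divided differences of dots absorbed by a longest element -/

section Evaluation

variable {I : Type*} {K : Type*} [Field K] {D : Datum I} {ν : Multiset (Color D)}

local notation "𝟙" => listOne K ν
local notation "τ" => crossAt K ν
local notation "ξ" => dotAt K ν
local notation "δ" => descAt K ν
local notation "α" => ascAt K ν

theorem descAt_mem_wordSpan (l : ℕ) : (fun p => δ p l) ∈ wordSpan K ν (l + 1) := by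
  refine Submodule.subset_span ⟨(List.range l).reverse, by simp, ?_⟩
  ext p
  simp [descAt, List.range'_eq_map_range, Function.comp_def]

theorem ascAt_mem_wordSpan (l : ℕ) : (fun p => α p l) ∈ wordSpan K ν (l + 1) := by
  refine Submodule.subset_span ⟨List.range l, by simp, ?_⟩
  ext p
  simp [ascAt, List.range'_eq_map_range, Function.comp_def]

theorem dotAt_comm_descAt {k p l : ℕ} (h : k < p ∨ p + l < k) : Commute (ξ k) (δ p l) :=
  commute_descAt fun _ _ _ => dotAt_comm_crossAt K (by omega) (by omega)

theorem dotAt_comm_ascAt {k p l : ℕ} (h : k < p ∨ p + l < k) : Commute (ξ k) (α p l) :=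
  commute_ascAt fun _ _ _ => dotAt_comm_crossAt K (by omega) (by omega)

theorem dotPoly_comm {z : KLR K ν} {S : Set ℕ} {g : MvPolynomial ℕ K}
    (hg : g ∈ MvPolynomial.supported K S) (h : ∀ k ∈ S, Commute (ξ k) z) :
    Commute (dotPoly K ν g) z := by
  rw [MvPolynomial.supported] at hg
  induction hg using Algebra.adjoin_induction with
  | mem x hx =>
    obtain ⟨k, hk, rfl⟩ := hx
    rw [dotPoly_X]
    exact h k hk
  | algebraMap r =>
    rw [AlgHom.commutes]
    exact Algebra.commutes r z
  | add x y _ _ hx hy => rw [map_add]; exact hx.add_left hy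
  | mul x y _ _ hx hy => rw [map_mul]; exact hx.mul_left hy

variable {e e' z : KLR K ν} {p p' s t : ℕ} {S : Set ℕ} {f : MvPolynomial ℕ K}

/-- Only the leading term of a polynomial in the dots survives the divided difference `α p t`. -/
theorem IsNilHecke.mul_dotPoly_mul_asc (H : IsNilHecke e p (t + 1)) (hz : z * e = z)
    (h : ∀ k, p ≤ k → k < p + t → z * τ k = 0) (hS : ∀ k ∈ S, k < p ∨ p + t < k)
    (hf : f - MvPolynomial.X p ^ t ∈ lowSpan K p p S t) :
    z * dotPoly K ν f * α p t = z := by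
  have h1 : ∀ g ∈ lowSpan K p p S t, z * dotPoly K ν g * α p t = 0 := by
    intro g hg
    induction hg using Submodule.span_induction with
    | zero => rw [map_zero, mul_zero, zero_mul]
    | add x y _ _ hx hy => rw [map_add, mul_add, add_mul, hx, hy, add_zero]
    | smul c x _ hx => rw [map_smul, mul_smul_comm, smul_mul_assoc, hx, smul_zero]
    | mem x hx =>
      obtain ⟨i, j, g, hij, hg, rfl⟩ := hx
      have hc : Commute (dotPoly K ν g) (α p t) := dotPoly_comm hg fun k hk =>
        dotAt_comm_ascAt (by have := hS k hk; omega)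
      rw [← pow_add, map_mul, map_pow, dotPoly_X, mul_assoc, mul_assoc, hc.eq, ← mul_assoc,
        ← mul_assoc, H.mul_dot_pow_mul_asc hz h (by omega), if_neg (by omega), zero_mul]
  have h2 := H.mul_dot_pow_mul_asc hz h (c := t) le_rfl
  rw [if_pos rfl] at h2
  have h3 := h1 _ hf
  rw [map_sub, map_pow, dotPoly_X, mul_sub, sub_mul, h2] at h3
  exact sub_eq_zero.1 h3

/-- Only the leading term of a polynomial in the dots survives the divided difference `δ p s`. -/
theorem IsNilHecke.mul_dotPoly_mul_desc (H : IsNilHecke e p (s + 1)) (hz : z * e = z)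
    (h : ∀ k, p ≤ k → k < p + s → z * τ k = 0) (hS : ∀ k ∈ S, k < p ∨ p + s < k)
    (hf : f - MvPolynomial.X (p + s) ^ s ∈ lowSpan K (p + s) (p + s) S s) :
    z * dotPoly K ν f * δ p s = (-1 : K) ^ s • z := by
  have h1 : ∀ g ∈ lowSpan K (p + s) (p + s) S s, z * dotPoly K ν g * δ p s = 0 := by
    intro g hg
    induction hg using Submodule.span_induction with
    | zero => rw [map_zero, mul_zero, zero_mul]
    | add x y _ _ hx hy => rw [map_add, mul_add, add_mul, hx, hy, add_zero]
    | smul c x _ hx => rw [map_smul, mul_smul_comm, smul_mul_assoc, hx, smul_zero]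
    | mem x hx =>
      obtain ⟨i, j, g, hij, hg, rfl⟩ := hx
      have hc : Commute (dotPoly K ν g) (δ p s) := dotPoly_comm hg fun k hk =>
        dotAt_comm_descAt (by have := hS k hk; omega)
      rw [← pow_add, map_mul, map_pow, dotPoly_X, mul_assoc, mul_assoc, hc.eq, ← mul_assoc,
        ← mul_assoc, H.mul_dot_pow_mul_desc hz h (by omega), if_neg (by omega), zero_mul]
  have h2 := H.mul_dot_pow_mul_desc hz h (c := s) le_rfl
  rw [if_pos rfl] at h2
  have h3 := h1 _ hf
  rw [map_sub, map_pow, dotPoly_X, mul_sub, sub_mul, h2] at h3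
  exact sub_eq_zero.1 h3

theorem IsNilHecke.mul_dot_pow_mul_desc_asc (H : IsNilHecke e p (s + 1))
    (H' : IsNilHecke e p' (t + 1)) (hp : p + s < p') (hz : z * e = z)
    (h : ∀ k, p ≤ k → k < p + s → z * τ k = 0)
    (h' : ∀ k, p' ≤ k → k < p' + t → z * τ k = 0) {i j : ℕ} (hij : i + j ≤ s + t) :
    z * (ξ (p + s) ^ i * ξ p' ^ j) * (δ p s * α p' t) =
      if i = s ∧ j = t then (-1 : K) ^ s • z else 0 := by
  have c1 : Commute (ξ (p + s) ^ i) (ξ p' ^ j) :=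
    ((dotAt_comm K (p + s) p').pow_left i).pow_right j
  have c2 : Commute (ξ (p + s) ^ i) (α p' t) :=
    (dotAt_comm_ascAt (by omega)).pow_left i
  have c3 : Commute (ξ p' ^ j) (δ p s) :=
    (dotAt_comm_descAt (by omega)).pow_left j
  have c4 : Commute (δ p s) (α p' t) :=
    (commute_wordSpan (K := K) (ν := ν) (p := p) (p' := p') (descAt_mem_wordSpan s) (ascAt_mem_wordSpan t)
      (by omega) :)
  have h1 : z * (ξ (p + s) ^ i * ξ p' ^ j) * (δ p s * α p' t) =
      z * ξ (p + s) ^ i * δ p s * (ξ p' ^ j * α p' t) := by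
    simp only [mul_assoc]
    rw [c3.left_comm]
  have h2 : z * (ξ (p + s) ^ i * ξ p' ^ j) * (δ p s * α p' t) =
      z * ξ p' ^ j * α p' t * (ξ (p + s) ^ i * δ p s) := by
    rw [c1.eq, c4.eq]
    simp only [mul_assoc]
    rw [c2.left_comm]
  by_cases hi : i < s
  · rw [h1, H.mul_dot_pow_mul_desc hz h (by omega), if_neg (by omega), if_neg (by omega), zero_mul]
  · have hj := H'.mul_dot_pow_mul_asc hz h' (c := j) (by omega)
    by_cases hj' : j = t
    · obtain rfl : i = s := by omega
      rw [h2, hj, if_pos hj', ← mul_assoc, H.mul_dot_pow_mul_desc hz h le_rfl, if_pos rfl,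
        if_pos ⟨rfl, hj'⟩]
    · rw [h2, hj, if_neg hj', zero_mul, if_neg (by tauto)]

/-- Only the leading term of a polynomial in the dots survives the two divided differences. -/
theorem IsNilHecke.mul_dotPoly_mul_desc_asc (H : IsNilHecke e p (s + 1))
    (H' : IsNilHecke e p' (t + 1)) (hp : p + s < p') (hz : z * e = z)
    (h : ∀ k, p ≤ k → k < p + s → z * τ k = 0)
    (h' : ∀ k, p' ≤ k → k < p' + t → z * τ k = 0)
    (hS : ∀ k ∈ S, p + s < k ∧ k < p')
    (hf : f - geomPoly K (p + s) p' (s + t + 1) ∈ lowSpan K (p + s) p' S (s + t)) :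
    z * dotPoly K ν f * (δ p s * α p' t) = (-1 : K) ^ s • z := by
  have h1 : ∀ g ∈ lowSpan K (p + s) p' S (s + t),
      z * dotPoly K ν g * (δ p s * α p' t) = 0 := by
    intro g hg
    induction hg using Submodule.span_induction with
    | zero => rw [map_zero, mul_zero, zero_mul]
    | add x y _ _ hx hy => rw [map_add, mul_add, add_mul, hx, hy, add_zero]
    | smul c x _ hx => rw [map_smul, mul_smul_comm, smul_mul_assoc, hx, smul_zero]
    | mem x hx =>
      obtain ⟨i, j, g, hij, hg, rfl⟩ := hx
      have hc : Commute (dotPoly K ν g) (δ p s * α p' t) := dotPoly_comm hg fun k hk =>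
        (dotAt_comm_descAt (by have := hS k hk; omega)).mul_right
          (dotAt_comm_ascAt (by have := hS k hk; omega))
      rw [map_mul, map_mul, map_pow, map_pow, dotPoly_X, dotPoly_X, mul_assoc, mul_assoc, hc.eq,
        ← mul_assoc, ← mul_assoc, H.mul_dot_pow_mul_desc_asc H' hp hz h h' (by omega),
        if_neg (by omega), zero_mul]
  have h2 : z * dotPoly K ν (geomPoly K (p + s) p' (s + t + 1)) * (δ p s * α p' t) =
      (-1 : K) ^ s • z := by
    rw [geomPoly, map_sum, Finset.mul_sum, Finset.sum_mul, Finset.sum_eq_single_of_mem s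
      (Finset.mem_range.2 (by omega))]
    · rw [map_mul, map_pow, map_pow, dotPoly_X, dotPoly_X,
        H.mul_dot_pow_mul_desc_asc H' hp hz h h' (by omega), if_pos (by omega)]
    · intro i hi his
      rw [Finset.mem_range] at hi
      rw [map_mul, map_pow, map_pow, dotPoly_X, dotPoly_X,
        H.mul_dot_pow_mul_desc_asc H' hp hz h h' (by omega), if_neg (by omega)]
  have h3 := h1 _ hf
  rw [map_sub, mul_sub, sub_mul, h2] at h3
  exact sub_eq_zero.1 h3

end Evaluation

/-! ### The complex of the quantum Serre relation -/

section Serre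

variable {I : Type*} {K : Type*} [Field K] {D : Datum I} {ν : Multiset (Color D)}

local notation "𝟙" => listOne K ν
local notation "τ" => crossAt K ν
local notation "ξ" => dotAt K ν
local notation "δ" => descAt K ν
local notation "α" => ascAt K ν
local notation "ω₀" => longestAt K ν

/-- The sequence `c^a u c^b`.  The empty list at the end brings it into the form `A ++ (c^b ++ B)` in
which blocks of one colour are treated. -/
def serreSeq (c : Color D) (u : List (Color D)) (a b : ℕ) : List (Color D) :=
  List.replicate a c ++ (u ++ (List.replicate b c ++ []))

variable {c : Color D} {u : List (Color D)} {F : ℕ → KLR K ν} {a b : ℕ}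

theorem serreSeq_succ_left (c : Color D) (u : List (Color D)) (a b : ℕ) :
    serreSeq c u (a + 1) b = List.replicate a c ++ c :: (u ++ (List.replicate b c ++ [])) := by
  rw [serreSeq, List.replicate_succ']; simp

theorem isNilHecke_serreSeq_left (hc : D.IsReal c.idx) :
    IsNilHecke (𝟙 (serreSeq c u a b)) 0 a :=
  isNilHecke_listOne (A := []) rfl hc

theorem isNilHecke_serreSeq_right (hc : D.IsReal c.idx) :
    IsNilHecke (𝟙 (serreSeq c u a b)) (a + u.length) b := by
  have := isNilHecke_listOne (K := K) (ν := ν) (A := List.replicate a c ++ u) (B := []) (m := b)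
    (p := a + u.length) (by simp) hc
  rwa [List.append_assoc] at this

theorem listOne_serreSeq_mul_desc : 𝟙 (serreSeq c u a (b + 1)) * δ a u.length =
    δ a u.length * 𝟙 (serreSeq c u (a + 1) b) := by
  rw [serreSeq_succ_left]
  exact listOne_mul_descAt List.length_replicate rfl

theorem listOne_serreSeq_mul_asc : 𝟙 (serreSeq c u (a + 1) b) * α a u.length =
    α a u.length * 𝟙 (serreSeq c u a (b + 1)) := by
  rw [serreSeq_succ_left]
  exact listOne_mul_ascAt List.length_replicate rfl

variable (c u F a b) in
/-- The product of the longest elements on both powers of `c` in `c^a u c^b` and of the diagram `F`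
on the strands `u`.  The left ideal which it generates is, up to a shift, `P_{c^{(a)} u c^{(b)}}`. -/
noncomputable def serreElem : KLR K ν :=
  𝟙 (serreSeq c u a b) * (ω₀ 0 a * (ω₀ (a + u.length) b * F a))

/-- The conditions on the colour `c`, the middle colours `u` and the diagram `F` on the strands `u`
under which the Serre relation is derived.  As `F` is not required to be idempotent, no property of
the symmetrizers beyond these is needed. -/
structure SerreData (K : Type*) [Field K] (ν : Multiset (Color D)) (c : Color D)
    (u : List (Color D)) (F : ℕ → KLR K ν) : Prop where
  isReal : D.IsReal c.idx
  ne : ∀ d ∈ u, d.idx ≠ c.idx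
  mem : F ∈ wordSpan K ν u.length
  comm : ∀ A B : List (Color D), Commute (listOne K ν (A ++ (u ++ B))) (F A.length)

variable (S : SerreData K ν c u F)
include S

theorem SerreData.comm_serreSeq : Commute (𝟙 (serreSeq c u a b)) (F a) := by
  have := S.comm (List.replicate a c) (List.replicate b c ++ [])
  rwa [List.length_replicate] at this

theorem SerreData.comm_left : Commute (𝟙 (serreSeq c u a b)) (ω₀ 0 a) :=
  (isNilHecke_serreSeq_left S.isReal).comm_wordSpan (F := fun p => ω₀ p a) (longestAt_mem_wordSpan a) le_rfl le_rfl

theorem SerreData.comm_right : Commute (𝟙 (serreSeq c u a b)) (ω₀ (a + u.length) b) :=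
  (isNilHecke_serreSeq_right S.isReal).comm_wordSpan (F := fun p => ω₀ p b)
    (longestAt_mem_wordSpan b) le_rfl le_rfl

theorem SerreData.mul_listOne :
    serreElem c u F a b * 𝟙 (serreSeq c u a b) = serreElem c u F a b := by
  rw [serreElem, (S.comm_left.mul_right (S.comm_right.mul_right S.comm_serreSeq)).eq, mul_assoc,
    listOne_mul_self]

theorem SerreData.mul_cross_left {k : ℕ} (hk : k + 1 < a) : serreElem c u F a b * τ k = 0 := by
  have c1 : Commute (τ k) (ω₀ (a + u.length) b * F a) :=
    (commute_of_mem_wordSpan (F := fun p => ω₀ p b) (longestAt_mem_wordSpan b) fun j _ _ =>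
      crossAt_comm K (by omega)).mul_right (commute_of_mem_wordSpan S.mem fun j _ _ =>
      crossAt_comm K (by omega))
  have h1 : serreElem c u F a b * τ k =
      𝟙 (serreSeq c u a b) * ω₀ 0 a * τ k * (ω₀ (a + u.length) b * F a) := by
    rw [serreElem, mul_assoc, mul_assoc, ← c1.eq]
    simp only [mul_assoc]
  rw [h1, (isNilHecke_serreSeq_left S.isReal).longest_mul_cross (by omega) (by omega), zero_mul]

theorem SerreData.mul_cross_right {k : ℕ} (hk : a + u.length ≤ k)
    (hk' : k + 1 < a + u.length + b) : serreElem c u F a b * τ k = 0 := by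
  have c1 : Commute (τ k) (F a) := commute_of_mem_wordSpan S.mem fun j _ _ =>
      crossAt_comm K (by omega)
  rw [serreElem, mul_assoc, mul_assoc, mul_assoc, ← c1.eq, ← mul_assoc, S.comm_left.eq, mul_assoc,
    ← mul_assoc _ (τ k), ← mul_assoc (𝟙 _), ← mul_assoc (𝟙 _),
    (isNilHecke_serreSeq_right S.isReal).longest_mul_cross hk hk', zero_mul, mul_zero]

/-- The differential takes the left ideal of `c^a u c^{b+1}` to that of `c^{a+1} u c^b`. -/
theorem SerreData.mul_desc : serreElem c u F a (b + 1) * δ 0 (a + u.length) =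
    δ (a + u.length) b * δ a u.length * serreElem c u F (a + 1) b := by
  have f1 : 𝟙 (serreSeq c u a (b + 1)) * (F a * δ a u.length) =
      𝟙 (serreSeq c u a (b + 1)) * (δ a u.length * F (a + 1)) :=
    listOne_mul_wordSpan_mul_descAt S.mem List.length_replicate rfl
      fun d hd => not_sameReal_of_ne (S.ne d hd)
  have f1' : 𝟙 (serreSeq c u a (b + 1)) * (F a * (δ a u.length * δ 0 a)) =
      𝟙 (serreSeq c u a (b + 1)) * (δ a u.length * (F (a + 1) * δ 0 a)) := by
    rw [← mul_assoc (F a), ← mul_assoc, f1]; simp only [mul_assoc]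
  have f2 := (isNilHecke_serreSeq_right (K := K) (ν := ν) (c := c) (u := u) (a := a) (b := b + 1)
    S.isReal).longest_succ_desc le_rfl
  have c3 : Commute (ω₀ 0 a) (δ (a + u.length) b) :=
    (commute_wordSpan (K := K) (ν := ν) (p := 0) (p' := a + u.length) (longestAt_mem_wordSpan a) (descAt_mem_wordSpan b)
      (by omega) :)
  have c4 : Commute (ω₀ 0 a) (δ a u.length) :=
    (commute_wordSpan (K := K) (ν := ν) (p := 0) (p' := a) (longestAt_mem_wordSpan a) (descAt_mem_wordSpan u.length)
      (by omega) :)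
  have c5 : Commute (δ a u.length) (ω₀ (a + u.length + 1) b) :=
    (commute_wordSpan (K := K) (ν := ν) (p := a) (p' := a + u.length + 1) (descAt_mem_wordSpan u.length) (longestAt_mem_wordSpan b)
      (by omega) :)
  have c6 : Commute (δ 0 a) (F (a + 1)) :=
    (commute_wordSpan (K := K) (ν := ν) (p := 0) (p' := a + 1) (descAt_mem_wordSpan a) S.mem
      (by omega) :)
  have c7 : Commute (δ 0 a) (ω₀ (a + u.length + 1) b) :=
    (commute_wordSpan (K := K) (ν := ν) (p := 0) (p' := a + u.length + 1) (descAt_mem_wordSpan a) (longestAt_mem_wordSpan b)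
      (by omega) :)
  have c8 : Commute (𝟙 (serreSeq c u a (b + 1))) (δ (a + u.length) b) :=
    (isNilHecke_serreSeq_right S.isReal).comm_desc le_rfl
  have h1 : δ 0 (a + u.length) = δ a u.length * δ 0 a := by
    rw [descAt_add, zero_add]
  have h2 : 𝟙 (serreSeq c u a (b + 1)) *
      (ω₀ (a + u.length) (b + 1) * (δ a u.length * (F (a + 1) * δ 0 a))) =
      𝟙 (serreSeq c u a (b + 1)) * (δ (a + u.length) b * (ω₀ (a + u.length + 1) b *
        (δ a u.length * (F (a + 1) * δ 0 a)))) := by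
    rw [← mul_assoc, f2]; simp only [mul_assoc]
  have h3 : δ (a + u.length) b * δ a u.length * 𝟙 (serreSeq c u (a + 1) b) =
      𝟙 (serreSeq c u a (b + 1)) * (δ (a + u.length) b * δ a u.length) := by
    rw [mul_assoc, ← listOne_serreSeq_mul_desc, ← mul_assoc, ← c8.eq, mul_assoc]
  rw [serreElem, serreElem, ← mul_assoc (δ _ _ * δ _ _), h3, h1]
  simp only [mul_assoc]
  rw [mul_mul_congr S.comm_left.eq (mul_mul_congr S.comm_right.eq f1'),
    mul_mul_congr S.comm_left.eq h2, c3.left_comm, ← c5.left_comm, c4.left_comm, ← c6.eq,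
    ← c7.left_comm, show a + 1 + u.length = a + u.length + 1 by omega, longestAt]
  simp only [mul_assoc]

/-- The homotopy takes the left ideal of `c^{a+1} u c^b` to that of `c^a u c^{b+1}`. -/
theorem SerreData.mul_asc : serreElem c u F (a + 1) b * α a (u.length + b) =
    α 0 a * α a u.length * serreElem c u F a (b + 1) := by
  have f1 : 𝟙 (serreSeq c u (a + 1) b) * (F (a + 1) * α a u.length) =
      𝟙 (serreSeq c u (a + 1) b) * (α a u.length * F a) := by
    rw [serreSeq_succ_left]
    exact listOne_mul_wordSpan_mul_ascAt S.mem List.length_replicate rfl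
      fun d hd => not_sameReal_of_ne (S.ne d hd)
  have f1' : 𝟙 (serreSeq c u (a + 1) b) * (F (a + 1) * (α a u.length * α (a + u.length) b)) =
      𝟙 (serreSeq c u (a + 1) b) * (α a u.length * (F a * α (a + u.length) b)) := by
    rw [← mul_assoc (F _), ← mul_assoc, f1]; simp only [mul_assoc]
  have f2 := (isNilHecke_serreSeq_right (K := K) (ν := ν) (c := c) (u := u) (a := a) (b := b + 1)
    S.isReal).longest_succ_asc' le_rfl
  have c3 : Commute (F a) (α (a + u.length) b) :=
    (commute_wordSpan (K := K) (ν := ν) (p := a) (p' := a + u.length) S.mem (ascAt_mem_wordSpan b)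
      (by omega) :)
  have c4 : Commute (ω₀ 0 a) (α a u.length) :=
    (commute_wordSpan (K := K) (ν := ν) (p := 0) (p' := a) (longestAt_mem_wordSpan a) (ascAt_mem_wordSpan u.length)
      (by omega) :)
  have c5 : Commute (α a u.length) (ω₀ (a + u.length + 1) b) :=
    (commute_wordSpan (K := K) (ν := ν) (p := a) (p' := a + u.length + 1) (ascAt_mem_wordSpan u.length) (longestAt_mem_wordSpan b)
      (by omega) :)
  have c8 : Commute (𝟙 (serreSeq c u (a + 1) b)) (α 0 a) :=
    (isNilHecke_serreSeq_left S.isReal).comm_asc le_rfl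
  have h3 : α 0 a * α a u.length * 𝟙 (serreSeq c u a (b + 1)) =
      𝟙 (serreSeq c u (a + 1) b) * (α 0 a * α a u.length) := by
    rw [mul_assoc, ← listOne_serreSeq_mul_asc, ← mul_assoc, ← c8.eq, mul_assoc]
  have h2 : 𝟙 (serreSeq c u a (b + 1)) * (ω₀ (a + u.length) (b + 1) * F a) =
      𝟙 (serreSeq c u a (b + 1)) *
        (ω₀ (a + u.length + 1) b * (α (a + u.length) b * F a)) := by
    rw [← mul_assoc, f2]; simp only [mul_assoc]
  rw [serreElem, serreElem, mul_mul_congr S.comm_left.eq h2, ← mul_assoc (α _ _ * α _ _), h3,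
    ascAt_add]
  simp only [mul_assoc]
  have h4 := mul_mul_congr (S.comm_left (a := a + 1) (b := b)).eq
    (mul_mul_congr (S.comm_right (a := a + 1) (b := b)).eq f1')
  rw [h4, show a + 1 + u.length = a + u.length + 1 by omega, ← c5.left_comm, longestAt_succ_asc,
    mul_assoc (α 0 a), c4.left_comm, c3.eq]

/-- The differential has square zero: moving two strands across produces their crossing `τ_a`, which
slides back through `u` to the right hand power and is absorbed there. -/
theorem SerreData.mul_desc_mul_desc : serreElem c u F a (b + 2) *
    (δ 0 (a + u.length) * δ 0 (a + 1 + u.length)) = 0 := by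
  have e1 : δ 0 (a + u.length) = δ a u.length * δ 0 a := by rw [descAt_add, zero_add]
  have e2 : δ 0 (a + 1 + u.length) = δ (a + 1) u.length * δ 0 (a + 1) := by
    rw [descAt_add, zero_add]
  have c1 : Commute (δ 0 a) (δ (a + 1) u.length) :=
    (commute_wordSpan (K := K) (ν := ν) (p := 0) (p' := a + 1) (descAt_mem_wordSpan a) (descAt_mem_wordSpan u.length)
      (by omega) :)
  have h1 : 𝟙 (serreSeq c u (a + 2) b) * (δ 0 a * δ 0 (a + 1)) =
      𝟙 (serreSeq c u (a + 2) b) * (τ a * (δ 0 a * δ 1 a)) := by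
    rw [(isNilHecke_serreSeq_left S.isReal).wordSpan_mul_desc (l := a + 1) le_rfl
      (descAt_mem_wordSpan a), descAt_succ 0 a, zero_add, mul_assoc (τ a)]
  have h2 := mul_mul_congr (listOne_serreSeq_mul_desc (K := K) (ν := ν) (c := c) (u := u) (a := a)
    (b := b + 1)) (mul_mul_congr listOne_serreSeq_mul_desc h1)
  have h3 : 𝟙 (serreSeq c u a (b + 2)) * τ (a + u.length) *
      (δ a u.length * δ (a + 1) u.length) =
      𝟙 (serreSeq c u a (b + 2)) * (δ a u.length * δ (a + 1) u.length) * τ a :=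
    listOne_mul_crossAt_mul_descAt_descAt List.length_replicate rfl
      fun d hd => not_sameReal_of_ne (S.ne d hd)
  have h4 : 𝟙 (serreSeq c u a (b + 2)) * (δ 0 (a + u.length) * δ 0 (a + 1 + u.length)) =
      𝟙 (serreSeq c u a (b + 2)) * (τ (a + u.length) * (δ a u.length * δ (a + 1) u.length *
        (δ 0 a * δ 1 a))) := by
    rw [e1, e2, mul_assoc, c1.left_comm, h2, ← mul_assoc (δ a _), ← mul_assoc (δ a _ * _),
      ← mul_assoc, ← mul_assoc (𝟙 _) _ (τ a), ← h3]
    simp only [mul_assoc]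
  rw [mul_congr_of_absorb S.mul_listOne h4, ← mul_assoc,
    S.mul_cross_right le_rfl (by omega), zero_mul]

/-- The homotopy has square zero, by the mirror image of `SerreData.mul_desc_mul_desc`. -/
theorem SerreData.mul_asc_mul_asc : serreElem c u F (a + 2) b *
    (α (a + 1) (u.length + b) * α a (u.length + (b + 1))) = 0 := by
  have c1 : Commute (α a u.length) (α (a + u.length + 1) b) :=
    (commute_wordSpan (K := K) (ν := ν) (p := a) (p' := a + u.length + 1) (ascAt_mem_wordSpan u.length) (ascAt_mem_wordSpan b)
      (by omega) :)
  have h1 : 𝟙 (serreSeq c u a (b + 2)) * (α (a + u.length + 1) b * α (a + u.length) (b + 1)) =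
      𝟙 (serreSeq c u a (b + 2)) * (τ (a + u.length) *
        (α (a + u.length + 1) b * α (a + u.length) b)) := by
    rw [(isNilHecke_serreSeq_right S.isReal).wordSpan_mul_asc (l := b + 1) le_rfl
      (ascAt_mem_wordSpan b), ascAt_succ' (a + u.length) b, mul_assoc (τ _)]
  have h2 := mul_mul_congr (listOne_serreSeq_mul_asc (K := K) (ν := ν) (c := c) (u := u)
    (a := a + 1) (b := b)) (mul_mul_congr listOne_serreSeq_mul_asc h1)
  have h3 : 𝟙 (serreSeq c u (a + 2) b) * (α (a + 1) u.length * α a u.length) * τ (a + u.length) =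
      𝟙 (serreSeq c u (a + 2) b) * τ a * (α (a + 1) u.length * α a u.length) := by
    have : serreSeq c u (a + 2) b =
        List.replicate a c ++ c :: c :: (u ++ (List.replicate b c ++ [])) := by
      rw [serreSeq, List.replicate_add]; simp [List.replicate_succ]
    rw [this]
    exact listOne_mul_ascAt_ascAt_mul_crossAt List.length_replicate rfl
      fun d hd => not_sameReal_of_ne (S.ne d hd)
  have h4 : 𝟙 (serreSeq c u (a + 2) b) * (α (a + 1) (u.length + b) *
      α a (u.length + (b + 1))) = 𝟙 (serreSeq c u (a + 2) b) * (τ a *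
        (α (a + 1) u.length * α a u.length *
          (α (a + u.length + 1) b * α (a + u.length) b))) := by
    rw [ascAt_add, ascAt_add, show a + 1 + u.length = a + u.length + 1 by omega, mul_assoc,
      ← c1.left_comm, h2, ← mul_assoc (α (a + 1) _), ← mul_assoc (α (a + 1) _ * _),
      ← mul_assoc, ← mul_assoc (𝟙 _) _ (τ _), h3]
    simp only [mul_assoc]
  rw [mul_congr_of_absorb S.mul_listOne h4, ← mul_assoc,
    S.mul_cross_left (by omega), zero_mul]

/-- The contracting homotopy in the middle of the complex: the two composites differ by the correction
term of the braid relation, whose leading form has degree `a + b`. -/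
theorem SerreData.mul_homotopy (h : crossDegree c u = a + b + 1) :
    serreElem c u F (a + 1) (b + 1) * (α a (u.length + (b + 1)) * δ 0 (a + u.length)) -
      serreElem c u F (a + 1) (b + 1) * (δ 0 (a + 1 + u.length) * α (a + 1) (u.length + b)) =
    (-1 : K) ^ a • serreElem c u F (a + 1) (b + 1) := by
  have e1 : δ 0 (a + u.length) = δ a u.length * δ 0 a := by rw [descAt_add, zero_add]
  have e2 : δ 0 (a + 1 + u.length) = δ (a + 1) u.length * (τ a * δ 0 a) := by
    rw [descAt_add, zero_add, descAt_succ, zero_add]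
  have e3 : α a (u.length + (b + 1)) =
      α a u.length * (τ (a + u.length) * α (a + u.length + 1) b) := by
    rw [ascAt_add, ascAt_succ']
  have e4 : α (a + 1) (u.length + b) = α (a + 1) u.length * α (a + u.length + 1) b := by
    rw [ascAt_add, show a + 1 + u.length = a + u.length + 1 by omega]
  have c1 : Commute (δ a u.length) (α (a + u.length + 1) b) :=
    (commute_wordSpan (K := K) (ν := ν) (p := a) (p' := a + u.length + 1) (descAt_mem_wordSpan u.length) (ascAt_mem_wordSpan b)
      (by omega) :)
  have c2 : Commute (δ 0 a) (α (a + u.length + 1) b) :=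
    (commute_wordSpan (K := K) (ν := ν) (p := 0) (p' := a + u.length + 1) (descAt_mem_wordSpan a) (ascAt_mem_wordSpan b)
      (by omega) :)
  have c3 : Commute (δ 0 a) (α (a + 1) u.length) :=
    (commute_wordSpan (K := K) (ν := ν) (p := 0) (p' := a + 1) (descAt_mem_wordSpan a) (ascAt_mem_wordSpan u.length)
      (by omega) :)
  have hb : 𝟙 (serreSeq c u (a + 1) (b + 1)) *
      (α a u.length * τ (a + u.length) * δ a u.length) =
      𝟙 (serreSeq c u (a + 1) (b + 1)) * (δ (a + 1) u.length * τ a * α (a + 1) u.length +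
        dotPoly K ν (braidPoly K c a (a + u.length + 1) (a + 1) u)) := by
    rw [serreSeq_succ_left]
    exact listOne_mul_braid_eq List.length_replicate rfl S.isReal S.ne
  have hb' := mul_congr_of_absorb S.mul_listOne hb
  have h1 : α a (u.length + (b + 1)) * δ 0 (a + u.length) =
      α a u.length * τ (a + u.length) * δ a u.length * (δ 0 a * α (a + u.length + 1) b) := by
    rw [e1, e3, c2.eq]
    simp only [mul_assoc]
    rw [← c1.left_comm]
  have h2 : δ 0 (a + 1 + u.length) * α (a + 1) (u.length + b) =
      δ (a + 1) u.length * τ a * α (a + 1) u.length * (δ 0 a * α (a + u.length + 1) b) := by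
    rw [e2, e4]
    simp only [mul_assoc]
    rw [c3.left_comm]
  have hl := braidPoly_sub_mem_lowSpan (K := K) (x := a) (y := a + u.length + 1) (u := u)
    (p := a + 1) (S := {k | a < k ∧ k < a + u.length + 1}) S.isReal S.ne
    (fun k h1 h2 => ⟨by omega, by omega⟩)
  have hr := (isNilHecke_serreSeq_right (K := K) (ν := ν) (c := c) (u := u) (a := a + 1)
    (b := b + 1) S.isReal)
  rw [show a + 1 + u.length = a + u.length + 1 by omega] at hr
  have := (isNilHecke_serreSeq_left (K := K) (ν := ν) (c := c) (u := u) (a := a + 1)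
    (b := b + 1) S.isReal).mul_dotPoly_mul_desc_asc (s := a) (t := b) hr (by omega)
    S.mul_listOne (fun k _ h2 => S.mul_cross_left (by omega))
    (fun k h1 h2 => S.mul_cross_right (by omega) (by omega))
    (S := {k | a < k ∧ k < a + u.length + 1}) (fun k hk => by rw [zero_add]; exact hk)
    (f := braidPoly K c a (a + u.length + 1) (a + 1) u) (by
      rw [h] at hl
      rw [zero_add]
      convert hl using 2
      push_cast
      ring)
  rw [h1, h2, ← this, ← mul_assoc _ (α a u.length * τ (a + u.length) * δ a u.length), hb',
    ← mul_assoc _ (δ (a + 1) u.length * τ a * α (a + 1) u.length), ← sub_mul, mul_add,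
    add_sub_cancel_left]

/-- The contracting homotopy at the start of the complex, where the composite is a double crossing. -/
theorem SerreData.mul_homotopy_first (h : crossDegree c u = b) :
    serreElem c u F 0 (b + 1) * (δ 0 (0 + u.length) * α 0 (u.length + b)) =
      serreElem c u F 0 (b + 1) := by
  have hb : 𝟙 (serreSeq c u 0 (b + 1)) * (δ 0 u.length * α 0 u.length) =
      𝟙 (serreSeq c u 0 (b + 1)) * dotPoly K ν (doubleListPoly K c (0 + u.length) 0 u) :=
    listOne_mul_descAt_mul_ascAt_eq (A := []) rfl rfl S.ne
  have hb' := mul_congr_of_absorb S.mul_listOne hb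
  have hl := doubleListPoly_sub_mem_lowSpan (K := K) (x := 0 + u.length) (y := 0 + u.length)
    (u := u) (p := 0) (S := {k | k < 0 + u.length}) S.isReal S.ne (fun k h1 h2 => h2)
  rw [h] at hl
  have := (isNilHecke_serreSeq_right (K := K) (ν := ν) (c := c) (u := u) (a := 0)
    (b := b + 1) S.isReal).mul_dotPoly_mul_asc S.mul_listOne
    (fun k h1 h2 => S.mul_cross_right h1 (by omega)) (fun k hk => Or.inl hk) hl
  rw [ascAt_add, ← mul_assoc (δ _ _), ← mul_assoc, zero_add, hb']
  rwa [zero_add] at this ⊢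

/-- The contracting homotopy at the end of the complex. -/
theorem SerreData.mul_homotopy_last (h : crossDegree c u = a) :
    serreElem c u F (a + 1) 0 * (α a (u.length + 0) * δ 0 (a + u.length)) =
      (-1 : K) ^ a • serreElem c u F (a + 1) 0 := by
  have hb : 𝟙 (serreSeq c u (a + 1) 0) * (α a u.length * δ a u.length) =
      𝟙 (serreSeq c u (a + 1) 0) * dotPoly K ν (doubleListPoly K c a (a + 1) u) := by
    rw [serreSeq_succ_left]
    exact listOne_mul_ascAt_mul_descAt_eq List.length_replicate rfl S.ne
  have hb' := mul_congr_of_absorb S.mul_listOne hb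
  have hl := doubleListPoly_sub_mem_lowSpan (K := K) (x := a) (y := a)
    (u := u) (p := a + 1) (S := {k | a < k}) S.isReal S.ne (fun k h1 h2 => h1)
  rw [h] at hl
  have := (isNilHecke_serreSeq_left (K := K) (ν := ν) (c := c) (u := u) (a := a + 1)
    (b := 0) S.isReal).mul_dotPoly_mul_desc (s := a) (S := {k | a < k}) S.mul_listOne
    (fun k _ h2 => S.mul_cross_left (by omega))
    (fun k hk => Or.inr (by rw [zero_add]; exact hk)) (by rw [zero_add]; exact hl)
  rw [descAt_add, zero_add, add_zero, ← mul_assoc (α _ _), ← mul_assoc, hb', this]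

end Serre

/-! ### The projectives of the Serre relation -/

section Projectives

variable {I : Type*} {K : Type*} [Field K] {D : Datum I} {ν : Multiset (Color D)}

local notation "𝟙" => listOne K ν
local notation "τ" => crossAt K ν
local notation "ξ" => dotAt K ν
local notation "δ" => descAt K ν
local notation "α" => ascAt K ν
local notation "ω₀" => longestAt K ν

theorem blocksElem_append (p : ℕ) (v w : List (Block D)) :
    blocksElem K ν p (v ++ w) = blocksElem K ν p v * blocksElem K ν (p + (colors v).length) w := by
  induction v generalizing p with
  | nil => simp [blocksElem, colors]
  | cons x v ih =>
    rw [List.cons_append, blocksElem, blocksElem, ih, mul_assoc]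
    simp [colors, add_assoc]

theorem psi_nilHeckeAt (p m : ℕ) :
    psi K (nilHeckeAt K ν p m) = psi K (ω₀ p m) * staircaseAt K ν p m := by
  rw [nilHeckeAt_eq, psi_mul, psi_staircaseAt]

theorem colors_serreWord (i : I) (hi : D.IsReal i) (U : List (Block D)) (a b : ℕ) :
    colors (serreWord i hi U a b) = serreSeq (Color.real i hi) (colors U) a b := by
  simp [colors, serreWord, serreSeq, Block.colors]

variable {c : Color D} {u : List (Color D)} {F : ℕ → KLR K ν} {a b : ℕ}

/-- The flip turns `x^{staircase} τ_{w₀}` into `τ_{w₀} x^{staircase}`. -/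
theorem SerreData.psi_eq (S : SerreData K ν c u F) :
    𝟙 (serreSeq c u a b) * (psi K (nilHeckeAt K ν (a + u.length) b) * F a *
      psi K (nilHeckeAt K ν 0 a)) =
    serreElem c u F a b * (staircaseAt K ν 0 a * staircaseAt K ν (a + u.length) b) := by
  have hl := isNilHecke_serreSeq_left (K := K) (ν := ν) (u := u) (a := a) (b := b) S.isReal
  have hr := isNilHecke_serreSeq_right (K := K) (ν := ν) (u := u) (a := a) (b := b) S.isReal
  have hdot : ∀ p m, Commute (𝟙 (serreSeq c u a b)) (staircaseAt K ν p m) := fun p m =>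
    commute_staircaseAt fun k _ _ => hl.comm_dot k
  have h1 : 𝟙 (serreSeq c u a b) * (psi K (ω₀ 0 a) * staircaseAt K ν 0 a) =
      𝟙 (serreSeq c u a b) * (ω₀ 0 a * staircaseAt K ν 0 a) := by
    rw [← mul_assoc, hl.mul_psi_longest, mul_assoc]
  have c1 : Commute (F a) (staircaseAt K ν (a + u.length) b) :=
    commute_staircaseAt fun k _ _ => (commute_of_mem_wordSpan S.mem fun j _ _ =>
      dotAt_comm_crossAt K (by omega) (by omega)).symm
  have c2 : Commute (ω₀ 0 a) (staircaseAt K ν (a + u.length) b) :=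
    commute_staircaseAt fun k _ _ => (commute_of_mem_wordSpan (F := fun p => ω₀ p a)
      (longestAt_mem_wordSpan a) fun j _ _ => dotAt_comm_crossAt K (by omega) (by omega)).symm
  have c3 : Commute (staircaseAt K ν 0 a) (staircaseAt K ν (a + u.length) b) :=
    commute_staircaseAt fun k _ _ =>
      (commute_staircaseAt fun j _ _ => dotAt_comm K k j).symm
  have c4 : Commute (ω₀ 0 a) (ω₀ (a + u.length) b) :=
    (commute_wordSpan (K := K) (ν := ν) (p := 0) (p' := a + u.length) (longestAt_mem_wordSpan a)
      (longestAt_mem_wordSpan b) (by omega) :)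
  have c5 : Commute (ω₀ 0 a) (F a) :=
    (commute_wordSpan (p := 0) (p' := a) (longestAt_mem_wordSpan a) S.mem (by omega) :)
  rw [psi_nilHeckeAt, psi_nilHeckeAt]
  simp only [mul_assoc]
  rw [← mul_assoc, hr.mul_psi_longest, mul_assoc, mul_mul_congr S.comm_right.eq
    (mul_mul_congr (hdot _ _).eq (mul_mul_congr S.comm_serreSeq.eq h1)), serreElem, c3.eq]
  simp only [mul_assoc]
  rw [← c1.left_comm, ← c2.left_comm, ← c5.left_comm, ← c4.left_comm]

theorem SerreData.mul_staircase (S : SerreData K ν c u F) :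
    serreElem c u F a b * (staircaseAt K ν 0 a * staircaseAt K ν (a + u.length) b *
      (ω₀ 0 a * ω₀ (a + u.length) b)) = serreElem c u F a b := by
  have c2 : Commute (ω₀ 0 a) (staircaseAt K ν (a + u.length) b) :=
    commute_staircaseAt fun k _ _ => (commute_of_mem_wordSpan (F := fun p => ω₀ p a)
      (longestAt_mem_wordSpan a) fun j _ _ => dotAt_comm_crossAt K (by omega) (by omega)).symm
  have h1 : staircaseAt K ν 0 a * staircaseAt K ν (a + u.length) b *
      (ω₀ 0 a * ω₀ (a + u.length) b) =
      staircaseAt K ν 0 a * ω₀ 0 a * (staircaseAt K ν (a + u.length) b * ω₀ (a + u.length) b) := by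
    simp only [mul_assoc]
    rw [c2.left_comm]
  rw [h1, ← mul_assoc, (isNilHecke_serreSeq_left S.isReal).mul_staircase_mul_longest S.mul_listOne
    fun k _ h => S.mul_cross_left (by omega),
    (isNilHecke_serreSeq_right S.isReal).mul_staircase_mul_longest S.mul_listOne
    fun k h h' => S.mul_cross_right h h']

variable (D) in
/-- `⟨i^{(a)} u i^{(b)}⟩` for `u` without divided powers. -/
def serreShift (i : I) (a b : ℕ) : ℤ :=
  ((a * (a - 1) / 2 : ℕ) : ℤ) * D.r i + ((b * (b - 1) / 2 : ℕ) : ℤ) * D.r i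

theorem listOne_mul_longest_mem_degPart (hc : D.IsReal c.idx) :
    𝟙 (serreSeq c u a b) * (ω₀ 0 a * ω₀ (a + u.length) b) ∈
      degPart K ν (-(2 * serreShift D c.idx a b)) := by
  have h1 := listOne_mul_longestAt_mem_degPart (K := K) (ν := ν) (A := [])
    (B := u ++ (List.replicate b c ++ [])) (p := 0) hc rfl a
  have h2 := listOne_mul_longestAt_mem_degPart (K := K) (ν := ν) (A := List.replicate a c ++ u)
    (B := []) (p := a + u.length) hc (by simp) b
  have h3 : Commute (𝟙 (serreSeq c u a b)) (ω₀ 0 a) :=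
    (isNilHecke_serreSeq_left hc).comm_wordSpan (F := fun p => ω₀ p a)
      (longestAt_mem_wordSpan a) le_rfl le_rfl
  rw [List.append_assoc] at h2
  convert mul_mul_mem_degPart (listOne_mul_self K _) h3.eq h1 h2 using 1
  rw [serreShift]
  congr 1
  ring

theorem listOne_mul_staircase_mem_degPart :
    𝟙 (serreSeq c u a b) * (staircaseAt K ν 0 a * staircaseAt K ν (a + u.length) b) ∈
      degPart K ν (2 * serreShift D c.idx a b) := by
  have h1 := listOne_mul_staircaseAt_mem_degPart (K := K) (ν := ν) (A := []) (c := c)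
    (B := u ++ (List.replicate b c ++ [])) (p := 0) rfl a
  have h2 := listOne_mul_staircaseAt_mem_degPart (K := K) (ν := ν) (A := List.replicate a c ++ u)
    (B := []) (p := a + u.length) (c := c) (by simp) b
  have h3 : Commute (𝟙 (serreSeq c u a b)) (staircaseAt K ν 0 a) :=
    commute_staircaseAt fun k _ _ => listOne_comm_dotAt K _ k
  rw [List.append_assoc] at h2
  convert mul_mul_mem_degPart (listOne_mul_self K _) h3.eq h1 h2 using 1
  rw [serreShift]
  congr 1
  ring

/-- Up to isomorphism the staircases of dots in `ψ(1_w)` can be dropped.  The degrees of the staircases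
add up to `2⟨w⟩`, which changes the shift from `-⟨w⟩` to `⟨w⟩`. -/
theorem iso_proj_serreElem {i : I} {hi : D.IsReal i} {U : List (Block D)}
    (h : (colors (serreWord i hi U a b) : Multiset (Color D)) = ν) (hU : blockShift U = 0)
    (S : SerreData K ν (Color.real i hi) (colors U) fun p => psi K (blocksElem K ν p U)) :
    Iso (proj K (serreWord i hi U a b) h)
      ⟨serreElem (Color.real i hi) (colors U) (fun p => psi K (blocksElem K ν p U)) a b,
        serreShift D i a b⟩ := by
  have h1 : (proj K (serreWord i hi U a b) h).elem =
      serreElem (Color.real i hi) (colors U) (fun p => psi K (blocksElem K ν p U)) a b *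
        (staircaseAt K ν 0 a * staircaseAt K ν (a + (colors U).length) b) := by
    rw [← S.psi_eq, ← colors_serreWord, listOne_of_eq K h]
    change psi K (idem K _ h) = _
    rw [idem, psi_mul, psi_gen]
    congr 1
    rw [serreWord, blocksElem_append, blocksElem_append, psi_mul, psi_mul, ← mul_assoc]
    simp [blocksElem, Block.elem, colors, Block.colors]
  have h2 : (proj K (serreWord i hi U a b) h).shift = -serreShift D i a b := by
    change -blockShift _ = _
    have : blockShift (serreWord i hi U a b) = ((a * (a - 1) / 2 : ℕ) : ℤ) * D.r i +
        (blockShift U + ((b * (b - 1) / 2 : ℕ) : ℤ) * D.r i) := by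
      simp [blockShift, serreWord]
    rw [this, hU, zero_add, serreShift]
  have h3 := S.mul_staircase (a := a) (b := b)
  have h4 := S.mul_listOne (a := a) (b := b)
  have h5 : Commute (𝟙 (serreSeq (Color.real i hi) (colors U) a b))
      (staircaseAt K ν 0 a * staircaseAt K ν (a + (colors U).length) b) :=
    (commute_staircaseAt fun k _ _ => listOne_comm_dotAt K _ k).mul_right
      (commute_staircaseAt fun k _ _ => listOne_comm_dotAt K _ k)
  set Z := serreElem (Color.real i hi) (colors U) (fun p => psi K (blocksElem K ν p U)) a b
  set E := 𝟙 (serreSeq (Color.real i hi) (colors U) a b) with hE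
  set s := staircaseAt K ν 0 a * staircaseAt K ν (a + (colors U).length) b
  set w := ω₀ 0 a * ω₀ (a + (colors U).length) b
  have h6 : Z * s * (E * w) = Z := by
    rw [← mul_assoc (Z * s) E w, mul_assoc Z s E, ← h5.eq, ← mul_assoc Z E s, h4, mul_assoc Z s w,
      h3]
  have h7 : Z * (E * s) = Z * s := by rw [← mul_assoc, h4]
  refine iso_of_mul (E * w) (E * s) ?_ ?_ ?_ ?_ ?_ ?_
  · rw [h1, h6]
    exact Submodule.mem_span_singleton_self _
  · rw [h7, h1]
    exact Submodule.mem_span_singleton_self _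
  · rw [h1, ← mul_assoc, h6, h7]
  · change Z * _ = Z
    rw [← mul_assoc, h7, h6]
  · rw [h2]
    convert listOne_mul_longest_mem_degPart (K := K) (ν := ν) (u := colors U) (a := a) (b := b)
      (c := Color.real i hi) hi using 1
    change degPart K ν (-serreShift D i a b - serreShift D i a b) =
      degPart K ν (-(2 * serreShift D i a b))
    congr 1
    ring
  · rw [h2]
    convert listOne_mul_staircase_mem_degPart (K := K) (ν := ν) (u := colors U) (a := a) (b := b)
      (c := Color.real i hi) using 1
    change degPart K ν (serreShift D i a b - -serreShift D i a b) =
      degPart K ν (2 * serreShift D i a b)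
    congr 1
    ring

/-! ### The quantum Serre relations -/

theorem listOne_serreSeq_mul_descAt_zero : 𝟙 (serreSeq c u a (b + 1)) * δ 0 (a + u.length) =
    δ 0 (a + u.length) * 𝟙 (serreSeq c u (a + 1) b) := by
  have h := listOne_mul_descAt (K := K) (ν := ν) (A := []) (u := List.replicate a c ++ u)
    (b := c) (B := List.replicate b c ++ []) (p := 0) (l := a + u.length) rfl (by simp)
  rw [List.append_assoc, List.append_assoc] at h
  exact h

theorem listOne_serreSeq_mul_ascAt_add : 𝟙 (serreSeq c u (a + 1) b) * α a (u.length + b) =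
    α a (u.length + b) * 𝟙 (serreSeq c u a (b + 1)) := by
  have h := listOne_mul_ascAt (K := K) (ν := ν) (A := List.replicate a c)
    (u := u ++ List.replicate b c) (b := c) (B := []) (p := a) (l := u.length + b)
    List.length_replicate (by simp)
  rw [serreSeq_succ_left]
  rw [List.append_assoc, List.append_assoc] at h
  rw [h, serreSeq, List.replicate_succ']
  simp

theorem crossDeg_self (hc : D.IsReal c.idx) : crossDeg c c = -(2 * D.r c.idx) := by
  have hcm : c.mult = 1 := c.mult_eq_one (by
    unfold Datum.IsNeg; unfold Datum.IsReal at hc; omega)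
  rw [crossDeg, hcm, show D.a c.idx c.idx = 2 from hc]
  push_cast
  ring

theorem sum_crossDeg (hc : D.IsReal c.idx) (hu : ∀ d ∈ u, d.idx ≠ c.idx) :
    (u.map fun d => crossDeg d c).sum = D.r c.idx * crossDegree c u := by
  have hcm : c.mult = 1 := c.mult_eq_one (by
    unfold Datum.IsNeg; unfold Datum.IsReal at hc; omega)
  induction u with
  | nil => simp [crossDegree]
  | cons d u ih =>
    have h1 : 0 ≤ -((d.mult : ℤ) * D.a c.idx d.idx) := by
      have := D.offDiag c.idx d.idx (hu d (by simp)).symm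
      have := mul_nonneg (Int.natCast_nonneg d.mult) (neg_nonneg.2 this)
      linarith
    rw [List.map_cons, List.sum_cons, ih fun x hx => hu x (by simp [hx]), crossDegree_cons,
      crossDeg_comm, crossDeg, hcm, Nat.cast_add, Int.toNat_of_nonneg h1]
    push_cast
    ring

/-- The differential is homogeneous: `b - a` is the difference of `a (a - 1) / 2 + (b + 1) b / 2` and
`(a + 1) a / 2 + b (b - 1) / 2`. -/
theorem SerreData.desc_mem_degPart (S : SerreData K ν c u F) (h : crossDegree c u = a + b) :
    𝟙 (serreSeq c u a (b + 1)) * δ 0 (a + u.length) ∈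
      degPart K ν (serreShift D c.idx a (b + 1) - serreShift D c.idx (a + 1) b) := by
  have h1 := listOne_mul_descAt_mem_degPart (K := K) (ν := ν) (A := [])
    (u := List.replicate a c ++ u) (b := c) (B := List.replicate b c ++ []) (p := 0)
    (l := a + u.length) rfl (by simp)
  rw [List.append_assoc, List.map_append, List.sum_append, sum_crossDeg S.isReal S.ne,
    List.map_replicate, List.sum_replicate, crossDeg_self S.isReal, h] at h1
  have h2 : 𝟙 (serreSeq c u a (b + 1)) * δ 0 (a + u.length) ∈ _ := h1
  convert h2 using 1
  rw [serreShift, serreShift, Nat.triangle_succ, Nat.triangle_succ, nsmul_eq_mul]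
  congr 1
  push_cast
  ring

theorem SerreData.asc_mem_degPart (S : SerreData K ν c u F) (h : crossDegree c u = a + b) :
    𝟙 (serreSeq c u (a + 1) b) * α a (u.length + b) ∈
      degPart K ν (serreShift D c.idx (a + 1) b - serreShift D c.idx a (b + 1)) := by
  have h1 := listOne_mul_ascAt_mem_degPart (K := K) (ν := ν) (A := List.replicate a c)
    (u := u ++ List.replicate b c) (b := c) (B := []) (p := a) (l := u.length + b)
    List.length_replicate (by simp)
  rw [List.append_assoc, List.map_append, List.sum_append, sum_crossDeg S.isReal S.ne,
    List.map_replicate, List.sum_replicate, crossDeg_self S.isReal, h] at h1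
  rw [serreSeq_succ_left]
  convert h1 using 1
  rw [serreShift, serreShift, Nat.triangle_succ, Nat.triangle_succ, nsmul_eq_mul]
  congr 1
  push_cast
  ring

/-- The intermediate idempotents in a product of two maps can be dropped. -/
theorem mul_chain {R : Type*} [Semigroup R] {z e e' x : R} (hz : z * e = z) (he : e' * e' = e')
    (h : e * x = x * e') (y : R) : z * (e * x * (e' * y)) = z * (x * y) := by
  rw [h, mul_assoc x, ← mul_assoc e', he, ← mul_assoc x, ← h, mul_assoc e, ← mul_assoc z, hz]

/-- The Serre relation for arbitrary middle blocks without divided powers.  The index `a` of the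
complex is the length of the left hand power of `i`. -/
theorem serreIso_of_serreData {i : I} {hi : D.IsReal i} {U : List (Block D)} {m : ℕ}
    (hU : blockShift U = 0) (hm : crossDegree (Color.real i hi) (colors U) + 1 = m)
    (S : SerreData K (serreClass i hi U m) (Color.real i hi) (colors U)
      fun p => psi K (blocksElem K (serreClass i hi U m) p U)) :
    SerreIso K i hi U m := by
  set c := Color.real i hi with hc
  set u := colors U with hu
  set ν := serreClass i hi U m with hν
  set F : ℕ → KLR K ν := fun p => psi K (blocksElem K ν p U) with hF
  let P : ℕ → ShiftedIdeal K ν := fun a => ⟨serreElem c u F a (m - a), serreShift D i a (m - a)⟩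
  let d : ℕ → KLR K ν := fun a =>
    listOne K ν (serreSeq c u a (m - a)) * descAt K ν 0 (a + u.length)
  let d' : ℕ → KLR K ν := fun a =>
    listOne K ν (serreSeq c u (a + 1) (m - (a + 1))) * ascAt K ν a (u.length + (m - (a + 1)))
  -- `d` carries the strand at position `a + |u|` to position `0`, and `d'` the strand at position `a`
  -- to the last position
  have key : SumIso (fun c : {c : ℕ // 2 * c ≤ m} => P (2 * c))
      (fun c : {c : ℕ // 2 * c + 1 ≤ m} => P (2 * c + 1)) := by
    refine sumIso_of_homotopy m P d d' ?_ ?_ ?_ ?_ ?_ ?_ ?_ (by omega) ?_ ?_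
    · intro a ha
      obtain ⟨b, hb⟩ : ∃ b, m - a = b + 1 := ⟨m - a - 1, by omega⟩
      have hb' : m - (a + 1) = b := by omega
      simp only [P, d, hb, hb']
      rw [← mul_assoc, S.mul_listOne, S.mul_desc]
      exact Submodule.smul_mem _ _ (Submodule.mem_span_singleton_self _)
    · intro a ha
      obtain ⟨b, hb⟩ : ∃ b, m - a = b + 1 := ⟨m - a - 1, by omega⟩
      have hb' : m - (a + 1) = b := by omega
      simp only [P, d', hb, hb']
      rw [← mul_assoc, S.mul_listOne, S.mul_asc]
      exact Submodule.smul_mem _ _ (Submodule.mem_span_singleton_self _)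
    · intro a ha
      obtain ⟨b, hb⟩ : ∃ b, m - a = b + 2 := ⟨m - a - 2, by omega⟩
      have hb' : m - (a + 1) = b + 1 := by omega
      simp only [P, d, hb, hb']
      rw [mul_chain S.mul_listOne (listOne_mul_self K _) listOne_serreSeq_mul_descAt_zero,
        S.mul_desc_mul_desc]
    · intro a ha
      obtain ⟨b, hb⟩ : ∃ b, m - (a + 2) = b := ⟨_, rfl⟩
      have hb' : m - (a + 1) = b + 1 := by omega
      simp only [P, d', hb, hb', add_assoc, Nat.reduceAdd]
      rw [mul_chain S.mul_listOne (listOne_mul_self K _) listOne_serreSeq_mul_ascAt_add,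
        S.mul_asc_mul_asc]
    · intro a ha
      obtain ⟨b, hb⟩ : ∃ b, m - (a + 1) = b + 1 := ⟨m - a - 2, by omega⟩
      have hb' : m - a = b + 2 := by omega
      have hb'' : m - (a + 1 + 1) = b := by omega
      simp only [P, d, d', hb, hb', hb'']
      rw [mul_chain S.mul_listOne (listOne_mul_self K _) listOne_serreSeq_mul_ascAt_add,
        mul_chain S.mul_listOne (listOne_mul_self K _) listOne_serreSeq_mul_descAt_zero,
        S.mul_homotopy (by omega)]
    · intro _
      obtain ⟨b, hb⟩ : ∃ b, m - 0 = b + 1 := ⟨m - 1, by omega⟩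
      have hb' : m - (0 + 1) = b := by omega
      simp only [P, d, d', hb, hb']
      rw [mul_chain S.mul_listOne (listOne_mul_self K _) listOne_serreSeq_mul_descAt_zero,
        S.mul_homotopy_first (by omega)]
    · intro a ha
      have hb : m - a = 1 := by omega
      have hb' : m - (a + 1) = 0 := by omega
      have hb'' : P m = P (a + 1) := by rw [ha]
      rw [hb'']
      simp only [P, d, d', hb, hb']
      rw [mul_chain S.mul_listOne (listOne_mul_self K _)
        (listOne_serreSeq_mul_ascAt_add (b := 0)), S.mul_homotopy_last (by omega)]
    · intro a ha
      obtain ⟨b, hb⟩ : ∃ b, m - a = b + 1 := ⟨m - a - 1, by omega⟩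
      have hb' : m - (a + 1) = b := by omega
      simp only [P, d, hb, hb']
      exact S.desc_mem_degPart (by omega)
    · intro a ha
      obtain ⟨b, hb⟩ : ∃ b, m - a = b + 1 := ⟨m - a - 1, by omega⟩
      have hb' : m - (a + 1) = b := by omega
      simp only [P, d', hb, hb']
      exact S.asc_mem_degPart (by omega)
  exact ((sumIso_of_iso fun x => iso_proj_serreElem _ hU S).trans key).trans
    (sumIso_of_iso fun x => iso_proj_serreElem _ hU S).symm

theorem blocksElem_replicate_strand (p n : ℕ) (c : Color D) :
    blocksElem K ν p (List.replicate n (.strand c)) = 1 := by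
  induction n generalizing p with
  | zero => rfl
  | succ n ih => rw [List.replicate_succ, blocksElem, ih, mul_one]; rfl

theorem colors_replicate_strand (n : ℕ) (c : Color D) :
    colors (List.replicate n (.strand c)) = List.replicate n c := by
  induction n with
  | zero => rfl
  | succ n ih =>
    rw [List.replicate_succ, List.replicate_succ, ← ih]
    rfl

theorem crossDegree_replicate (c d : Color D) (n : ℕ) :
    crossDegree c (List.replicate n d) = n * (-((d.mult : ℤ) * D.a c.idx d.idx)).toNat := by
  simp [crossDegree]

theorem serreIso_replicate_strand {i : I} {hi : D.IsReal i} {d : Color D} (hd : i ≠ d.idx)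
    {n m : ℕ} (hm : (m : ℤ) = 1 - n * (d.mult * D.a i d.idx)) :
    SerreIso K i hi (List.replicate n (.strand d)) m := by
  have h1 : 0 ≤ -((d.mult : ℤ) * D.a i d.idx) := by
    have := mul_nonneg (Int.natCast_nonneg d.mult) (neg_nonneg.2 (D.offDiag i d.idx hd))
    linarith
  refine serreIso_of_serreData ?_ ?_ ⟨hi, ?_, ?_, ?_⟩
  · simp [blockShift]
  · rw [colors_replicate_strand, crossDegree_replicate]
    zify
    rw [show (Color.real i hi).idx = i from rfl, Int.toNat_of_nonneg h1, hm]
    ring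
  · intro x hx
    rw [colors_replicate_strand] at hx
    rw [List.eq_of_mem_replicate hx]
    exact hd.symm
  · simp only [blocksElem_replicate_strand, psi_one]
    exact one_mem_wordSpan _
  · intro A B
    simp only [blocksElem_replicate_strand, psi_one]
    exact Commute.one_right _

theorem serreIso_symm {i j : I} {hi : D.IsReal i} {hj : D.IsZero j} (h : i ≠ j)
    {n m : ℕ} (hm : (m : ℤ) = 1 - n * D.a i j) :
    SerreIso K i hi [.symm j hj n] m := by
  have h1 : 0 ≤ -D.a i j := neg_nonneg.2 (D.offDiag i j h)
  have h2 : colors [.symm j hj n] = List.replicate n (Color.zero j hj) := by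
    simp [colors, Block.colors]
  have h3 : (fun p => psi K (blocksElem K (serreClass i hi [.symm j hj n] m) p [.symm j hj n])) ∈
      wordSpan K _ n := by
    refine psi_mem_wordSpan (F := fun p => blocksElem K _ p [.symm j hj n]) ?_
    simpa [blocksElem, Block.elem] using symmetrizerAt_mem_wordSpan n
  refine serreIso_of_serreData ?_ ?_ ⟨hi, ?_, ?_, ?_⟩
  · simp [blockShift]
  · rw [h2, crossDegree_replicate]
    zify
    rw [show (Color.real i hi).idx = i from rfl, show (Color.zero j hj).idx = j from rfl,
      show (Color.zero j hj).mult = 1 from rfl, Nat.cast_one, one_mul, Int.toNat_of_nonneg h1, hm]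
    ring
  · intro x hx
    rw [h2] at hx
    rw [List.eq_of_mem_replicate hx]
    exact h.symm
  · rwa [h2, List.length_replicate]
  · intro A B
    rw [h2]
    exact listOne_comm_of_mem_wordSpan_replicate h3 rfl

end Projectives
end BorcherdsKLR

open BorcherdsKLR

theorem mainTheorem7 {K : Type*} [Field K] [IsAlgClosed K] [CharZero K]
    {I : Type*} [Finite I] (D : Datum I) :
    -- quantum Serre relations, with middle part `j^n`, `(j, n)`, `e_{j,n}` respectively
    (∀ (i j : I) (hi : D.IsReal i), i ≠ j → ∀ (n m : ℕ) (hn : 0 < n),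
      (m : ℤ) = 1 - n * D.a i j →
        (∀ hj : D.IsReal j, SerreIso K i hi (List.replicate n (.strand (.real j hj))) m) ∧
        (∀ hj : D.IsNeg j, SerreIso K i hi [.strand (.neg j hj n hn)] m) ∧
        (∀ hj : D.IsZero j, SerreIso K i hi [.symm j hj n] m)) ∧
    -- commutation relations for `a i j = 0`
    (∀ b c : Color D, D.a b.idx c.idx = 0 →
      Iso (ideal K ([.strand b] ++ [.strand c]) rfl)
        (ideal K ([.strand c] ++ [.strand b]) (colors_swap _ _))) ∧
    (∀ (i : I) (hi : D.IsZero i) (l : ℕ) (c : Color D), D.a i c.idx = 0 →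
      Iso (ideal K ([.symm i hi l] ++ [.strand c]) rfl)
        (ideal K ([.strand c] ++ [.symm i hi l]) (colors_swap _ _))) ∧
    (∀ (i j : I) (hi : D.IsZero i) (hj : D.IsZero j) (l k : ℕ), D.a i j = 0 →
      Iso (ideal K ([.symm i hi l] ++ [.symm j hj k]) rfl)
        (ideal K ([.symm j hj k] ++ [.symm i hi l]) (colors_swap _ _))) := by
  refine ⟨fun i j hi hij n m hn hm => ⟨fun hj => ?_, fun hj => ?_, fun hj => ?_⟩, ?_, ?_, ?_⟩
  · refine serreIso_replicate_strand hij ?_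
    simpa [Color.real] using hm
  · refine serreIso_replicate_strand (n := 1) hij ?_
    simpa [Color.neg] using hm
  · exact serreIso_symm hij hm
  · intro b c h
    exact iso_ideal_of_orthogonal (c := b) (d := c) (l := 1) (k := 1) rfl rfl (one_mem_wordSpan _)
      (one_mem_wordSpan _) h
  · intro i hi l c h
    exact iso_ideal_of_orthogonal (c := Color.zero i hi) (d := c) (l := l) (k := 1) rfl rfl
      (symmetrizerAt_mem_wordSpan l) (one_mem_wordSpan _) h
  · intro i j hi hj l k h
    exact iso_ideal_of_orthogonal (c := Color.zero i hi) (d := Color.zero j hj) (l := l) (k := k)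
      rfl rfl (symmetrizerAt_mem_wordSpan l) (symmetrizerAt_mem_wordSpan k) h
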